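/- For a finite group $G$ and a prime $p$ let $r(p,G)$ be the number of conjugacy classes of $G$ whose elements have order $p^d$ for some $d\ge 1$. Let $W_X$ denote the Weyl group of type $X$, that is, the group of automorphisms of the root lattice $\bigoplus_i \mathbb{Z}\alpha_i$ generated by the simple reflections $s_j(v)=v-\langle v,\alpha_j^\vee\rangle\alpha_j$, where $(\langle\alpha_i,\alpha_j^\vee\rangle)_{i,j}$ is the Cartan matrix of type $X$. Then: - $r(2,W_{D_4})=10$, $r(3,W_{D_4})=1$; - $r(2,W_{F_4})=13$, $r(3,W_{F_4})=3$; - $r(2,W_{G_2})=3$, $r(3,W_{G_2})=1$; - $r(2,W_{E_6})=9$, $r(3,W_{E_6})=4$, $r(5,W_{E_6})=1$; - $r(2,W_{E_7})=23$, $r(3,W_{E_7})=4$, $r(5,W_{E_7})=1$, $r(7,W_{E_7})=1$; - $r(2,W_{E_8})=31$, $r(3,W_{E_8})=6$, $r(5,W_{E_8})=2$, $r(7,W_{E_8})=1$; and in each of the six cases $r(p,W_X)=0$ for every prime $p$ not listed for that type. -/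

import Mathlib

/-- `r(p, G)`: the number of conjugacy classes `C` of `G` whose elements have order `p ^ d` for
some `d ≥ 1`.  The value lies in `ℕ∞`, so an infinite number of classes would be counted as `⊤`. -/
noncomputable def pPowerClassCount (p : ℕ) (G : Type*) [Group G] : ℕ∞ :=
  Set.encard {C : ConjClasses G | ∀ g ∈ C.carrier, ∃ d : ℕ, 1 ≤ d ∧ orderOf g = p ^ d}

/-- For a Cartan matrix `A` with entries `A i j = ⟨αᵢ, αⱼ^∨⟩`, and with the root lattice
`⨁ ℤ αᵢ` identified with `I → ℤ` (so that `αᵢ` is `Pi.single i 1`), this is the simple coroot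
`αⱼ^∨` as a linear form: `v ↦ ∑ i, v i * A i j`. -/
def simpleCoroot {I : Type*} [Fintype I] (A : Matrix I I ℤ) (j : I) : Module.Dual ℤ (I → ℤ) :=
  ∑ i, A i j • LinearMap.proj i

theorem simpleCoroot_apply {I : Type*} [Fintype I] (A : Matrix I I ℤ) (j : I) (v : I → ℤ) :
    simpleCoroot A j v = ∑ i, v i * A i j := by
  simp [simpleCoroot, mul_comm]

theorem simpleCoroot_single {I : Type*} [Fintype I] [DecidableEq I] (A : Matrix I I ℤ) (i j : I) :
    simpleCoroot A j (Pi.single i 1) = A i j := by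
  simp [simpleCoroot_apply, Pi.single_apply]

/-- The simple reflection `v ↦ v - ⟨v, αⱼ^∨⟩ αⱼ` of the root lattice. -/
def simpleReflection {I : Type*} [Fintype I] [DecidableEq I] (A : Matrix I I ℤ)
    (hA : ∀ i, A i i = 2) (j : I) :
    (I → ℤ) ≃ₗ[ℤ] (I → ℤ) :=
  Module.reflection (x := (Pi.single j 1 : I → ℤ)) (f := simpleCoroot A j)
    ((simpleCoroot_single A j j).trans (hA j))

/-- The Weyl group of a Cartan matrix: the group of automorphisms of the root lattice generated
by the simple reflections. -/
def cartanWeylGroup {I : Type*} [Fintype I] [DecidableEq I] (A : Matrix I I ℤ)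
    (hA : ∀ i, A i i = 2) :
    Subgroup ((I → ℤ) ≃ₗ[ℤ] (I → ℤ)) :=
  Subgroup.closure (Set.range (simpleReflection A hA))

namespace WeylComparison

/-- If `G` and `H` act by linear automorphisms on `M` and `L`, and `L → M` is an additive injection
with spanning image that intertwines two families of automorphisms, then the two families generate
isomorphic groups. -/
theorem nonempty_closure_mulEquiv {K M L J : Type*} [Field K] [AddCommGroup M] [Module K M]
    [AddCommGroup L] (f : L →+ M) (hf : Function.Injective f)
    (hspan : Submodule.span K (Set.range f) = ⊤)
    (s : J → M ≃ₗ[K] M) (t : J → L ≃ₗ[ℤ] L) (h : ∀ j v, s j (f v) = f (t j v)) :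
    Nonempty (Subgroup.closure (Set.range s) ≃* Subgroup.closure (Set.range t)) := by
  let D : Subgroup ((M ≃ₗ[K] M) × (L ≃ₗ[ℤ] L)) :=
    Subgroup.closure (Set.range fun j => (s j, t j))
  have hD : ∀ g ∈ D, ∀ v, g.1 (f v) = f (g.2 v) := by
    intro g hg
    induction hg using Subgroup.closure_induction with
    | mem x hx => obtain ⟨j, rfl⟩ := hx; exact h j
    | one => intro v; rfl
    | mul x y _ _ hx hy =>
      intro v
      change x.1 (y.1 (f v)) = f (x.2 (y.2 v))
      rw [hy, hx]
    | inv x _ hx =>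
      intro v
      change x.1.symm (f v) = f (x.2.symm v)
      rw [LinearEquiv.symm_apply_eq, hx, LinearEquiv.apply_symm_apply]
  have h1 : D.map (MonoidHom.fst _ _) = Subgroup.closure (Set.range s) := by
    rw [MonoidHom.map_closure, ← Set.range_comp]; rfl
  have h2 : D.map (MonoidHom.snd _ _) = Subgroup.closure (Set.range t) := by
    rw [MonoidHom.map_closure, ← Set.range_comp]; rfl
  have i1 : Function.Injective ((MonoidHom.fst (M ≃ₗ[K] M) (L ≃ₗ[ℤ] L)).subgroupMap D) := by
    rw [injective_iff_map_eq_one]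
    rintro ⟨g, hg⟩ hg1
    have e1 : g.1 = 1 := congrArg Subtype.val hg1
    have e2 : g.2 = 1 := by
      ext v
      apply hf
      rw [← hD g hg v, e1]; rfl
    exact Subtype.ext (Prod.ext e1 e2)
  have i2 : Function.Injective ((MonoidHom.snd (M ≃ₗ[K] M) (L ≃ₗ[ℤ] L)).subgroupMap D) := by
    rw [injective_iff_map_eq_one]
    rintro ⟨g, hg⟩ hg1
    have e2 : g.2 = 1 := congrArg Subtype.val hg1
    have e1 : g.1 = 1 := by
      apply LinearEquiv.toLinearMap_injective
      refine LinearMap.ext_on hspan ?_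
      rintro _ ⟨v, rfl⟩
      change g.1 (f v) = f v
      rw [hD g hg v, e2]; rfl
    exact Subtype.ext (Prod.ext e1 e2)
  exact ⟨(MulEquiv.subgroupCongr h1).symm.trans <|
    (MulEquiv.ofBijective _ ⟨i1, MonoidHom.subgroupMap_surjective _ D⟩).symm.trans <|
    (MulEquiv.ofBijective _ ⟨i2, MonoidHom.subgroupMap_surjective _ D⟩).trans <|
    MulEquiv.subgroupCongr h2⟩

/-- The reflections in the simple roots generate all reflections. -/
theorem closure_reflection_eq {ι K M N : Type*} [Field K] [CharZero K] [AddCommGroup M]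
    [Module K M] [AddCommGroup N] [Module K N] {P : RootPairing ι K M N} [Finite ι]
    [P.IsCrystallographic] [P.IsReduced] (b : P.Base) :
    Subgroup.closure (Set.range P.reflection) =
      Subgroup.closure (Set.range fun i : b.support => P.reflection i) := by
  refine le_antisymm ((Subgroup.closure_le _).2 ?_) (Subgroup.closure_mono ?_)
  · rintro _ ⟨i, rfl⟩
    have h1 : ∀ i ∈ b.support, P.reflection i ∈
        Subgroup.closure (Set.range fun i : b.support => P.reflection i) :=
      fun i hi => Subgroup.subset_closure ⟨⟨i, hi⟩, rfl⟩
    refine b.induction_reflect i (p := fun i => P.reflection i ∈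
      Subgroup.closure (Set.range fun i : b.support => P.reflection i)) ?_ h1 ?_
    · intro i hi
      rw [RootPairing.reflection_reflectionPerm]
      exact mul_mem (mul_mem hi hi) hi
    · intro i j hi hj
      rw [RootPairing.reflection_reflectionPerm]
      exact mul_mem (mul_mem (h1 j hj) hi) (h1 j hj)
  · rintro _ ⟨i, rfl⟩
    exact ⟨_, rfl⟩

/-- Consistency with Mathlib: the Weyl group of a reduced crystallographic root system is
isomorphic to the group attached above to its Cartan matrix with respect to a base. -/
theorem nonempty_weylGroup_mulEquiv {ι K M N : Type*} [Field K] [CharZero K] [AddCommGroup M]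
    [Module K M] [AddCommGroup N] [Module K N] {P : RootPairing ι K M N} [Finite ι]
    [DecidableEq ι] [P.IsCrystallographic] [P.IsReduced] [P.IsRootSystem] (b : P.Base) :
    Nonempty (P.weylGroup ≃*
      cartanWeylGroup b.cartanMatrix (fun i => b.cartanMatrix_apply_same i)) := by
  let B := b.toWeightBasis
  let f : (b.support → ℤ) →+ M :=
    { toFun := fun v => ∑ i, (v i : K) • B i
      map_zero' := by simp
      map_add' := fun v w => by simp [add_smul, Finset.sum_add_distrib] }
  have hfB : ∀ v, f v = ∑ i, (v i : K) • B i := fun v => rfl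
  have hfs : ∀ i, f (Pi.single i 1) = B i := fun i => by
    rw [hfB, Finset.sum_eq_single i] <;> simp +contextual
  have hf : Function.Injective f := by
    intro v w hvw
    ext i
    have := congrArg (fun m => B.repr m i) hvw
    simp only [hfB, Module.Basis.repr_sum_self] at this
    exact_mod_cast this
  have hspan : Submodule.span K (Set.range f) = ⊤ := by
    rw [eq_top_iff, ← B.span_eq]
    apply Submodule.span_mono
    rintro _ ⟨i, rfl⟩
    exact ⟨_, hfs i⟩
  obtain ⟨E⟩ := nonempty_closure_mulEquiv (K := K) f hf hspan
    (fun i : b.support => P.reflection i)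
    (simpleReflection b.cartanMatrix (fun i => b.cartanMatrix_apply_same i)) (by
      intro j v
      rw [simpleReflection, Module.reflection_apply, map_sub, map_zsmul, hfs,
        RootPairing.reflection_apply, b.toWeightBasis_apply, simpleCoroot_apply]
      congr 1
      rw [← Int.cast_smul_eq_zsmul K]
      congr 1
      rw [hfB, map_sum]
      push_cast
      refine Finset.sum_congr rfl fun i _ => ?_
      have hA : ((b.cartanMatrix i j : ℤ) : K) = P.pairing i j :=
        b.algebraMap_cartanMatrixIn_apply ℤ i j
      rw [map_smul, b.toWeightBasis_apply, P.root_coroot'_eq_pairing, smul_eq_mul, hA])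
  have e1 : P.weylGroup ≃* ((RootPairing.Equiv.weightHom P).domRestrict P.weylGroup).range :=
    MonoidHom.ofInjective fun x y hxy =>
      Subtype.ext (RootPairing.Equiv.weightHom_injective P hxy)
  exact ⟨e1.trans <| (MulEquiv.subgroupCongr
    (P.range_weylGroup_weightHom.trans (closure_reflection_eq b))).trans E⟩

end WeylComparison

/-! The Weyl group is never enumerated. For each type there is an explicit list of words in
reflections, with their orders, and kernel evaluation verifies three facts: every element is
conjugate to a listed word; each word has the stated order; the words whose order is a nontrivial
power of 2, 3, 5 or 7 are pairwise non-conjugate. For these four primes `r(p, W)` is then the number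
of listed orders `p ^ d` with `d ≥ 1`. It is zero for every prime that does not divide a common
multiple of the listed orders. `pPowerClassCount_weyl` assembles this.

Covering (`exists_conj_of_forall_letter`). The table of reflections is permuted by conjugation.
Suppose that a family `R` contains the identity and that, for all `r` in `R` and all reflections `t`
of the table, `r t` is conjugate to a member of `R`. If `g` is conjugate to `r` and `s` is a simple
reflection, then `s g` is conjugate to `g s`, hence to `r t` for some `t`, hence to a member of `R`.
By induction `R` meets every class. So it is enough to have, for each pair `(r, t)`, a certificate
of conjugacy, and these are packed into one number per `r`.

Equality of words (`run_rep_injective`). Images of simple roots are roots up to sign, with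
coefficients at most 7 in absolute value, so the image of the single vector `(16 ^ i)` determines a
group element (`eq_of_apply_probe_eq`). Vectors are packed as residues modulo `(2 ^ 48) ^ n`. The
product of a packed vector with a coroot packed in reverse order carries their pairing in the digit
of place `n - 1`, so a reflection acts by a few operations on natural numbers (`step_rep`). An
equation between words becomes one comparison of natural numbers.

Separation (`eigenCount_eq_of_isConj`). If a finite set of vectors is stable under the group, the
numbers of its members that `w` fixes or negates are class functions of `w`. These numbers, the
order of `w`, and the numbers of vectors fixed by the square and the fourth power of `w` distinguish
the classes that have to be counted. -/

namespace WeylClasses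

/-! ### Vectors and reflections as lists of integers -/

/-- The dot product of two lists. -/
def dot : List ℤ → List ℤ → ℤ
  | a :: l, b :: m => Int.add (Int.mul a b) (dot l m)
  | _, _ => 0

/-- `subMul d l m` is `l - d • m`. -/
def subMul (d : ℤ) : List ℤ → List ℤ → List ℤ
  | a :: l, b :: m => Int.sub a (Int.mul d b) :: subMul d l m
  | _, _ => []

/-- The reflection of `v` attached to a pair (root, coroot). -/
def reflectList (s : List ℤ × List ℤ) (v : List ℤ) : List ℤ :=
  subMul (dot s.2 v) v s.1

/-- The conjugate of the reflection of `t` by the reflection of `s`. -/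
def conjPair (s t : List ℤ × List ℤ) : List ℤ × List ℤ :=
  (reflectList s t.1, subMul (dot t.2 s.1) t.2 s.2)

theorem dot_ofFn {n : ℕ} (x y : Fin n → ℤ) : dot (List.ofFn x) (List.ofFn y) = x ⬝ᵥ y := by
  induction n with
  | zero => simp [dot]
  | succ n ih =>
    rw [List.ofFn_succ, List.ofFn_succ, dot, ih, dotProduct, dotProduct, Fin.sum_univ_succ]
    rfl

theorem subMul_ofFn {n : ℕ} (d : ℤ) (x y : Fin n → ℤ) :
    subMul d (List.ofFn x) (List.ofFn y) = List.ofFn (x - d • y) := by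
  induction n with
  | zero => simp [subMul]
  | succ n ih =>
    rw [List.ofFn_succ, List.ofFn_succ, subMul, ih, List.ofFn_succ]
    rfl

/-- `g` is the reflection attached to the pair of lists `t`. -/
def Realizes {n : ℕ} (t : List ℤ × List ℤ) (g : (Fin n → ℤ) ≃ₗ[ℤ] (Fin n → ℤ)) : Prop :=
  ∃ β φ : Fin n → ℤ, t = (List.ofFn β, List.ofFn φ) ∧ ∀ x, g x = x - (φ ⬝ᵥ x) • β

/-- A pair determines its map. The converse fails, since negating both root and coroot gives the
same reflection; so a table needs only one of two opposite roots. -/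
theorem Realizes.unique {n : ℕ} {t : List ℤ × List ℤ} {g h : (Fin n → ℤ) ≃ₗ[ℤ] (Fin n → ℤ)}
    (hg : Realizes t g) (hh : Realizes t h) : g = h := by
  obtain ⟨β, φ, rfl, hg⟩ := hg
  obtain ⟨β', φ', he, hh⟩ := hh
  obtain ⟨h1, h2⟩ := Prod.mk.inj he
  obtain rfl := List.ofFn_injective h1
  obtain rfl := List.ofFn_injective h2
  exact LinearEquiv.ext fun x => (hg x).trans (hh x).symm

/-- As `g` is its own inverse, `g h g⁻¹` sends `x` to `x - φ'(g x) • g β'`. Here `g β' = β' - (φ ⬝ᵥ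
β') • β` and `φ' ∘ g = φ' - (φ' ⬝ᵥ β) • φ`, the two components of `conjPair`. -/
theorem Realizes.conj {n : ℕ} {s t : List ℤ × List ℤ} {g h : (Fin n → ℤ) ≃ₗ[ℤ] (Fin n → ℤ)}
    (hg : Realizes s g) (hh : Realizes t h) (hgg : g * g = 1) :
    Realizes (conjPair s t) (g * h * g⁻¹) := by
  obtain ⟨β, φ, rfl, hg⟩ := hg
  obtain ⟨β', φ', rfl, hh⟩ := hh
  refine ⟨β' - (φ ⬝ᵥ β') • β, φ' - (φ' ⬝ᵥ β) • φ, ?_, fun x => ?_⟩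
  · simp only [conjPair, reflectList, dot_ofFn, subMul_ofFn]
  · rw [inv_eq_of_mul_eq_one_left hgg]
    have hgg' : g (g x) = x := DFunLike.congr_fun hgg x
    change g (h (g x)) = _
    rw [hh, map_sub, hgg', map_smul, hg β', hg x]
    simp only [dotProduct_sub, sub_dotProduct, dotProduct_smul, smul_dotProduct, smul_eq_mul]
    ring_nf

/-- The zero pair, which gives the identity. -/
def zeroPair (n : ℕ) : List ℤ × List ℤ := (List.replicate n 0, List.replicate n 0)

/-- The zero pair is the default for lookups out of range. As it realizes the identity, indices in
hints and words never need a bounds check. -/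
theorem realizes_zeroPair (n : ℕ) : Realizes (n := n) (zeroPair n) 1 := by
  refine ⟨0, 0, ?_, fun x => ?_⟩
  · rw [zeroPair, ← List.ofFn_const]; rfl
  · simp

/-- Extends a list of pairs by conjugates: `(k, j)` adds the conjugate of the `k`-th entry by the
`j`-th pair of `S`. -/
def grow (n : ℕ) (S : List (List ℤ × List ℤ)) :
    List (ℕ × ℕ) → List (List ℤ × List ℤ) → List (List ℤ × List ℤ)
  | [], T => T
  | (k, j) :: hs, T =>
    grow n S hs (T ++ [conjPair (S.getD j (zeroPair n)) (T.getD k (zeroPair n))])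

/-- An invariant of the construction for arbitrary hints, so the hints need no verification: bad
ones only yield useless entries. -/
theorem forall_mem_grow {n : ℕ} {S : List (List ℤ × List ℤ)}
    {p : List ℤ × List ℤ → Prop} (h0 : p (zeroPair n))
    (hc : ∀ j t, p t → p (conjPair (S.getD j (zeroPair n)) t)) (hs : List (ℕ × ℕ))
    (T : List (List ℤ × List ℤ)) (hT : ∀ t ∈ T, p t) : ∀ t ∈ grow n S hs T, p t := by
  induction hs generalizing T with
  | nil => exact hT
  | cons a hs ih =>
    refine ih _ fun t ht => ?_
    rcases List.mem_append.1 ht with ht | ht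
    · exact hT t ht
    · rw [List.mem_singleton.1 ht]
      refine hc _ _ ?_
      by_cases hk : a.1 < T.length
      · rw [List.getD_eq_getElem _ _ hk]; exact hT _ (List.getElem_mem hk)
      · rw [List.getD_eq_default _ _ (not_lt.1 hk)]; exact h0

theorem subset_grow {n : ℕ} {S : List (List ℤ × List ℤ)} (hs : List (ℕ × ℕ))
    (T : List (List ℤ × List ℤ)) : T ⊆ grow n S hs T := by
  induction hs generalizing T with
  | nil => exact List.Subset.refl _
  | cons a hs ih => exact fun t ht => ih _ (List.mem_append_left _ ht)

/-! ### Packing a vector into one natural number -/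

/-- The base in which vectors are packed. -/
def base : ℕ := 281474976710656

/-- The integer whose base-`base` digits are the entries of the list. -/
def pack : List ℤ → ℤ
  | [] => 0
  | a :: l => Int.add a (Int.mul (Int.ofNat base) (pack l))

theorem pack_ofFn {n : ℕ} (x : Fin n → ℤ) :
    pack (List.ofFn x) = ∑ i, x i * (base : ℤ) ^ (i : ℕ) := by
  induction n with
  | zero => simp [pack]
  | succ n ih =>
    rw [List.ofFn_succ, pack, ih, Fin.sum_univ_succ]
    change _ + (base : ℤ) * _ = _
    rw [Finset.mul_sum]
    simp only [Fin.val_zero, pow_zero, mul_one, Fin.val_succ, pow_succ]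
    congr 1
    exact Finset.sum_congr rfl fun i _ => by ring

/-- Reversal puts coordinate `i` in place `n - 1 - i`, so that in a product with an unreversed
packed vector all the terms of the dot product meet in place `n - 1`. -/
theorem pack_reverse_ofFn {n : ℕ} (x : Fin n → ℤ) :
    pack (List.ofFn x).reverse = ∑ i, x i * (base : ℤ) ^ (n - 1 - i) := by
  have hr : (List.ofFn x).reverse = List.ofFn fun i => x i.rev := by
    refine List.ext_getElem (by simp) fun i h1 h2 => ?_
    simp only [List.getElem_reverse, List.getElem_ofFn, List.length_ofFn]
    congr 1
    ext
    simp only [Fin.val_rev]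
    omega
  rw [hr, pack_ofFn, ← Equiv.sum_comp Fin.revPerm]
  refine Finset.sum_congr rfl fun i _ => ?_
  simp only [Fin.revPerm_apply, Fin.rev_rev, Fin.val_rev]
  congr 2
  omega

/-- Digits that are smaller than the base are determined by the number modulo `C ^ n`. -/
theorem eq_zero_of_pow_dvd_sum {n : ℕ} {C : ℤ} (d : Fin n → ℤ) (hd : ∀ i, |d i| < C)
    (h : C ^ n ∣ ∑ i, d i * C ^ (i : ℕ)) : d = 0 := by
  induction n with
  | zero => exact Subsingleton.elim _ _
  | succ n ih =>
    have hC : 0 < C := (abs_nonneg _).trans_lt (hd 0)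
    have e : ∑ i, d i * C ^ (i : ℕ) = d 0 + C * ∑ i : Fin n, d i.succ * C ^ (i : ℕ) := by
      rw [Fin.sum_univ_succ, Finset.mul_sum]
      simp only [Fin.val_zero, pow_zero, mul_one, Fin.val_succ, pow_succ]
      congr 1
      exact Finset.sum_congr rfl fun i _ => by ring
    rw [e] at h
    have h0 : d 0 = 0 := by
      refine Int.eq_zero_of_abs_lt_dvd (m := C) ?_ (hd 0)
      have : C ∣ C ^ (n + 1) := dvd_pow_self _ n.succ_ne_zero
      exact (Int.dvd_add_left (Dvd.intro _ rfl)).1 (this.trans h)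
    rw [h0, zero_add, pow_succ', mul_dvd_mul_iff_left hC.ne'] at h
    have := ih (fun i => d i.succ) (fun i => hd _) h
    funext i
    exact Fin.cases h0 (fun i => congrFun this i) i

/-- The residue representing a vector. -/
def rep {n : ℕ} (x : Fin n → ℤ) : ℕ := (pack (List.ofFn x) % (base : ℤ) ^ n).toNat

theorem base_pow_pos (n : ℕ) : (0 : ℤ) < (base : ℤ) ^ n := pow_pos (by norm_num [base]) n

theorem coe_rep {n : ℕ} (x : Fin n → ℤ) : (rep x : ℤ) = pack (List.ofFn x) % (base : ℤ) ^ n :=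
  Int.toNat_of_nonneg (Int.emod_nonneg _ (base_pow_pos n).ne')

/-- Differences of entries are at most `2 ^ 35`, below the base `2 ^ 48`, so signed digits can be
recovered from the residue. -/
theorem rep_injective {n : ℕ} {x y : Fin n → ℤ} (hx : ∀ i, |x i| ≤ 2 ^ 34)
    (hy : ∀ i, |y i| ≤ 2 ^ 34) (h : rep x = rep y) : x = y := by
  have h1 : pack (List.ofFn x) % (base : ℤ) ^ n = pack (List.ofFn y) % (base : ℤ) ^ n := by
    rw [← coe_rep, ← coe_rep, h]
  rw [← sub_eq_zero]
  refine eq_zero_of_pow_dvd_sum (C := base) _ (fun i => ?_) ?_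
  · have := abs_sub (x i) (y i)
    have h2 := hx i
    have h3 := hy i
    simp only [Pi.sub_apply, base]
    norm_num at *
    omega
  · rw [pack_ofFn, pack_ofFn] at h1
    have := Int.ModEq.dvd (Int.ModEq.symm h1)
    simpa only [Pi.sub_apply, sub_mul, Finset.sum_sub_distrib] using this

/-- The product of the packed vector `x` and the reversed packed form `φ` has `φ ⬝ᵥ x` as the digit
in place `n - 1`, up to a small error. -/
theorem exists_pack_mul_pack {n : ℕ} (hn : 1 ≤ n) (hn8 : n ≤ 8) (x φ : Fin n → ℤ)
    (hx : ∀ i, |x i| ≤ 2 ^ 34) (hφ : ∑ i, |φ i| ≤ 2 ^ 8) :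
    ∃ L Z : ℤ, pack (List.ofFn x) * pack (List.ofFn φ).reverse =
      L + (φ ⬝ᵥ x) * (base : ℤ) ^ (n - 1) + (base : ℤ) ^ n * Z ∧
      4 * |L| ≤ (base : ℤ) ^ (n - 1) := by
  set C : ℤ := (base : ℤ) with hC
  have hC1 : 1 ≤ C := by norm_num [hC, base]
  -- The term `x i * φ j` has place `n - 1 - j + i`. It lies below place `n - 1` for `i < j` and
  -- goes to the error `L`; for `j < i` the place is at least `n` and the term goes to the multiple
  -- `Z` of the modulus.
  refine ⟨∑ i, ∑ j, if i < j then x i * φ j * C ^ ((n - 1 - (j : ℕ)) + i) else 0,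
    ∑ i, ∑ j, if j < i then x i * φ j * C ^ ((i : ℕ) - j - 1) else 0, ?_, ?_⟩
  · rw [pack_ofFn, pack_reverse_ofFn, Finset.sum_mul_sum]
    have hd : (φ ⬝ᵥ x) * C ^ (n - 1) =
        ∑ i, ∑ j, if i = j then x i * φ j * C ^ (n - 1) else 0 := by
      simp only [dotProduct, Finset.sum_mul, Finset.sum_ite_eq, Finset.mem_univ, if_true]
      exact Finset.sum_congr rfl fun i _ => by ring
    rw [hd, Finset.mul_sum, ← Finset.sum_add_distrib, ← Finset.sum_add_distrib]
    refine Finset.sum_congr rfl fun i _ => ?_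
    rw [Finset.mul_sum, ← Finset.sum_add_distrib, ← Finset.sum_add_distrib]
    refine Finset.sum_congr rfl fun j _ => ?_
    rcases lt_trichotomy i j with h | rfl | h
    · rw [if_pos h, if_neg h.ne, if_neg h.not_gt, pow_add]; ring
    · have : C ^ (n - 1) = C ^ (n - 1 - (i : ℕ)) * C ^ (i : ℕ) := by
        rw [← pow_add]; congr 1; omega
      simp only [lt_irrefl, if_false, if_true]
      rw [this, hC]
      ring
    · have h' : (j : ℕ) < i := h
      have : C ^ n * C ^ ((i : ℕ) - j - 1) = C ^ (i : ℕ) * C ^ (n - 1 - (j : ℕ)) := by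
        rw [← pow_add, ← pow_add]; congr 1; omega
      rw [if_neg h.not_gt, if_neg h.ne', if_pos h]
      linear_combination -(x i * φ j) * this
  · rcases Nat.lt_or_ge n 2 with h2 | h2
    · obtain rfl : n = 1 := by omega
      simp
    -- Since `i < j`, the place `n - 1 - j + i` is at most `n - 2`.
    have hb : ∀ i j : Fin n, |if i < j then x i * φ j * C ^ ((n - 1 - (j : ℕ)) + i) else 0| ≤
        2 ^ 34 * C ^ (n - 2) * |φ j| := by
      intro i j
      split_ifs with h
      · have h' : (i : ℕ) < j := h
        rw [abs_mul, abs_mul, abs_pow, abs_of_pos (by omega : 0 < C)]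
        have : C ^ ((n - 1 - (j : ℕ)) + i) ≤ C ^ (n - 2) := pow_le_pow_right₀ hC1 (by omega)
        calc |x i| * |φ j| * C ^ ((n - 1 - (j : ℕ)) + i)
            ≤ 2 ^ 34 * |φ j| * C ^ (n - 2) := by
              gcongr
              exact hx i
          _ = _ := by ring
      · rw [abs_zero]; positivity
    have hL : |∑ i, ∑ j, if i < j then x i * φ j * C ^ ((n - 1 - (j : ℕ)) + i) else 0| ≤
        n * (2 ^ 34 * C ^ (n - 2) * 2 ^ 8) := by
      calc _ ≤ ∑ i : Fin n, ∑ j : Fin n, 2 ^ 34 * C ^ (n - 2) * |φ j| :=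
            (Finset.abs_sum_le_sum_abs _ _).trans (Finset.sum_le_sum fun i _ =>
              (Finset.abs_sum_le_sum_abs _ _).trans (Finset.sum_le_sum fun j _ => hb i j))
        _ ≤ ∑ i : Fin n, 2 ^ 34 * C ^ (n - 2) * 2 ^ 8 := by
            refine Finset.sum_le_sum fun i _ => ?_
            rw [← Finset.mul_sum]
            gcongr
        _ = _ := by simp
    -- With `n ≤ 8`, `4 * n * 2 ^ 34 * 2 ^ 8` is at most `2 ^ 47`, less than the base `2 ^ 48`; this
    -- margin dictates the choice of base.
    have hCn : C ^ (n - 1) = C ^ (n - 2) * 2 ^ 48 := by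
      have : n - 1 = (n - 2) + 1 := by omega
      rw [this, pow_succ]; norm_num [hC, base]
    have hn' : (n : ℤ) ≤ 8 := by exact_mod_cast hn8
    have hpos : 0 < C ^ (n - 2) := pow_pos (by omega) _
    rw [hCn]
    nlinarith

/-! ### Words in reflections acting on packed vectors -/

/-- `force k f` is `f k`; its reduction evaluates `k` first. -/
def force {α : Type*} (k : ℕ) (f : ℕ → α) : α :=
  Nat.rec (f 0) (fun k _ => f (Nat.succ k)) k

@[simp] theorem force_eq {α : Type*} (k : ℕ) (f : ℕ → α) : force k f = f k := by
  cases k <;> rfl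

/-- The residue of an integer modulo `M`. -/
def residue (M : ℕ) (a : ℤ) : ℕ := (Int.emod a (Int.ofNat M)).toNat

theorem coe_residue {M : ℕ} (hM : 0 < M) (a : ℤ) : (residue M a : ℤ) = a % M :=
  Int.toNat_of_nonneg (Int.emod_nonneg _ (Int.natCast_ne_zero.2 hM.ne'))

theorem residue_lt {M : ℕ} (hM : 0 < M) (a : ℤ) : residue M a < M := by
  have := coe_residue hM a
  have := Int.emod_lt_of_pos a (by omega : (0 : ℤ) < M)
  omega

theorem rep_eq_residue {n : ℕ} (x : Fin n → ℤ) :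
    rep x = residue (base ^ n) (pack (List.ofFn x)) := by
  rw [rep, residue, Int.ofNat_eq_natCast, Nat.cast_pow]; rfl

/-- The number whose digits to base `M` are the entries of the list. -/
def packTable (M : ℕ) : List ℕ → ℕ
  | [] => 0
  | a :: l => Nat.add a (Nat.mul M (packTable M l))

/-- A whole table is kept in one natural number, so a lookup is a shift and a remainder. Beyond the
end of the list the digits are zero. -/
theorem packTable_div_mod {M : ℕ} (hM : 0 < M) (l : List ℕ) (hl : ∀ a ∈ l, a < M) (i : ℕ) :
    packTable M l / M ^ i % M = l.getD i 0 := by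
  induction l generalizing i with
  | nil => simp [packTable]
  | cons a l ih =>
    have ha : a < M := hl a List.mem_cons_self
    change (a + M * packTable M l) / M ^ i % M = _
    cases i with
    | zero => simp [Nat.mod_eq_of_lt ha]
    | succ i =>
      rw [pow_succ', ← Nat.div_div_eq_div_mul, Nat.add_mul_div_left _ _ hM,
        Nat.div_eq_of_lt ha, zero_add, ih fun b hb => hl b (List.mem_cons_of_mem _ hb),
        List.getD_cons_succ]

/-- The constants used in computing with packed vectors. -/
structure Machine where
  /-- the number of bits of `modulus` -/
  width : ℕ
  /-- packed vectors are residues modulo this number -/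
  modulus : ℕ
  /-- the place value of the leading digit -/
  top : ℕ
  /-- the offset that makes digits nonnegative -/
  offset : ℕ
  /-- the table of packed coroots -/
  coroots : ℕ
  /-- the table of packed negative roots -/
  roots : ℕ
  /-- the table of corrections for the offset -/
  shifts : ℕ

/-- The entry `i` of a table. -/
def Machine.entry (m : Machine) (table i : ℕ) : ℕ :=
  Nat.mod (Nat.shiftRight table (Nat.mul i m.width)) m.modulus

/-- The action of the reflection number `i` on a packed vector. -/
def Machine.step (m : Machine) (i V : ℕ) : ℕ :=
  -- The quotient by `top` is the pairing increased by `base / 2`, which keeps it a natural number.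
  -- It multiplies the negative root, and the entry of `shifts`, `base / 2` times the root, cancels
  -- the excess.
  Nat.mod (Nat.add (Nat.add V (m.entry m.shifts i))
    (Nat.mul (Nat.div (Nat.mod (Nat.add (Nat.mul V (m.entry m.coroots i)) m.offset) m.modulus)
      m.top) (m.entry m.roots i))) m.modulus

/-- The action of a word on a packed vector. -/
noncomputable def Machine.run (m : Machine) (l : List ℕ) (V : ℕ) : ℕ :=
  @List.rec ℕ (fun _ => ℕ) V (fun i _ ih => force ih (m.step i)) l

@[simp] theorem Machine.run_nil (m : Machine) (V : ℕ) : m.run [] V = V := rfl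

@[simp] theorem Machine.run_cons (m : Machine) (i : ℕ) (l : List ℕ) (V : ℕ) :
    m.run (i :: l) V = m.step i (m.run l V) :=
  force_eq _ _

/-- The constants for the list `T` of reflections in dimension `n`. -/
def machine (n : ℕ) (T : List (List ℤ × List ℤ)) : Machine where
  width := 48 * n
  modulus := base ^ n
  top := base ^ (n - 1)
  -- The first summand makes the digit of place `n - 1` nonnegative. The second makes the signed
  -- contribution of the lower places nonnegative, so that it does not borrow from that digit.
  offset := base / 2 * base ^ (n - 1) + base ^ (n - 1) / 2
  coroots := packTable (base ^ n) (T.map fun t => residue (base ^ n) (pack t.2.reverse))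
  roots := packTable (base ^ n) (T.map fun t => residue (base ^ n) (-pack t.1))
  shifts := packTable (base ^ n)
    (T.map fun t => residue (base ^ n) (Int.mul (Int.ofNat (base / 2)) (pack t.1)))

/-- `withMachine n T f` is `f (machine n T)`; its reduction evaluates the constants first. -/
def withMachine {α : Type*} (n : ℕ) (T : List (List ℤ × List ℤ)) (f : Machine → α) : α :=
  force (machine n T).width fun width => force (machine n T).modulus fun modulus =>
  force (machine n T).top fun top => force (machine n T).offset fun offset =>
  force (machine n T).coroots fun coroots => force (machine n T).roots fun roots =>
  force (machine n T).shifts fun shifts =>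
    f ⟨width, modulus, top, offset, coroots, roots, shifts⟩

@[simp] theorem withMachine_eq {α : Type*} (n : ℕ) (T : List (List ℤ × List ℤ))
    (f : Machine → α) : withMachine n T f = f (machine n T) := by
  simp only [withMachine, force_eq]

/-- A shift by `i * (48 * n)` bits is division by `(base ^ n) ^ i`. The hypothesis on the zero pair
makes the digit 0 read past the end of the table agree with the default entry. -/
theorem machine_entry {n : ℕ} (T : List (List ℤ × List ℤ)) (f : List ℤ × List ℤ → ℤ)
    (h0 : f (zeroPair n) = 0) (i : ℕ) :
    (machine n T).entry (packTable (base ^ n) (T.map fun t => residue (base ^ n) (f t))) i =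
      residue (base ^ n) (f (T.getD i (zeroPair n))) := by
  have hM : 0 < base ^ n := pow_pos (by norm_num [base]) n
  have hw : 2 ^ (i * (48 * n)) = (base ^ n) ^ i := by
    rw [mul_comm, pow_mul, pow_mul]; norm_num [base]
  change Nat.shiftRight _ (i * (48 * n)) % (base ^ n) = _
  have := Nat.shiftRight_eq_div_pow
    (packTable (base ^ n) (T.map fun t => residue (base ^ n) (f t))) (i * (48 * n))
  change Nat.shiftRight _ _ = _ at this
  rw [this, hw, packTable_div_mod hM]
  · have h0' : residue (base ^ n) (f (zeroPair n)) = 0 := by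
      rw [h0, residue, show Int.emod 0 (Int.ofNat (base ^ n)) = 0 from Int.zero_emod _]; rfl
    rw [← h0', List.getD_map (f := fun t => residue (base ^ n) (f t))]
  · intro a ha
    obtain ⟨t, -, rfl⟩ := List.mem_map.1 ha
    exact residue_lt hM _

theorem pack_replicate_zero (n : ℕ) : pack (List.replicate n 0) = 0 := by
  induction n with
  | zero => rfl
  | succ n ih => rw [List.replicate_succ, pack, ih]; rfl

/-- The sum of the absolute values of the entries. -/
def absSum (l : List ℤ) : ℕ := (l.map Int.natAbs).sum

theorem absSum_ofFn {n : ℕ} (x : Fin n → ℤ) : (absSum (List.ofFn x) : ℤ) = ∑ i, |x i| := by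
  rw [absSum, List.map_ofFn, List.sum_ofFn]
  simp

/-- The heart of the packed arithmetic: the bounds on `x` and on the coroot leave no room for
overflow between digits, so one machine step is exactly the reflection. -/
theorem step_rep {n : ℕ} (hn : 1 ≤ n) (hn8 : n ≤ 8) {T : List (List ℤ × List ℤ)} {i : ℕ}
    (hT : absSum (T.getD i (zeroPair n)).2 ≤ 2 ^ 8)
    {g : (Fin n → ℤ) ≃ₗ[ℤ] (Fin n → ℤ)} (hg : Realizes (T.getD i (zeroPair n)) g)
    {x : Fin n → ℤ} (hx : ∀ i, |x i| ≤ 2 ^ 34) :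
    (machine n T).step i (rep x) = rep (g x) := by
  obtain ⟨β, φ, ht, hg⟩ := hg
  have hM : 0 < base ^ n := pow_pos (by norm_num [base]) n
  have hp := machine_entry (n := n) T (fun t => pack t.2.reverse)
    (by simp [zeroPair, pack_replicate_zero]) i
  have hq := machine_entry (n := n) T (fun t => -pack t.1)
    (by simp [zeroPair, pack_replicate_zero]) i
  have hk := machine_entry (n := n) T (fun t => Int.mul (Int.ofNat (base / 2)) (pack t.1))
    (by simp only [zeroPair, pack_replicate_zero]; exact Int.mul_zero _) i
  simp only [ht] at hp hq hk hT
  rw [Machine.step]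
  change ((rep x + (machine n T).entry (machine n T).shifts i) +
    ((rep x * (machine n T).entry (machine n T).coroots i +
      (base / 2 * base ^ (n - 1) + base ^ (n - 1) / 2)) % base ^ n / base ^ (n - 1)) *
        (machine n T).entry (machine n T).roots i) % base ^ n = _
  rw [show (machine n T).entry (machine n T).shifts i = _ from hk,
    show (machine n T).entry (machine n T).coroots i = _ from hp,
    show (machine n T).entry (machine n T).roots i = _ from hq]
  have hφ : ∑ i, |φ i| ≤ 2 ^ 8 := by
    rw [← absSum_ofFn]; exact_mod_cast hT
  obtain ⟨L, Z, hLZ, hL⟩ := exists_pack_mul_pack hn hn8 x φ hx hφ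
  have hdot : |φ ⬝ᵥ x| ≤ 2 ^ 8 * 2 ^ 34 := by
    calc |φ ⬝ᵥ x| ≤ ∑ i, |φ i * x i| := Finset.abs_sum_le_sum_abs _ _
      _ ≤ ∑ i, |φ i| * 2 ^ 34 := Finset.sum_le_sum fun i _ => by
          rw [abs_mul]; exact mul_le_mul_of_nonneg_left (hx i) (abs_nonneg _)
      _ ≤ _ := by rw [← Finset.sum_mul]; exact mul_le_mul_of_nonneg_right hφ (by norm_num)
  have hbn : (base : ℤ) ^ n = base ^ (n - 1) * base := by
    rw [← pow_succ]; congr 1; omega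
  have htop : (2 : ℤ) ∣ base ^ (n - 1) ∨ n = 1 := by
    rcases Nat.lt_or_ge n 2 with h | h
    · right; omega
    · left; exact dvd_pow (by norm_num [base]) (by omega)
  have he : ((rep x * residue (base ^ n) (pack (List.ofFn φ).reverse) +
      (base / 2 * base ^ (n - 1) + base ^ (n - 1) / 2)) % base ^ n / base ^ (n - 1) : ℕ) =
        φ ⬝ᵥ x + (base / 2 : ℕ) := by
    push_cast
    rw [coe_rep, coe_residue hM, Nat.cast_pow]
    set D : ℤ := (base : ℤ) ^ (n - 1) with hD
    have hDpos : 0 < D := base_pow_pos _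
    obtain ⟨hd1, hd2⟩ := abs_le.1 hdot
    obtain ⟨hL1, hL2⟩ : -D ≤ 4 * L ∧ 4 * L ≤ D := by
      have := abs_le.1 (show |4 * L| ≤ D by rwa [abs_mul])
      exact ⟨by linarith, by linarith⟩
    -- The error is at most a quarter of the place value in absolute value, so adding half of it
    -- gives a genuine remainder modulo `D`.
    have hlow : 0 ≤ L + D / 2 ∧ L + D / 2 < D := by
      constructor <;> omega
    have hmod : (pack (List.ofFn x) % (base : ℤ) ^ n *
        (pack (List.ofFn φ).reverse % (base : ℤ) ^ n) + ((base : ℤ) / 2 * D + D / 2)) %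
          (base : ℤ) ^ n = (L + D / 2) + (φ ⬝ᵥ x + (base : ℤ) / 2) * D := by
      have e1 : (pack (List.ofFn x) % (base : ℤ) ^ n *
        (pack (List.ofFn φ).reverse % (base : ℤ) ^ n) + ((base : ℤ) / 2 * D + D / 2)) ≡
          (L + D / 2) + (φ ⬝ᵥ x + (base : ℤ) / 2) * D [ZMOD (base : ℤ) ^ n] := by
        refine (Int.ModEq.add_right _ ((Int.mod_modEq _ _).mul (Int.mod_modEq _ _))).trans ?_
        rw [hLZ]
        refine (Int.modEq_iff_dvd.2 ⟨-Z, ?_⟩)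
        ring
      -- The pairing is at most `2 ^ 42` in absolute value, so after adding `2 ^ 47` it is a
      -- legitimate digit and nothing wraps around modulo `base ^ n`.
      have hb : (base : ℤ) = 281474976710656 := rfl
      have hc : 0 ≤ φ ⬝ᵥ x + (base : ℤ) / 2 ∧ φ ⬝ᵥ x + (base : ℤ) / 2 + 1 ≤ base := by
        rw [hb]; norm_num at hd1 hd2 ⊢; omega
      refine Eq.trans e1 (Int.emod_eq_of_lt ?_ ?_)
      · nlinarith
      · rw [hbn]; nlinarith
    rw [hmod, Int.add_mul_ediv_right _ _ hDpos.ne', Int.ediv_eq_zero_of_lt hlow.1 hlow.2, zero_add]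
  zify
  zify at he
  -- What remains is the congruence `x + (base / 2) β - (φ ⬝ᵥ x + base / 2) β = x - (φ ⬝ᵥ x) β`
  -- between packed values.
  rw [he, coe_rep, coe_rep, coe_residue hM, coe_residue hM, Nat.cast_pow]
  refine (Int.ModEq.add (Int.ModEq.add (Int.mod_modEq _ _) (Int.mod_modEq _ _))
    (Int.ModEq.mul_left _ (Int.mod_modEq _ _))).trans ?_
  have hpk : pack (List.ofFn (g x)) =
      pack (List.ofFn x) - (φ ⬝ᵥ x) * pack (List.ofFn β) := by
    rw [pack_ofFn, pack_ofFn, pack_ofFn, Finset.mul_sum, ← Finset.sum_sub_distrib]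
    refine Finset.sum_congr rfl fun i _ => ?_
    rw [hg]; simp; ring
  rw [hpk]
  refine congrArg (· % (base : ℤ) ^ n) ?_
  change _ + ((base / 2 : ℕ) : ℤ) * _ + _ = _
  push_cast
  ring

section

variable {n : ℕ} (A : Matrix (Fin n) (Fin n) ℤ) (hA : ∀ i, A i i = 2)

/-! ### The table of reflections of a Weyl group -/

/-- The simple roots and coroots. -/
def simplePairs : List (List ℤ × List ℤ) :=
  List.ofFn fun j => (List.ofFn (Pi.single j 1 : Fin n → ℤ), List.ofFn fun i => A i j)

theorem realizes_simpleReflection (j : Fin n) :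
    Realizes (List.ofFn (Pi.single j 1 : Fin n → ℤ), List.ofFn fun i => A i j)
      (simpleReflection A hA j) := by
  refine ⟨_, _, rfl, fun x => ?_⟩
  rw [simpleReflection, Module.reflection_apply, simpleCoroot_apply, dotProduct]
  simp only [mul_comm]

theorem simpleReflection_mul_self (j : Fin n) :
    simpleReflection A hA j * simpleReflection A hA j = 1 := by
  ext1 x
  exact Module.involutive_reflection _ x

theorem simpleReflection_mem (j : Fin n) : simpleReflection A hA j ∈ cartanWeylGroup A hA :=
  Subgroup.subset_closure ⟨j, rfl⟩

/-- The table of reflections obtained from the simple ones by conjugation. -/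
def table (hints : List (ℕ × ℕ)) : List (List ℤ × List ℤ) :=
  grow n (simplePairs A) hints (simplePairs A)

variable (hints : List (ℕ × ℕ))

theorem getD_simplePairs (j : ℕ) : (∃ i : Fin n, (simplePairs A).getD j (zeroPair n) =
    (List.ofFn (Pi.single i 1 : Fin n → ℤ), List.ofFn fun k => A k i)) ∨
    (simplePairs A).getD j (zeroPair n) = zeroPair n := by
  by_cases hj : j < n
  · left
    refine ⟨⟨j, hj⟩, ?_⟩
    rw [List.getD_eq_getElem _ _ (by simpa [simplePairs] using hj)]
    simp [simplePairs]
  · right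
    exact List.getD_eq_default _ _ (by simpa [simplePairs] using hj)

/-- The table starts from simple reflections and grows by conjugating with them, so it never leaves
the group. -/
theorem exists_realizes_of_mem_table : ∀ t ∈ table A hints,
    ∃ g ∈ cartanWeylGroup A hA, Realizes t g := by
  refine forall_mem_grow ⟨1, one_mem _, realizes_zeroPair n⟩ ?_ _ _ ?_
  · rintro j t ⟨g, hg, ht⟩
    rcases getD_simplePairs A j with ⟨i, h⟩ | h
    · rw [h]
      exact ⟨_, mul_mem (mul_mem (simpleReflection_mem A hA i) hg)
        (inv_mem (simpleReflection_mem A hA i)),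
        (realizes_simpleReflection A hA i).conj ht (simpleReflection_mul_self A hA i)⟩
    · rw [h]
      exact ⟨_, mul_mem (mul_mem (one_mem _) hg) (inv_mem (one_mem _)),
        (realizes_zeroPair n).conj ht (one_mul 1)⟩
  · intro t ht
    obtain ⟨j, rfl⟩ := (List.mem_ofFn' _ _).1 ht
    exact ⟨_, simpleReflection_mem A hA j, realizes_simpleReflection A hA j⟩

/-- Every natural number names a group element, with the identity for numbers out of range; this
makes `word` total. -/
theorem exists_letter (k : ℕ) : ∃ g : cartanWeylGroup A hA,
    Realizes ((table A hints).getD k (zeroPair n)) g.1 := by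
  by_cases hk : k < (table A hints).length
  · rw [List.getD_eq_getElem _ _ hk]
    obtain ⟨g, hg, h⟩ := exists_realizes_of_mem_table A hA hints _ (List.getElem_mem hk)
    exact ⟨⟨g, hg⟩, h⟩
  · rw [List.getD_eq_default _ _ (not_lt.1 hk)]
    exact ⟨1, realizes_zeroPair n⟩

/-- The reflection number `k` of the table. -/
noncomputable def letter (k : ℕ) : cartanWeylGroup A hA := (exists_letter A hA hints k).choose

theorem realizes_letter (k : ℕ) :
    Realizes ((table A hints).getD k (zeroPair n)) (letter A hA hints k).1 :=
  (exists_letter A hA hints k).choose_spec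

/-- The product of the reflections whose numbers are listed. -/
noncomputable def word (l : List ℕ) : cartanWeylGroup A hA := (l.map (letter A hA hints)).prod

@[simp] theorem word_nil : word A hA hints [] = 1 := rfl

@[simp] theorem word_cons (k : ℕ) (l : List ℕ) :
    word A hA hints (k :: l) = letter A hA hints k * word A hA hints l :=
  List.prod_cons

@[simp] theorem word_append (l m : List ℕ) :
    word A hA hints (l ++ m) = word A hA hints l * word A hA hints m := by
  rw [word, List.map_append, List.prod_append]; rfl

/-! ### Closure of the table under conjugation -/

/-- Equality of lists of integers. -/
def eqList : List ℤ → List ℤ → Bool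
  | a :: l, b :: m => match Int.instDecidableEq a b with
    | isTrue _ => eqList l m
    | isFalse _ => false
  | [], [] => true
  | _, _ => false

theorem eq_of_eqList : ∀ {l m : List ℤ}, eqList l m = true → l = m
  | a :: l, b :: m, h => by
    rw [eqList] at h
    split at h
    · next hab _ => rw [hab, eq_of_eqList h]
    · exact absurd h Bool.false_ne_true
  | [], [], _ => rfl
  | [], _ :: _, h => absurd h Bool.false_ne_true
  | _ :: _, [], h => absurd h Bool.false_ne_true

/-- Membership in a list of pairs. -/
def memPairs (p : List ℤ × List ℤ) : List (List ℤ × List ℤ) → Bool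
  | [] => false
  | q :: l => match eqList p.1 q.1 with
    | true => eqList p.2 q.2
    | false => memPairs p l

/-- Only soundness is needed: once the roots agree, the test stakes the result on the coroots and
does not search further. -/
theorem mem_of_memPairs {p : List ℤ × List ℤ} :
    ∀ {l : List (List ℤ × List ℤ)}, memPairs p l = true → p ∈ l
  | [], h => absurd h Bool.false_ne_true
  | q :: l, h => by
    rw [memPairs] at h
    split at h
    · next h1 => exact List.mem_cons.2 (Or.inl (Prod.ext (eq_of_eqList h1) (eq_of_eqList h)))
    · exact List.mem_cons_of_mem _ (mem_of_memPairs h)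

/-- The conjugates by `S` of the entries of `T` are in `T`, except that an entry of `S` need not be
conjugated by itself; the entries of `T` are small. -/
def tableCheck (S T : List (List ℤ × List ℤ)) : Bool :=
  T.all fun t => (t.1.all fun a => Nat.ble a.natAbs 7) && Nat.ble (absSum t.2) 256 &&
    S.all fun s => match memPairs (conjPair s t) T with
      | true => true
      | false => eqList t.1 s.1 && eqList t.2 s.2

variable {A hA hints}

/-- What `tableCheck` verifies. -/
structure TableGood (S T : List (List ℤ × List ℤ)) : Prop where
  conj_mem : ∀ t ∈ T, ∀ s ∈ S, conjPair s t ∈ T ∨ t = s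
  root_le : ∀ t ∈ T, ∀ a ∈ t.1, |a| ≤ 7
  coroot_le : ∀ t ∈ T, absSum t.2 ≤ 2 ^ 8

theorem tableGood_of_tableCheck {S T : List (List ℤ × List ℤ)} (h : tableCheck S T = true) :
    TableGood S T := by
  simp only [tableCheck, List.all_eq_true, Bool.and_eq_true] at h
  refine ⟨fun t ht s hs => ?_, fun t ht a ha => ?_, fun t ht => ?_⟩
  · have := (h t ht).2 s hs
    split at this
    · next h1 => exact Or.inl (mem_of_memPairs h1)
    · rw [Bool.and_eq_true] at this
      exact Or.inr (Prod.ext (eq_of_eqList this.1) (eq_of_eqList this.2))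
  · have := Nat.le_of_ble_eq_true ((h t ht).1.1 a ha)
    rw [Int.abs_eq_natAbs]
    exact_mod_cast this
  · exact Nat.le_of_ble_eq_true (h t ht).1.2

theorem simplePairs_subset_table : simplePairs A ⊆ table A hints := subset_grow _ _

theorem simplePair_mem (j : Fin n) :
    (List.ofFn (Pi.single j 1 : Fin n → ℤ), List.ofFn fun i => A i j) ∈ simplePairs A :=
  (List.mem_ofFn' _ _).2 ⟨j, rfl⟩

/-- A pair determines its reflection, so membership of a pair in the table identifies a group
element with a letter. -/
theorem exists_letter_eq {g : cartanWeylGroup A hA} {t : List ℤ × List ℤ}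
    (ht : t ∈ table A hints) (hg : Realizes t g.1) :
    ∃ k < (table A hints).length, g = letter A hA hints k := by
  obtain ⟨k, hk, rfl⟩ := List.getElem_of_mem ht
  refine ⟨k, hk, Subtype.ext (hg.unique ?_)⟩
  have := realizes_letter A hA hints k
  rwa [List.getD_eq_getElem _ _ hk] at this

theorem simpleReflection_inv (j : Fin n) :
    (simpleReflection A hA j)⁻¹ = simpleReflection A hA j :=
  inv_eq_of_mul_eq_one_left (simpleReflection_mul_self A hA j)

/-- An induction principle for the Weyl group, with multiplication by simple reflections on the
left. -/
theorem weyl_induction {p : cartanWeylGroup A hA → Prop} (h1 : p 1)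
    (hs : ∀ j g, p g → p (⟨simpleReflection A hA j, simpleReflection_mem A hA j⟩ * g))
    (g : cartanWeylGroup A hA) : p g := by
  obtain ⟨g, hg⟩ := g
  refine Subgroup.closure_induction_left (p := fun x hx => p ⟨x, hx⟩) h1 ?_ ?_ hg
  · rintro _ ⟨j, rfl⟩ y hy h
    exact hs j _ h
  · rintro _ ⟨j, rfl⟩ y hy h
    have := hs j _ h
    simp only [simpleReflection_inv]
    exact this

/-- The table is closed under conjugation by simple reflections, hence by the whole group. The
exempted case of a simple pair conjugated by itself gives the opposite pair, but the reflection
itself does not change. -/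
theorem exists_conj_letter (hT : TableGood (simplePairs A) (table A hints))
    (g : cartanWeylGroup A hA) {k : ℕ} (hk : k < (table A hints).length) :
    ∃ l < (table A hints).length,
      g * letter A hA hints k * g⁻¹ = letter A hA hints l := by
  induction g using weyl_induction with
  | h1 => exact ⟨k, hk, by simp⟩
  | hs j g ih =>
    obtain ⟨l, hl, h⟩ := ih
    set s : cartanWeylGroup A hA := ⟨simpleReflection A hA j, simpleReflection_mem A hA j⟩
    have e : s * g * letter A hA hints k * (s * g)⁻¹ = s * letter A hA hints l * s⁻¹ := by
      rw [← h]; group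
    rw [e]
    have hr := realizes_letter A hA hints l
    rw [List.getD_eq_getElem _ _ hl] at hr
    rcases hT.conj_mem _ (List.getElem_mem hl) _ (simplePair_mem j) with h1 | h1
    · exact exists_letter_eq h1 ((realizes_simpleReflection A hA j).conj hr
        (simpleReflection_mul_self A hA j))
    · have : letter A hA hints l = s := by
        refine Subtype.ext (hr.unique ?_)
        rw [h1]
        exact realizes_simpleReflection A hA j
      exact ⟨l, hl, by rw [this]; group⟩

theorem exists_letter_eq_simpleReflection (j : Fin n) : ∃ k < (table A hints).length,
    (⟨simpleReflection A hA j, simpleReflection_mem A hA j⟩ : cartanWeylGroup A hA) =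
      letter A hA hints k :=
  exists_letter_eq (simplePairs_subset_table (simplePair_mem j)) (realizes_simpleReflection A hA j)

/-- If the classes of a family of elements are closed under multiplication by the reflections of
the table, then they cover the Weyl group. -/
theorem exists_conj_of_forall_letter (hT : TableGood (simplePairs A) (table A hints)) {ι : Type*}
    (r : ι → cartanWeylGroup A hA) (h1 : ∃ i, r i = 1)
    (hr : ∀ i, ∀ k < (table A hints).length, ∃ j, IsConj (r i * letter A hA hints k) (r j))
    (g : cartanWeylGroup A hA) : ∃ i, IsConj g (r i) := by
  induction g using weyl_induction with
  | h1 =>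
    obtain ⟨i, hi⟩ := h1
    exact ⟨i, hi ▸ IsConj.refl _⟩
  | hs j g ih =>
    obtain ⟨i, hi⟩ := ih
    obtain ⟨k, hk, hjk⟩ := exists_letter_eq_simpleReflection (A := A) (hA := hA) (hints := hints) j
    obtain ⟨c, hc⟩ := isConj_iff.1 hi
    obtain ⟨l, hl, hkl⟩ := exists_conj_letter hT c hk
    obtain ⟨m, hm⟩ := hr i l hl
    -- Conjugating by the inverse of the simple reflection moves it from the left of `g` to the
    -- right; then `c` carries `g` to `r i` and the simple reflection to letter `l`.
    refine ⟨m, IsConj.trans (isConj_iff.2 ⟨c * (letter A hA hints k)⁻¹, ?_⟩) hm⟩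
    rw [hjk, ← hc, ← hkl]
    group

/-! ### Bounds -/

/-- Membership is taken up to sign because a simple reflection sends its own root to the negative,
which need not be in the table. -/
theorem exists_mem_table_reflection (hT : TableGood (simplePairs A) (table A hints)) (k : Fin n)
    (x : Fin n → ℤ) (hx : ∃ t ∈ table A hints, List.ofFn x = t.1 ∨ List.ofFn (-x) = t.1) :
    ∃ t ∈ table A hints, List.ofFn (simpleReflection A hA k x) = t.1 ∨
      List.ofFn (-simpleReflection A hA k x) = t.1 := by
  obtain ⟨t, ht, hwt⟩ := hx
  obtain ⟨β, φ, hβ, hs⟩ := realizes_simpleReflection A hA k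
  have key : ∀ y : Fin n → ℤ, List.ofFn y = t.1 → ∃ u ∈ table A hints,
      List.ofFn (simpleReflection A hA k y) = u.1 ∨
      List.ofFn (-simpleReflection A hA k y) = u.1 := by
    intro y hy
    rcases hT.conj_mem _ ht _ (simplePair_mem k) with h | h
    · refine ⟨_, h, Or.inl ?_⟩
      rw [hβ, conjPair, reflectList, ← hy, dot_ofFn, subMul_ofFn, hs]
    · refine ⟨_, ht, Or.inr ?_⟩
      have hyk : y = Pi.single k 1 := by
        apply List.ofFn_injective
        rw [hy, h]
      rw [← hy, hyk]
      congr 1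
      rw [simpleReflection, Module.reflection_apply_self, neg_neg]
  rcases hwt with h | h
  · exact key x h
  · obtain ⟨u, hu, h⟩ := key _ h
    rw [map_neg, neg_neg] at h
    exact ⟨u, hu, h.symm⟩

/-- Each column of the matrix of `w` is, up to sign, a root of the table, and those roots were
checked to have entries of absolute value at most 7. -/
theorem abs_apply_le_of_table (hT : TableGood (simplePairs A) (table A hints))
    (w : cartanWeylGroup A hA) (j i : Fin n) : |w.1 (Pi.single j 1) i| ≤ 7 := by
  have h : ∃ t ∈ table A hints, List.ofFn (w.1 (Pi.single j 1)) = t.1 ∨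
      List.ofFn (-w.1 (Pi.single j 1)) = t.1 := by
    induction w using weyl_induction with
    | h1 => exact ⟨_, simplePairs_subset_table (simplePair_mem j), Or.inl rfl⟩
    | hs k w ih => exact exists_mem_table_reflection (hA := hA) hT k _ ih
  obtain ⟨t, ht, h | h⟩ := h
  · refine hT.root_le t ht _ ?_
    rw [← h]
    exact (List.mem_ofFn' _ _).2 ⟨i, rfl⟩
  · rw [← abs_neg]
    refine hT.root_le t ht _ ?_
    rw [← h]
    exact (List.mem_ofFn' _ _).2 ⟨i, rfl⟩

/-- A vector whose image determines an element of the Weyl group. -/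
def probe (n : ℕ) : Fin n → ℤ := fun i => 16 ^ (i : ℕ)

theorem apply_probe (w : cartanWeylGroup A hA) (i : Fin n) :
    w.1 (probe n) i = ∑ j : Fin n, w.1 (Pi.single j 1) i * 16 ^ (j : ℕ) := by
  have : probe n = ∑ j : Fin n, (16 ^ (j : ℕ) : ℤ) • (Pi.single j 1 : Fin n → ℤ) := by
    funext i
    simp [probe, Finset.sum_apply, Pi.single_apply]
  rw [this, map_sum, Finset.sum_apply]
  refine Finset.sum_congr rfl fun j _ => ?_
  rw [map_smul, Pi.smul_apply, smul_eq_mul, mul_comm]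

/-- Coordinate `i` of the image of the probe has the `i`-th row of the matrix as signed digits to
base 16. Two such digits differ by at most 14, so the rows are determined. -/
theorem eq_of_apply_probe_eq (hT : TableGood (simplePairs A) (table A hints))
    {w w' : cartanWeylGroup A hA} (h : w.1 (probe n) = w'.1 (probe n)) : w = w' := by
  have hji : ∀ i, (fun j => w.1 (Pi.single j 1) i - w'.1 (Pi.single j 1) i) = 0 := by
    intro i
    refine eq_zero_of_pow_dvd_sum (C := 16) _ (fun j => ?_) ?_
    · have h1 := abs_apply_le_of_table hT w j i
      have h2 := abs_apply_le_of_table hT w' j i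
      have := abs_sub (w.1 (Pi.single j 1) i) (w'.1 (Pi.single j 1) i)
      omega
    · simp only [sub_mul, Finset.sum_sub_distrib, ← apply_probe, h, sub_self, dvd_zero]
  refine Subtype.ext (LinearEquiv.toLinearMap_injective ((Pi.basisFun ℤ (Fin n)).ext fun j => ?_))
  funext i
  simpa [sub_eq_zero] using congrFun (hji i) j

/-- The orbit of `x` consists of small vectors. -/
def SmallOrbit (A : Matrix (Fin n) (Fin n) ℤ) (hA : ∀ i, A i i = 2) (x : Fin n → ℤ) : Prop :=
  ∀ (w : cartanWeylGroup A hA) (i : Fin n), |w.1 x i| ≤ 2 ^ 34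

/-- Here the bound `2 ^ 34` originates: at most 8 columns, entries at most 7 and weights at most `16
^ 7` give `56 * 2 ^ 28 < 2 ^ 34`. -/
theorem smallOrbit_probe (hn8 : n ≤ 8) (hT : TableGood (simplePairs A) (table A hints)) :
    SmallOrbit A hA (probe n) := by
  intro w i
  rw [apply_probe]
  calc _ ≤ ∑ j : Fin n, |w.1 (Pi.single j 1) i * 16 ^ (j : ℕ)| := Finset.abs_sum_le_sum_abs _ _
    _ ≤ ∑ j : Fin n, 7 * 16 ^ 7 := Finset.sum_le_sum fun j _ => by
        rw [abs_mul, abs_of_pos (by positivity : (0 : ℤ) < 16 ^ (j : ℕ))]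
        have : (16 : ℤ) ^ (j : ℕ) ≤ 16 ^ 7 := pow_le_pow_right₀ (by norm_num) (by omega)
        exact mul_le_mul (abs_apply_le_of_table hT w j i) this (by positivity) (by norm_num)
    _ ≤ _ := by
        rw [Finset.sum_const, Finset.card_univ, Fintype.card_fin, nsmul_eq_mul]
        have : (n : ℤ) ≤ 8 := by exact_mod_cast hn8
        norm_num
        linarith

/-- Smallness is required of the whole orbit because every intermediate vector of the computation
must satisfy the bound in `step_rep`. -/
theorem run_rep (hn : 1 ≤ n) (hn8 : n ≤ 8) (hT : TableGood (simplePairs A) (table A hints))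
    {x : Fin n → ℤ} (hx : SmallOrbit A hA x) (l : List ℕ) :
    (machine n (table A hints)).run l (rep x) = rep ((word A hA hints l).1 x) := by
  induction l with
  | nil => rfl
  | cons k l ih =>
    rw [Machine.run_cons, ih]
    refine (step_rep hn hn8 ?_ (realizes_letter A hA hints k) (hx _)).trans ?_
    · by_cases hk : k < (table A hints).length
      · rw [List.getD_eq_getElem _ _ hk]; exact hT.coroot_le _ (List.getElem_mem hk)
      · rw [List.getD_eq_default _ _ (not_lt.1 hk)]
        simp [zeroPair, absSum]
    · rw [word_cons]; rfl

/-- Words are compared as group elements by one pair of natural numbers; every conjugacy in the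
certificates is verified through this. -/
theorem run_rep_injective (hn : 1 ≤ n) (hn8 : n ≤ 8)
    (hT : TableGood (simplePairs A) (table A hints)) {l m : List ℕ}
    (h : (machine n (table A hints)).run l (rep (probe n)) =
      (machine n (table A hints)).run m (rep (probe n))) :
    word A hA hints l = word A hA hints m := by
  have hs := smallOrbit_probe (hA := hA) hn8 hT
  rw [run_rep (hA := hA) hn hn8 hT hs, run_rep (hA := hA) hn hn8 hT hs] at h
  exact eq_of_apply_probe_eq hT (rep_injective (hs _) (hs _) h)

end

section

variable {n : ℕ} {A : Matrix (Fin n) (Fin n) ℤ} {hA : ∀ i, A i i = 2} {hints : List (ℕ × ℕ)}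

/-! ### Certificates that a list of words meets every conjugacy class -/

/-- The first `len` digits of `N` to base `128`. -/
def digits : ℕ → ℕ → List ℕ
  | 0, _ => []
  | len + 1, N => Nat.mod N 128 :: digits len (Nat.div N 128)

/-- Checks that the products of the word `r` with the reflections number `k, ..., k + f - 1` are
conjugate to elements of `reps`. The digits of `N` describe, for each reflection, either a
conjugating word and the number of a representative, or a smaller number of a reflection for which
the product is conjugate under `r`. -/
noncomputable def rowCheck (m : Machine) (V₀ : ℕ) (reps : List (List ℕ)) (r : List ℕ) (Vr : ℕ) :
    ℕ → ℕ → ℕ → Bool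
  | 0, _, _ => true
  | f + 1, k, N => force (m.run r (m.step k V₀)) fun V =>
    -- The lowest two bits are the tag and the next seven an index. Under tag 0, three bits give the
    -- length of the conjugating word and its letters follow to base 128. Seven bits suffice even in
    -- type `E₈`, with 120 reflections and 112 classes.
    match Nat.mod N 4 with
    | 0 => force (Nat.mod (Nat.div N 4) 128) fun j => force (Nat.mod (Nat.div N 512) 8) fun len =>
      (fun w => Nat.beq (m.run w V) (m.run (reps.getD j []) (m.run w V₀)))
        (digits len (Nat.div N 4096)) &&
      force (Nat.div (Nat.div N 4096) (Nat.pow 128 len)) fun N =>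
        rowCheck m V₀ reps r Vr f (Nat.succ k) N
    | 1 => force (Nat.mod (Nat.div N 4) 128) fun j =>
      -- This compares `r t_k` with `t_j r`. The latter is conjugate to `r t_j`, which was treated
      -- earlier because `j < k`.
      Nat.blt j k && Nat.beq V (m.step j Vr) &&
      force (Nat.div N 512) fun N => rowCheck m V₀ reps r Vr f (Nat.succ k) N
    | _ => force (Nat.mod (Nat.div N 4) 128) fun j =>
      -- The mirror case `r t_j = t_k r`, where the right side is conjugate to `r t_k`.
      Nat.blt j k && Nat.beq (m.run r (m.step j V₀)) (m.step k Vr) &&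
      force (Nat.div N 512) fun N => rowCheck m V₀ reps r Vr f (Nat.succ k) N

/-- Checks all rows of a certificate. -/
noncomputable def coverCheck (m : Machine) (V₀ : ℕ) (reps : List (List ℕ)) (f : ℕ) :
    List (List ℕ) → List ℕ → Bool
  | [], _ => true
  | _ :: _, [] => false
  | r :: rs, N :: Ns => force (m.run r V₀) (fun Vr => rowCheck m V₀ reps r Vr f 0 N) &&
    coverCheck m V₀ reps f rs Ns

section

variable (hn : 1 ≤ n) (hn8 : n ≤ 8) (hT : TableGood (simplePairs A) (table A hints))

include hn hn8 hT

/-- The hypothesis `hk` carries the reflections already treated. A certificate may therefore refer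
back to a smaller index instead of supplying a conjugating word, since conjugation by `r` or its
inverse links the two products. -/
theorem isConj_of_rowCheck {reps : List (List ℕ)} (hreps : [] ∈ reps) (r : List ℕ) (f k N : ℕ)
    (h : rowCheck (machine n (table A hints)) (rep (probe n)) reps r
      ((machine n (table A hints)).run r (rep (probe n))) f k N = true)
    (hk : ∀ l < k, ∃ s ∈ reps,
      IsConj (word A hA hints r * letter A hA hints l) (word A hA hints s)) :
    ∀ l < k + f, ∃ s ∈ reps,
      IsConj (word A hA hints r * letter A hA hints l) (word A hA hints s) := by
  have hrun : ∀ {l m : List ℕ}, (machine n (table A hints)).run l (rep (probe n)) =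
      (machine n (table A hints)).run m (rep (probe n)) →
      word A hA hints l = word A hA hints m := run_rep_injective hn hn8 hT
  have happ : ∀ (l m : List ℕ) (V : ℕ), (machine n (table A hints)).run l
      ((machine n (table A hints)).run m V) = (machine n (table A hints)).run (l ++ m) V := by
    intro l m V
    induction l with
    | nil => rfl
    | cons a l ih => rw [List.cons_append, Machine.run_cons, Machine.run_cons, ih]
  have hstep : ∀ (i V : ℕ), (machine n (table A hints)).step i V =
      (machine n (table A hints)).run [i] V := by
    intro i V; rw [Machine.run_cons, Machine.run_nil]
  -- An index out of range yields the empty word, which is a representative by `hreps`.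
  have hgetD : ∀ j, reps.getD j [] ∈ reps := by
    intro j
    by_cases hj : j < reps.length
    · rw [List.getD_eq_getElem _ _ hj]; exact List.getElem_mem hj
    · rw [List.getD_eq_default _ _ (not_lt.1 hj)]; exact hreps
  induction f generalizing k N with
  | zero => exact hk
  | succ f ih =>
    have next : ∀ N', rowCheck (machine n (table A hints)) (rep (probe n)) reps r
        ((machine n (table A hints)).run r (rep (probe n))) f (Nat.succ k) N' = true →
        (∃ s ∈ reps, IsConj (word A hA hints r * letter A hA hints k) (word A hA hints s)) →
        ∀ l < k + (f + 1), ∃ s ∈ reps,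
          IsConj (word A hA hints r * letter A hA hints l) (word A hA hints s) := by
      intro N' hN' hs l hl
      refine ih (Nat.succ k) N' hN' (fun l hl => ?_) l (by omega)
      rcases Nat.lt_succ_iff_lt_or_eq.1 hl with h | rfl
      · exact hk l h
      · exact hs
    rw [rowCheck, force_eq] at h
    split at h
    · simp only [force_eq, Bool.and_eq_true] at h
      refine next _ h.2 ⟨_, hgetD (Nat.mod (Nat.div N 4) 128), ?_⟩
      have e := Nat.eq_of_beq_eq_true h.1
      simp only [hstep, happ] at e
      have e := hrun e
      simp only [word_append, word_cons, word_nil, mul_one] at e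
      exact isConj_iff.2 ⟨_, by rw [mul_inv_eq_iff_eq_mul]; exact e⟩
    · simp only [force_eq, Bool.and_eq_true] at h
      obtain ⟨s, hs, hc⟩ := hk _ (Nat.blt_eq.mp h.1.1)
      refine next _ h.2 ⟨s, hs, IsConj.trans ?_ hc⟩
      have e := Nat.eq_of_beq_eq_true h.1.2
      simp only [hstep, happ] at e
      have e := hrun e
      simp only [word_append, word_cons, word_nil, mul_one] at e
      refine isConj_iff.2 ⟨word A hA hints r, ?_⟩
      rw [e]; group
    · simp only [force_eq, Bool.and_eq_true] at h
      obtain ⟨s, hs, hc⟩ := hk _ (Nat.blt_eq.mp h.1.1)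
      refine next _ h.2 ⟨s, hs, IsConj.trans ?_ hc⟩
      have e := Nat.eq_of_beq_eq_true h.1.2
      simp only [hstep, happ] at e
      have e := hrun e
      simp only [word_append, word_cons, word_nil, mul_one] at e
      refine isConj_iff.2 ⟨(word A hA hints r)⁻¹, ?_⟩
      rw [e]; group

/-- The empty word supplies the identity that starts the induction; each row supplies closure of one
class under multiplication by reflections. -/
theorem isConj_of_coverCheck {reps : List (List ℕ)} (hreps : [] ∈ reps) {certs : List ℕ}
    (h : coverCheck (machine n (table A hints)) (rep (probe n)) reps (table A hints).length
      reps certs = true) (g : cartanWeylGroup A hA) :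
    ∃ r ∈ reps, IsConj g (word A hA hints r) := by
  have key : ∀ (rs : List (List ℕ)) (Ns : List ℕ),
      coverCheck (machine n (table A hints)) (rep (probe n)) reps (table A hints).length
      rs Ns = true → ∀ r ∈ rs, ∀ l < (table A hints).length, ∃ s ∈ reps,
        IsConj (word A hA hints r * letter A hA hints l) (word A hA hints s) := by
    intro rs
    induction rs with
    | nil => intro _ _ r hr; cases hr
    | cons a rs ih =>
      intro Ns h r hr
      cases Ns with
      | nil => exact absurd h Bool.false_ne_true
      | cons N Ns =>
        rw [coverCheck, force_eq, Bool.and_eq_true] at h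
        rcases List.mem_cons.1 hr with rfl | hr
        · intro l hl
          exact isConj_of_rowCheck hn hn8 hT hreps r _ 0 N h.1
            (fun l hl => absurd hl (Nat.not_lt_zero l)) l (by omega)
        · exact ih Ns h.2 r hr
  obtain ⟨⟨r, hr⟩, h⟩ := exists_conj_of_forall_letter hT
    (fun r : {r // r ∈ reps} => word A hA hints r.1) ⟨⟨[], hreps⟩, rfl⟩
    (fun r k hk => by
      obtain ⟨s, hs, hc⟩ := key reps certs h r.1 r.2 k hk
      exact ⟨⟨s, hs⟩, hc⟩) g
  exact ⟨r, hr, h⟩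

end

/-! ### Orders -/

/-- Iterates the word `r` until the vector `V₀` comes back, and returns the number of steps. -/
noncomputable def orderAux (m : Machine) (V₀ : ℕ) (r : List ℕ) : ℕ → ℕ → ℕ → ℕ
  | 0, _, _ => 0
  | f + 1, k, V => match Nat.beq V V₀ with
    | true => k
    | false => force (m.run r V) fun V => orderAux m V₀ r f (Nat.succ k) V

/-- Checks the orders of a list of words. -/
noncomputable def orderCheck (m : Machine) (V₀ : ℕ) (classes : List (ℕ × List ℕ)) : Bool :=
  classes.all fun c => Nat.blt 0 c.1 && Nat.blt c.1 64 &&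
    Nat.beq (orderAux m V₀ c.2 64 1 (m.run c.2 V₀)) c.1

section

variable (hn : 1 ≤ n) (hn8 : n ≤ 8) (hT : TableGood (simplePairs A) (table A hints))

include hn hn8 hT

/-- A power of the word is the identity exactly when it returns the probe vector, so the first
return time is the order. -/
theorem orderOf_of_orderAux {r : List ℕ} {o : ℕ} (ho : 0 < o) (f k : ℕ) (hk : 0 < k)
    (hlt : ∀ m, 0 < m → m < k → word A hA hints r ^ m ≠ 1)
    (h : orderAux (machine n (table A hints)) (rep (probe n)) r f k
      (rep ((word A hA hints r ^ k).1 (probe n))) = o) :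
    orderOf (word A hA hints r) = o := by
  have hs := smallOrbit_probe (hA := hA) hn8 hT
  induction f generalizing k with
  -- Exhausted fuel returns 0, which is excluded by the positivity of the claimed order.
  | zero => exact absurd (show 0 = o from h) ho.ne
  | succ f ih =>
    have hiff : rep ((word A hA hints r ^ k).1 (probe n)) = rep (probe n) ↔
        word A hA hints r ^ k = 1 := by
      constructor
      · intro e
        exact eq_of_apply_probe_eq hT (w' := 1) (rep_injective (hs _) (hs 1) e)
      · intro e
        rw [e]; rfl
    rw [orderAux] at h
    split at h
    · next hb =>
      have hb := hiff.1 (Nat.eq_of_beq_eq_true hb)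
      subst h
      exact (orderOf_eq_iff hk).2 ⟨hb, fun m hm hm0 => hlt m hm0 hm⟩
    · next hb =>
      have hb' : word A hA hints r ^ k ≠ 1 := by
        intro e
        rw [hiff.2 e, Nat.beq_refl] at hb
        exact Bool.noConfusion hb
      rw [force_eq] at h
      refine ih (Nat.succ k) (Nat.succ_pos _) (fun m hm hmk => ?_) ?_
      · rcases Nat.lt_succ_iff_lt_or_eq.1 hmk with h' | rfl
        · exact hlt m hm h'
        · exact hb'
      · have hs' : SmallOrbit A hA ((word A hA hints r ^ k).1 (probe n)) := fun w => by
          have := hs (w * word A hA hints r ^ k)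
          exact this
        rw [run_rep hn hn8 hT hs'] at h
        rw [← h, pow_succ']
        rfl

theorem orderOf_of_orderCheck {classes : List (ℕ × List ℕ)}
    (h : orderCheck (machine n (table A hints)) (rep (probe n)) classes = true) :
    ∀ c ∈ classes, c.1 < 64 ∧ orderOf (word A hA hints c.2) = c.1 := by
  intro c hc
  have := List.all_eq_true.1 h c hc
  simp only [Bool.and_eq_true, Nat.blt_eq] at this
  refine ⟨this.1.2, orderOf_of_orderAux hn hn8 hT this.1.1 64 1 one_pos
    (fun m h1 h2 => by omega) ?_⟩
  rw [← Nat.eq_of_beq_eq_true this.2, run_rep (hA := hA) hn hn8 hT (smallOrbit_probe hn8 hT),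
    pow_one]

end

end

section

variable {n : ℕ} {A : Matrix (Fin n) (Fin n) ℤ} {hA : ∀ i, A i i = 2} {hints : List (ℕ × ℕ)}

/-! ### Class functions that count vectors -/

/-- The list `Y` is a set of small vectors that is stable under the Weyl group. -/
structure StableList (A : Matrix (Fin n) (Fin n) ℤ) (hA : ∀ i, A i i = 2) (Y : List (List ℤ)) :
    Prop where
  exists_ofFn : ∀ l ∈ Y, ∃ x : Fin n → ℤ, l = List.ofFn x
  reflection_mem : ∀ (j : Fin n) (x : Fin n → ℤ), List.ofFn x ∈ Y →
    List.ofFn (simpleReflection A hA j x) ∈ Y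
  le : ∀ l ∈ Y, ∀ a ∈ l, |a| ≤ 2 ^ 34
  nodup : Y.Nodup

theorem StableList.apply_mem {Y : List (List ℤ)} (hY : StableList A hA Y)
    (w : cartanWeylGroup A hA) {x : Fin n → ℤ} (hx : List.ofFn x ∈ Y) :
    List.ofFn (w.1 x) ∈ Y := by
  induction w using weyl_induction with
  | h1 => exact hx
  | hs j w ih => exact hY.reflection_mem j _ ih

theorem StableList.abs_le {Y : List (List ℤ)} (hY : StableList A hA Y) {x : Fin n → ℤ}
    (hx : List.ofFn x ∈ Y) (i : Fin n) : |x i| ≤ 2 ^ 34 :=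
  hY.le _ hx _ ((List.mem_ofFn' _ _).2 ⟨i, rfl⟩)

theorem StableList.smallOrbit {Y : List (List ℤ)} (hY : StableList A hA Y) {x : Fin n → ℤ}
    (hx : List.ofFn x ∈ Y) : SmallOrbit A hA x :=
  fun w i => hY.abs_le (hY.apply_mem w hx) i

/-- The number of vectors in `Y` that `w` multiplies by `c`. -/
noncomputable def eigenCount (A : Matrix (Fin n) (Fin n) ℤ) (hA : ∀ i, A i i = 2)
    (Y : List (List ℤ)) (c : ℤ) (w : cartanWeylGroup A hA) : ℕ :=
  Set.ncard {x : Fin n → ℤ | List.ofFn x ∈ Y ∧ w.1 x = c • x}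

/-- The conjugating element maps the eigenvectors of `w` in the stable set `Y` bijectively to those
of its conjugate, with the same eigenvalue. -/
theorem eigenCount_eq_of_isConj {Y : List (List ℤ)} (hY : StableList A hA Y) (c : ℤ)
    {w w' : cartanWeylGroup A hA} (h : IsConj w w') :
    eigenCount A hA Y c w = eigenCount A hA Y c w' := by
  obtain ⟨u, rfl⟩ := isConj_iff.1 h
  rw [eigenCount, ← Set.ncard_image_of_injective _ u.1.injective, eigenCount]
  congr 1
  ext x
  constructor
  · rintro ⟨y, ⟨hy, hwy⟩, rfl⟩
    refine ⟨hY.apply_mem u hy, ?_⟩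
    change u.1 (w.1 (u.1.symm (u.1 y))) = _
    rw [LinearEquiv.symm_apply_apply, hwy, map_smul]
  · rintro ⟨hx, hwx⟩
    refine ⟨u.1.symm x, ⟨hY.apply_mem u⁻¹ hx, ?_⟩, LinearEquiv.apply_symm_apply _ _⟩
    have : u.1 (w.1 (u.1.symm x)) = c • x := hwx
    rw [← map_smul, ← this, LinearEquiv.symm_apply_apply]

/-- The packed form of a list of vectors. -/
def packList (M : ℕ) (Y : List (List ℤ)) : List ℕ := Y.map fun l => residue M (pack l)

/-- The packed form of the negative of a vector. -/
def negate (M V : ℕ) : ℕ := Nat.mod (Nat.sub M V) M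

/-- The number of packed vectors fixed by a word. -/
noncomputable def fixedCount (m : Machine) (l : List ℕ) (Vs : List ℕ) : ℕ :=
  @List.rec ℕ (fun _ => ℕ) 0
    (fun V _ ih => bif Nat.beq (m.run l V) V then Nat.succ ih else ih) Vs

/-- The number of packed vectors negated by a word. -/
noncomputable def negatedCount (m : Machine) (l : List ℕ) (Vs : List ℕ) : ℕ :=
  @List.rec ℕ (fun _ => ℕ) 0
    (fun V _ ih => bif Nat.beq (m.run l V) (negate m.modulus V) then Nat.succ ih else ih) Vs

theorem rec_count_eq (p : ℕ → Bool) (Vs : List ℕ) :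
    @List.rec ℕ (fun _ => ℕ) 0 (fun V _ ih => bif p V then Nat.succ ih else ih) Vs =
      Vs.countP p := by
  induction Vs with
  | nil => rfl
  | cons V Vs ih =>
    rw [List.countP_cons]
    change (bif p V then Nat.succ (List.rec _ _ Vs) else List.rec _ _ Vs) = _
    rw [ih]
    cases p V <;> rfl

/-- Absence of duplicates in `Y` makes counting list entries the same as counting vectors, and each
vector may be tested through its packed form. -/
theorem ncard_eq_countP {Y : List (List ℤ)} (hY : StableList A hA Y) (P : (Fin n → ℤ) → Prop)
    (p : ℕ → Bool) (hp : ∀ x : Fin n → ℤ, List.ofFn x ∈ Y → (p (rep x) = true ↔ P x)) :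
    Set.ncard {x : Fin n → ℤ | List.ofFn x ∈ Y ∧ P x} = (packList (base ^ n) Y).countP p := by
  rw [packList, List.countP_map, List.countP_eq_length_filter,
    ← List.toFinset_card_of_nodup (hY.nodup.filter _), ← Set.ncard_coe_finset,
    ← Set.ncard_image_of_injective _ List.ofFn_injective]
  congr 1
  ext l
  simp only [Set.mem_image, Set.mem_ofPred_eq, List.coe_toFinset, List.mem_filter,
    Function.comp_apply]
  constructor
  · rintro ⟨x, ⟨hx, hPx⟩, rfl⟩
    exact ⟨hx, by rw [← rep_eq_residue]; exact (hp x hx).2 hPx⟩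
  · rintro ⟨hl, h⟩
    obtain ⟨x, rfl⟩ := hY.exists_ofFn l hl
    rw [← rep_eq_residue] at h
    exact ⟨x, ⟨hl, (hp x hl).1 h⟩, rfl⟩

theorem rep_neg (x : Fin n → ℤ) : rep (-x) = negate (base ^ n) (rep x) := by
  have hM : 0 < base ^ n := pow_pos (by norm_num [base]) n
  have h1 : rep x < base ^ n := by rw [rep_eq_residue]; exact residue_lt hM _
  zify
  change _ = (((base ^ n - rep x) % base ^ n : ℕ) : ℤ)
  push_cast [h1.le]
  rw [coe_rep, coe_rep, pack_ofFn, pack_ofFn]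
  have : ∑ i : Fin n, (-x) i * (base : ℤ) ^ (i : ℕ) = -∑ i, x i * (base : ℤ) ^ (i : ℕ) := by
    simp
  rw [this]
  set a := ∑ i, x i * (base : ℤ) ^ (i : ℕ)
  set M := (base : ℤ) ^ n
  refine Int.ModEq.trans ?_ (Int.ModEq.sub_left M (Int.mod_modEq a M).symm)
  exact Int.modEq_iff_dvd.2 ⟨1, by ring⟩

section

variable (hn : 1 ≤ n) (hn8 : n ≤ 8) (hT : TableGood (simplePairs A) (table A hints))

include hn hn8 hT

theorem eigenCount_one {Y : List (List ℤ)} (hY : StableList A hA Y) (l : List ℕ) :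
    eigenCount A hA Y 1 (word A hA hints l) =
      fixedCount (machine n (table A hints)) l (packList (base ^ n) Y) := by
  rw [fixedCount, rec_count_eq (fun V => Nat.beq ((machine n (table A hints)).run l V) V),
    eigenCount, ncard_eq_countP hY]
  intro x hx
  rw [Nat.beq_eq, run_rep (hA := hA) hn hn8 hT (hY.smallOrbit hx), one_smul]
  exact ⟨fun h => rep_injective (hY.smallOrbit hx _) (hY.abs_le hx) h, fun h => by rw [h]⟩

theorem eigenCount_neg_one {Y : List (List ℤ)} (hY : StableList A hA Y) (l : List ℕ) :
    eigenCount A hA Y (-1) (word A hA hints l) =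
      negatedCount (machine n (table A hints)) l (packList (base ^ n) Y) := by
  rw [negatedCount, rec_count_eq (fun V => Nat.beq ((machine n (table A hints)).run l V)
    (negate (machine n (table A hints)).modulus V)), eigenCount, ncard_eq_countP hY]
  intro x hx
  change Nat.beq _ (negate (base ^ n) (rep x)) = true ↔ _
  rw [Nat.beq_eq, run_rep (hA := hA) hn hn8 hT (hY.smallOrbit hx), neg_one_smul, ← rep_neg]
  refine ⟨fun h => rep_injective (hY.smallOrbit hx _) (fun i => ?_) h, fun h => by rw [h]⟩
  rw [Pi.neg_apply, abs_neg]
  exact hY.abs_le hx i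

end

/-! ### Separating conjugacy classes -/

/-- An invariant of the class of a word, computed from its order and eigenvector counts. -/
noncomputable def classKey (m : Machine) (Ys : List (List ℕ)) (c : ℕ × List ℕ) : ℕ :=
  Ys.foldr (fun Vs a => Nat.add (fixedCount m c.2 Vs)
    (Nat.mul 512 (Nat.add (negatedCount m c.2 Vs) (Nat.mul 512 a)))) c.1

/-- Compares the classes of two words by eigenvector counts of their second and fourth powers. -/
noncomputable def powersDiffer (m : Machine) (Ys : List (List ℕ)) (l l' : List ℕ) : Bool :=
  Ys.any fun Vs =>
    !Nat.beq (fixedCount m (l ++ l) Vs) (fixedCount m (l' ++ l') Vs) ||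
    !Nat.beq (fixedCount m ((l ++ l) ++ (l ++ l)) Vs) (fixedCount m ((l' ++ l') ++ (l' ++ l')) Vs)

/-- Checks that words in a list belong to distinct classes, and that their classes differ from those
in `seen`. -/
noncomputable def distinctCheck (m : Machine) (Ys : List (List ℕ)) :
    List (ℕ × List ℕ) → List (ℕ × List ℕ) → Bool
  | [], _ => true
  | c :: cs, seen => force (classKey m Ys c) fun key =>
    (seen.all fun s => !Nat.beq s.1 key || powersDiffer m Ys s.2 c.2) &&
      distinctCheck m Ys cs ((key, c.2) :: seen)

/-- Squares of conjugate elements are conjugate; applied twice, this handles fourth powers. -/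
theorem isConj_word_append_self {l l' : List ℕ}
    (h : IsConj (word A hA hints l) (word A hA hints l')) :
    IsConj (word A hA hints (l ++ l)) (word A hA hints (l' ++ l')) := by
  rw [word_append, word_append, ← pow_two, ← pow_two]
  exact h.pow 2

section

variable (hn : 1 ≤ n) (hn8 : n ≤ 8) (hT : TableGood (simplePairs A) (table A hints))

include hn hn8 hT

theorem fixedCount_eq_of_isConj {Y : List (List ℤ)} (hY : StableList A hA Y) {l l' : List ℕ}
    (h : IsConj (word A hA hints l) (word A hA hints l')) :
    fixedCount (machine n (table A hints)) l (packList (base ^ n) Y) =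
      fixedCount (machine n (table A hints)) l' (packList (base ^ n) Y) := by
  rw [← eigenCount_one hn hn8 hT hY, ← eigenCount_one hn hn8 hT hY, eigenCount_eq_of_isConj hY 1 h]

theorem negatedCount_eq_of_isConj {Y : List (List ℤ)} (hY : StableList A hA Y) {l l' : List ℕ}
    (h : IsConj (word A hA hints l) (word A hA hints l')) :
    negatedCount (machine n (table A hints)) l (packList (base ^ n) Y) =
      negatedCount (machine n (table A hints)) l' (packList (base ^ n) Y) := by
  rw [← eigenCount_neg_one hn hn8 hT hY, ← eigenCount_neg_one hn hn8 hT hY,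
    eigenCount_eq_of_isConj hY (-1) h]

/-- Only this direction is used, so nothing depends on the digits to base 512 being unambiguous:
unequal keys prove non-conjugacy, however the key is built. -/
theorem classKey_eq_of_isConj {Ys : List (List (List ℤ))} (hY : ∀ Y ∈ Ys, StableList A hA Y)
    {c c' : ℕ × List ℕ} (hc : orderOf (word A hA hints c.2) = c.1)
    (hc' : orderOf (word A hA hints c'.2) = c'.1)
    (h : IsConj (word A hA hints c.2) (word A hA hints c'.2)) :
    classKey (machine n (table A hints)) (Ys.map (packList (base ^ n))) c =
      classKey (machine n (table A hints)) (Ys.map (packList (base ^ n))) c' := by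
  induction Ys with
  | nil =>
    change c.1 = c'.1
    rw [← hc, ← hc']
    obtain ⟨u, hu⟩ := isConj_iff.1 h
    rw [← hu]
    exact ((MulAut.conj u).orderOf_eq _).symm
  | cons Y Ys ih =>
    have h1 := ih fun Y' hY' => hY Y' (List.mem_cons_of_mem _ hY')
    have hY1 := hY Y List.mem_cons_self
    simp only [classKey, List.map_cons, List.foldr_cons] at h1 ⊢
    rw [h1, fixedCount_eq_of_isConj hn hn8 hT hY1 h, negatedCount_eq_of_isConj hn hn8 hT hY1 h]

/-- The counts for the second and fourth powers are class functions too, and can separate classes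
whose keys coincide. -/
theorem not_isConj_of_powersDiffer {Ys : List (List (List ℤ))}
    (hY : ∀ Y ∈ Ys, StableList A hA Y) {l l' : List ℕ}
    (h : powersDiffer (machine n (table A hints)) (Ys.map (packList (base ^ n))) l l' = true) :
    ¬ IsConj (word A hA hints l) (word A hA hints l') := by
  intro hc
  obtain ⟨Vs, hVs, h⟩ := List.any_eq_true.1 h
  obtain ⟨Y, hYm, rfl⟩ := List.mem_map.1 hVs
  have h2 := isConj_word_append_self hc
  have h4 := isConj_word_append_self h2
  rw [fixedCount_eq_of_isConj hn hn8 hT (hY Y hYm) h2,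
    fixedCount_eq_of_isConj hn hn8 hT (hY Y hYm) h4, Nat.beq_refl, Nat.beq_refl] at h
  exact Bool.noConfusion h

theorem pairwise_of_distinctCheck {Ys : List (List (List ℤ))}
    (hY : ∀ Y ∈ Ys, StableList A hA Y) {cs : List (ℕ × List ℕ)}
    (hcs : ∀ c ∈ cs, orderOf (word A hA hints c.2) = c.1)
    (h : distinctCheck (machine n (table A hints)) (Ys.map (packList (base ^ n))) cs [] = true) :
    cs.Pairwise fun c c' => ¬ IsConj (word A hA hints c.2) (word A hA hints c'.2) := by
  -- The induction has to carry the words already seen, each with its stored key. Such a key was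
  -- computed from a verified order, which is recovered existentially.
  have key : ∀ (cs seen : List (ℕ × List ℕ)),
      (∀ c ∈ cs, orderOf (word A hA hints c.2) = c.1) →
      (∀ s ∈ seen, ∃ o, orderOf (word A hA hints s.2) = o ∧ s.1 =
        classKey (machine n (table A hints)) (Ys.map (packList (base ^ n))) (o, s.2)) →
      distinctCheck (machine n (table A hints)) (Ys.map (packList (base ^ n))) cs seen = true →
      (cs.Pairwise fun c c' => ¬ IsConj (word A hA hints c.2) (word A hA hints c'.2)) ∧
      ∀ s ∈ seen, ∀ c ∈ cs, ¬ IsConj (word A hA hints s.2) (word A hA hints c.2) := by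
    intro cs
    induction cs with
    | nil => intro seen _ _ _; exact ⟨List.Pairwise.nil, fun s _ c hc => by cases hc⟩
    | cons c cs ih =>
      intro seen hcs hseen h
      rw [distinctCheck, force_eq, Bool.and_eq_true] at h
      obtain ⟨h1, h2⟩ := ih _ (fun c' hc' => hcs c' (List.mem_cons_of_mem _ hc'))
        (fun s hs => by
          rcases List.mem_cons.1 hs with rfl | hs
          · exact ⟨c.1, hcs c List.mem_cons_self, rfl⟩
          · exact hseen s hs) h.2
      refine ⟨List.pairwise_cons.2 ⟨fun c' hc' => h2 _ List.mem_cons_self c' hc', h1⟩,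
        fun s hs c' hc' => ?_⟩
      rcases List.mem_cons.1 hc' with rfl | hc'
      · intro hconj
        obtain ⟨o, ho, hk⟩ := hseen s hs
        have := List.all_eq_true.1 h.1 s hs
        rw [Bool.or_eq_true] at this
        rcases this with h3 | h3
        · rw [hk, classKey_eq_of_isConj hn hn8 hT hY (c := (o, s.2)) (c' := c') ho
            (hcs c' List.mem_cons_self) hconj, Nat.beq_refl] at h3
          exact Bool.noConfusion h3
        · exact not_isConj_of_powersDiffer hn hn8 hT hY h3 hconj
      · exact h2 s (List.mem_cons_of_mem _ hs) c' hc'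
  exact (key cs [] hcs (fun s hs => by cases hs) h).1

end

/-! ### Stable lists -/

/-- The negative of a list. -/
def negList (l : List ℤ) : List ℤ := l.map Int.neg

theorem negList_ofFn (x : Fin n → ℤ) : negList (List.ofFn x) = List.ofFn (-x) := by
  rw [negList, List.map_ofFn]; rfl

/-- The roots of a table, with both signs. -/
def signedRoots (T : List (List ℤ × List ℤ)) : List (List ℤ) :=
  T.map (fun t => t.1) ++ T.map fun t => negList t.1

/-- Checks that no entry of a list of numbers occurs twice. -/
def nodupCheck : List ℕ → Bool
  | [] => true
  | a :: l => (l.all fun b => !Nat.beq a b) && nodupCheck l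

theorem nodup_of_nodupCheck : ∀ {l : List ℕ}, nodupCheck l = true → l.Nodup
  | [], _ => List.nodup_nil
  | a :: l, h => by
    rw [nodupCheck, Bool.and_eq_true, List.all_eq_true] at h
    refine List.nodup_cons.2 ⟨fun ha => ?_, nodup_of_nodupCheck h.2⟩
    have := h.1 a ha
    rw [Nat.beq_refl] at this
    exact Bool.noConfusion this

/-- Stability comes from closure of the table up to sign. Distinctness of the packed values already
implies distinctness of the roots, so `M` may be arbitrary and packing need not be injective here.
-/
theorem stableList_signedRoots (hT : TableGood (simplePairs A) (table A hints)) {M : ℕ}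
    (h : nodupCheck (packList M (signedRoots (table A hints))) = true) :
    StableList A hA (signedRoots (table A hints)) := by
  have hof : ∀ t ∈ table A hints, ∃ x : Fin n → ℤ, t.1 = List.ofFn x := by
    intro t ht
    obtain ⟨-, -, β, φ, rfl, -⟩ := exists_realizes_of_mem_table A hA hints t ht
    exact ⟨β, rfl⟩
  have hmem : ∀ x : Fin n → ℤ, List.ofFn x ∈ signedRoots (table A hints) ↔
      ∃ t ∈ table A hints, List.ofFn x = t.1 ∨ List.ofFn (-x) = t.1 := by
    intro x
    rw [signedRoots, List.mem_append, List.mem_map, List.mem_map]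
    constructor
    · rintro (⟨t, ht, h⟩ | ⟨t, ht, h⟩)
      · exact ⟨t, ht, Or.inl h.symm⟩
      · obtain ⟨y, hy⟩ := hof t ht
        rw [hy, negList_ofFn] at h
        exact ⟨t, ht, Or.inr (by rw [hy, ← List.ofFn_injective h, neg_neg])⟩
    · rintro ⟨t, ht, h | h⟩
      · exact Or.inl ⟨t, ht, h.symm⟩
      · exact Or.inr ⟨t, ht, by rw [← h, negList_ofFn, neg_neg]⟩
  refine ⟨?_, ?_, ?_, (nodup_of_nodupCheck h).of_map _⟩
  · intro l hl
    rcases List.mem_append.1 hl with hl | hl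
    · obtain ⟨t, ht, rfl⟩ := List.mem_map.1 hl
      exact hof t ht
    · obtain ⟨t, ht, rfl⟩ := List.mem_map.1 hl
      obtain ⟨x, hx⟩ := hof t ht
      exact ⟨-x, by rw [hx, negList_ofFn]⟩
  · intro j x hx
    rw [hmem] at hx ⊢
    exact exists_mem_table_reflection hT j x hx
  · intro l hl a ha
    have : |a| ≤ 7 := by
      rcases List.mem_append.1 hl with hl | hl
      · obtain ⟨t, ht, rfl⟩ := List.mem_map.1 hl
        exact hT.root_le t ht a ha
      · obtain ⟨t, ht, rfl⟩ := List.mem_map.1 hl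
        obtain ⟨b, hb, rfl⟩ := List.mem_map.1 ha
        have := hT.root_le t ht b hb
        rwa [← abs_neg] at this
    exact this.trans (by norm_num)

/-- Checks that a list of vectors is stable under the reflections in `S`. -/
def stableCheck (n M : ℕ) (S : List (List ℤ × List ℤ)) (Y : List (List ℤ)) : Bool :=
  (Y.all fun l => Nat.beq l.length n && (l.all fun a => Nat.ble a.natAbs 7) &&
    S.all fun s => Y.any (eqList (reflectList s l))) && nodupCheck (packList M Y)

/-- Checking the simple reflections is enough, because they generate the group. -/
theorem stableList_of_stableCheck {M : ℕ} {Y : List (List ℤ)}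
    (h : stableCheck n M (simplePairs A) Y = true) : StableList A hA Y := by
  rw [stableCheck, Bool.and_eq_true] at h
  have h1 := fun l hl => List.all_eq_true.1 h.1 l hl
  simp only [Bool.and_eq_true, List.all_eq_true, List.any_eq_true] at h1
  refine ⟨fun l hl => ?_, fun j x hx => ?_, fun l hl a ha => ?_, (nodup_of_nodupCheck h.2).of_map _⟩
  · obtain rfl := Nat.eq_of_beq_eq_true (h1 l hl).1.1
    exact ⟨l.get, (List.ofFn_get l).symm⟩
  · obtain ⟨y, hy, he⟩ := (h1 _ hx).2 _ (simplePair_mem j)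
    obtain ⟨β, φ, hβ, hs⟩ := realizes_simpleReflection A hA j
    rw [← eq_of_eqList he, hβ, reflectList, dot_ofFn, subMul_ofFn, ← hs] at hy
    exact hy
  · have := Nat.le_of_ble_eq_true ((h1 l hl).1.2 a ha)
    rw [Int.abs_eq_natAbs]
    exact_mod_cast this.trans (by norm_num)

end

/-! ### Counting classes -/

/-- Tests whether `o` is one of the first five powers of `p`. -/
def isPowerOf (p o : ℕ) : Bool := [1, 2, 3, 4, 5].any fun d => Nat.beq (p ^ d) o

/-- For `p ≥ 2` a sixth power is at least 64, so an order below 64 leaves only the exponents 1 to 5.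
-/
theorem isPowerOf_iff {p o : ℕ} (hp : 2 ≤ p) (ho : o < 64) :
    isPowerOf p o = true ↔ ∃ d, 1 ≤ d ∧ o = p ^ d := by
  rw [isPowerOf, List.any_eq_true]
  constructor
  · rintro ⟨d, hd, h⟩
    refine ⟨d, ?_, (Nat.eq_of_beq_eq_true h).symm⟩
    simp only [List.mem_cons, List.not_mem_nil, or_false] at hd
    omega
  · rintro ⟨d, hd, rfl⟩
    refine ⟨d, ?_, Nat.beq_refl _⟩
    have h6 : d < 6 := by
      by_contra h
      have h1 : 2 ^ 6 ≤ p ^ d := (Nat.pow_le_pow_left hp 6).trans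
        (Nat.pow_le_pow_right (by omega) (by omega))
      omega
    simp only [List.mem_cons, List.not_mem_nil, or_false]
    omega

/-- Tests whether `o` is a nontrivial power of `2`, `3`, `5` or `7`. -/
def isPowerOfSmallPrime (o : ℕ) : Bool := [2, 3, 5, 7].any fun p => isPowerOf p o

theorem orderOf_eq_of_isConj {G : Type*} [Group G] {a b : G} (h : IsConj a b) :
    orderOf a = orderOf b := by
  obtain ⟨u, rfl⟩ := isConj_iff.1 h
  exact ((MulAut.conj u).orderOf_eq a).symm

section

variable {G : Type*} [Group G] {w : List ℕ → G} {classes : List (ℕ × List ℕ)}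

/-- The order is constant on a conjugacy class, so the condition on all elements of a class may be
tested on its listed representative. -/
theorem setOf_orderOf_eq (hcover : ∀ g : G, ∃ c ∈ classes, IsConj g (w c.2))
    (hord : ∀ c ∈ classes, c.1 < 64 ∧ orderOf (w c.2) = c.1) {p : ℕ} (hp : 2 ≤ p) :
    {C : ConjClasses G | ∀ g ∈ C.carrier, ∃ d : ℕ, 1 ≤ d ∧ orderOf g = p ^ d} =
      {C | C ∈ (classes.filter fun c => isPowerOf p c.1).map fun c => ConjClasses.mk (w c.2)} := by
  ext C
  simp only [Set.mem_ofPred_eq, List.mem_map, List.mem_filter]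
  constructor
  · induction C using Quotient.inductionOn with | _ g
    intro h
    obtain ⟨c, hc, hgc⟩ := hcover g
    refine ⟨c, ⟨hc, (isPowerOf_iff hp (hord c hc).1).2 ?_⟩, ?_⟩
    · rw [← (hord c hc).2, ← orderOf_eq_of_isConj hgc]
      exact h g ConjClasses.mem_carrier_mk
    · exact (ConjClasses.mk_eq_mk_iff_isConj.2 hgc).symm
  · rintro ⟨c, ⟨hc, hpow⟩, rfl⟩ g hg
    rw [ConjClasses.mem_carrier_iff_mk_eq, ConjClasses.mk_eq_mk_iff_isConj] at hg
    rw [orderOf_eq_of_isConj hg, (hord c hc).2]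
    exact (isPowerOf_iff hp (hord c hc).1).1 hpow

theorem pPowerClassCount_eq_length (hcover : ∀ g : G, ∃ c ∈ classes, IsConj g (w c.2))
    (hord : ∀ c ∈ classes, c.1 < 64 ∧ orderOf (w c.2) = c.1)
    (hpw : (classes.filter fun c => isPowerOfSmallPrime c.1).Pairwise
      fun c c' => ¬ IsConj (w c.2) (w c'.2)) {p : ℕ} (hp : p ∈ [2, 3, 5, 7]) :
    pPowerClassCount p G = (classes.filter fun c => isPowerOf p c.1).length := by
  classical
  have hp2 : 2 ≤ p := by
    simp only [List.mem_cons, List.not_mem_nil, or_false] at hp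
    omega
  -- Non-conjugacy is known only among the words whose order is a nontrivial power of 2, 3, 5 or 7,
  -- so the filter for `p` is factored through that one.
  have hsub : (classes.filter fun c => isPowerOf p c.1) =
      (classes.filter fun c => isPowerOfSmallPrime c.1).filter fun c => isPowerOf p c.1 := by
    rw [List.filter_filter]
    refine List.filter_congr fun c _ => ?_
    cases h : isPowerOf p c.1
    · rfl
    · exact (List.any_eq_true.2 ⟨p, hp, h⟩ : isPowerOfSmallPrime c.1 = true).symm
  have hnd : ((classes.filter fun c => isPowerOf p c.1).map
      fun c => ConjClasses.mk (w c.2)).Nodup := by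
    rw [hsub]
    refine List.pairwise_map.2 ((hpw.filter _).imp fun h => ?_)
    rwa [Ne, ConjClasses.mk_eq_mk_iff_isConj]
  rw [pPowerClassCount, setOf_orderOf_eq hcover hord hp2, ← List.coe_toFinset,
    Set.encard_coe_eq_coe_finsetCard, List.toFinset_card_of_nodup hnd, List.length_map]

/-- All element orders divide `N`, so an order `p ^ d` with `d ≥ 1` would force `p ∣ N`. -/
theorem pPowerClassCount_eq_zero (hcover : ∀ g : G, ∃ c ∈ classes, IsConj g (w c.2))
    (hord : ∀ c ∈ classes, c.1 < 64 ∧ orderOf (w c.2) = c.1) {N : ℕ}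
    (hN : (classes.all fun c => Nat.beq (N % c.1) 0) = true) {p : ℕ} (hp : p.Prime)
    (hpN : ¬ p ∣ N) : pPowerClassCount p G = 0 := by
  rw [pPowerClassCount, setOf_orderOf_eq hcover hord hp.two_le, Set.encard_eq_zero,
    Set.eq_empty_iff_forall_notMem]
  rintro C hC
  obtain ⟨c, hc, -⟩ := List.mem_map.1 hC
  obtain ⟨hc, hpow⟩ := List.mem_filter.1 hc
  obtain ⟨d, hd, hcd⟩ := (isPowerOf_iff hp.two_le (hord c hc).1).1 hpow
  have hdvd : c.1 ∣ N :=
    Nat.dvd_of_mod_eq_zero (Nat.eq_of_beq_eq_true (List.all_eq_true.1 hN c hc))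
  exact hpN (((dvd_pow_self p (by omega : d ≠ 0)).trans (hcd ▸ dvd_refl c.1)).trans hdvd)

end

/-! ### The verification of a list of classes -/

section

variable {n : ℕ} (A : Matrix (Fin n) (Fin n) ℤ) (hA : ∀ i, A i i = 2) (hints : List (ℕ × ℕ))
  (classes : List (ℕ × List ℕ)) (certs : List ℕ) (Ys : List (List (List ℤ)))

/-- Runs `coverCheck` and `orderCheck` for the Weyl group of a Cartan matrix. -/
noncomputable def coverVerify : Bool :=
  withMachine n (table A hints) fun m => force (rep (probe n)) fun V₀ =>
    force (table A hints).length fun f =>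
      orderCheck m V₀ classes && coverCheck m V₀ (classes.map Prod.snd) f
        (classes.map Prod.snd) certs

/-- `forceList l f` is `f l`; its reduction evaluates the entries of `l` first. -/
def forceList {α : Type*} : List ℕ → (List ℕ → α) → α
  | [], f => f []
  | a :: l, f => force a fun a => forceList l fun l => f (a :: l)

@[simp] theorem forceList_eq {α : Type*} (l : List ℕ) (f : List ℕ → α) :
    forceList l f = f l := by
  induction l generalizing f with
  | nil => rfl
  | cons a l ih => rw [forceList, force_eq, ih]

/-- `forceLists L f` is `f L`; its reduction evaluates the entries of `L` first. -/
def forceLists {α : Type*} : List (List ℕ) → (List (List ℕ) → α) → α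
  | [], f => f []
  | a :: l, f => forceList a fun a => forceLists l fun l => f (a :: l)

@[simp] theorem forceLists_eq {α : Type*} (l : List (List ℕ)) (f : List (List ℕ) → α) :
    forceLists l f = f l := by
  induction l generalizing f with
  | nil => rfl
  | cons a l ih => rw [forceLists, forceList_eq, ih]

/-- Runs `distinctCheck` for the Weyl group of a Cartan matrix. -/
noncomputable def distinctVerify : Bool :=
  withMachine n (table A hints) fun m => forceLists (Ys.map (packList m.modulus)) fun Ys =>
    distinctCheck m Ys (classes.filter fun c => isPowerOfSmallPrime c.1) []

variable {A hA hints classes certs Ys}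

/-- All that remains for a given type is evaluation of Boolean checks and stability of the lists in
`Ys`. Covering bounds the count from above, separation bounds it from below. -/
theorem pPowerClassCount_weyl (hn : 1 ≤ n) (hn8 : n ≤ 8)
    (hT : tableCheck (simplePairs A) (table A hints) = true)
    (hnil : [] ∈ classes.map Prod.snd)
    (hcover : coverVerify A hints classes certs = true)
    (hY : ∀ Y ∈ Ys, StableList A hA Y)
    (hdist : distinctVerify A hints classes Ys = true) {N : ℕ}
    (hN : (classes.all fun c => Nat.beq (N % c.1) 0) = true) :
    (∀ p ∈ [2, 3, 5, 7], pPowerClassCount p (cartanWeylGroup A hA) =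
      (classes.filter fun c => isPowerOf p c.1).length) ∧
    ∀ p : ℕ, p.Prime → ¬ p ∣ N → pPowerClassCount p (cartanWeylGroup A hA) = 0 := by
  have hT := tableGood_of_tableCheck hT
  simp only [coverVerify, withMachine_eq, force_eq, Bool.and_eq_true] at hcover
  simp only [distinctVerify, withMachine_eq, forceLists_eq] at hdist
  have hord := orderOf_of_orderCheck (hA := hA) hn hn8 hT hcover.1
  have hc : ∀ g : cartanWeylGroup A hA, ∃ c ∈ classes, IsConj g (word A hA hints c.2) := by
    intro g
    obtain ⟨r, hr, h⟩ := isConj_of_coverCheck hn hn8 hT hnil hcover.2 g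
    obtain ⟨c, hc, rfl⟩ := List.mem_map.1 hr
    exact ⟨c, hc, h⟩
  have hpw := pairwise_of_distinctCheck hn hn8 hT hY
    (fun c hc => (hord c (List.mem_filter.1 hc).1).2) hdist
  exact ⟨fun p hp => pPowerClassCount_eq_length hc hord hpw hp,
    fun p hp hpN => pPowerClassCount_eq_zero hc hord hN hp hpN⟩

end

/-- The number 24 is a multiple of the bounds 12, 24 and 6 used for `D₄`, `F₄` and `G₂`, so one
statement serves all three. -/
theorem prime_mem_of_dvd_2_3 {p : ℕ} (hp : p.Prime) (h : p ∣ 2 ^ 3 * 3) :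
    p ∈ ({2, 3} : Set ℕ) := by
  rcases hp.dvd_mul.1 h with h | h
  · exact Or.inl ((Nat.prime_dvd_prime_iff_eq hp Nat.prime_two).1 (hp.dvd_of_dvd_pow h))
  · exact Or.inr ((Nat.prime_dvd_prime_iff_eq hp Nat.prime_three).1 h)

theorem prime_mem_of_dvd_2_3_5 {p : ℕ} (hp : p.Prime) (h : p ∣ 2 ^ 3 * 3 ^ 2 * 5) :
    p ∈ ({2, 3, 5} : Set ℕ) := by
  rcases hp.dvd_mul.1 h with h | h
  · rcases hp.dvd_mul.1 h with h | h
    · exact Or.inl ((Nat.prime_dvd_prime_iff_eq hp Nat.prime_two).1 (hp.dvd_of_dvd_pow h))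
    · exact Or.inr (Or.inl
        ((Nat.prime_dvd_prime_iff_eq hp Nat.prime_three).1 (hp.dvd_of_dvd_pow h)))
  · exact Or.inr (Or.inr ((Nat.prime_dvd_prime_iff_eq hp Nat.prime_five).1 h))

theorem prime_mem_of_dvd_2_3_5_7 {p : ℕ} (hp : p.Prime) (h : p ∣ 2 ^ 3 * 3 ^ 2 * 5 * 7) :
    p ∈ ({2, 3, 5, 7} : Set ℕ) := by
  rcases hp.dvd_mul.1 h with h | h
  · rcases prime_mem_of_dvd_2_3_5 hp h with h | h | h
    · exact Or.inl h
    · exact Or.inr (Or.inl h)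
    · exact Or.inr (Or.inr (Or.inl h))
  · exact Or.inr (Or.inr (Or.inr ((Nat.prime_dvd_prime_iff_eq hp Nat.prime_seven).1 h)))

/-! ### Type `D₄` -/

/-- The steps that produce the reflections of type `D₄` from the simple ones. -/
def dFourHints : List (ℕ × ℕ) := [
  (0, 1), (1, 2), (1, 3), (4, 2), (4, 3), (5, 3), (7, 3), (10, 1)]

/-- Orders and representatives of the conjugacy classes in type `D₄`. -/
def dFourClasses : List (ℕ × List ℕ) := [
  (1, []), (2, [0]), (3, [0, 1]), (2, [0, 2]), (2, [0, 3]), (2, [0, 11]), (4, [0, 1, 2]),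
  (4, [0, 1, 3]), (4, [0, 1, 9]), (2, [0, 2, 3]), (6, [0, 1, 2, 3]), (4, [0, 1, 2, 6]),
  (2, [0, 2, 3, 11])]

/-- The certificate that the classes in type `D₄` are complete. -/
def dFourCerts : List ℕ := [
  0x894041240828810310205204104081c81009020110808043a0204204004,
  0x14128016810190a83208044100501000c008000,
  0x944c040190a834120101c0180101204,
  0x10e84819108b218028016830110843004800808860087404,
  0x110848150e814590e04400b41c084380080480c870088404,
  0x4088143a042a1005410a42002440044212010e84828880089404,
  0x250c8341c0102c088420c02803008007408,
  0x1285412010504411160421003014008008408,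
  0x205090642a0c8a0111401812058005a0401214,
  0x60050885432088a019140422800c01000110a0087414,
  0x25008442a1904834211200c00e008082420,
  0x4321d02830a8380301102210601204008870205420,
  0x900912042240a4481889039120822412448043a12011084828890089424]

/-- Orbits of multiples of the three minuscule weights in type `D₄`. -/
def dFourVectors : List (List (List ℤ)) := [
  [
    [2, 2, 1, 1], [0, 2, 1, 1], [0, 0, 1, 1], [0, 0, -1, 1], [0, 0, 1, -1], [0, 0, -1, -1],
    [0, -2, -1, -1], [-2, -2, -1, -1]],
  [
    [1, 2, 2, 1], [1, 2, 0, 1], [1, 0, 0, 1], [-1, 0, 0, 1], [1, 0, 0, -1], [-1, 0, 0, -1],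
    [-1, -2, 0, -1], [-1, -2, -2, -1]],
  [
    [1, 2, 1, 2], [1, 2, 1, 0], [1, 0, 1, 0], [-1, 0, 1, 0], [1, 0, -1, 0], [-1, 0, -1, 0],
    [-1, -2, -1, 0], [-1, -2, -1, -2]]]

theorem dFour_tableCheck : tableCheck (simplePairs (CartanMatrix.D 4)) (table (CartanMatrix.D 4) dFourHints) = true := by
  decide +kernel

theorem dFour_coverVerify : coverVerify (CartanMatrix.D 4) dFourHints dFourClasses dFourCerts = true := by
  decide +kernel

theorem dFour_distinctVerify : distinctVerify (CartanMatrix.D 4) dFourHints dFourClasses dFourVectors = true := by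
  decide +kernel

/-- Triality preserves the root system but permutes the classes of the words `[0, 2]`, `[0, 3]` and
`[0, 11]`, so counting roots cannot tell these apart. Triality also permutes the three orbits of
size 8, and counting in each of them separately breaks the symmetry. The weights are doubled to lie
in the root lattice. -/
theorem dFour_stableList : ∀ Y ∈ dFourVectors, StableList (CartanMatrix.D 4) (CartanMatrix.D_diag 4) Y := by
  have h : (dFourVectors.all (stableCheck 4 (base ^ 4) (simplePairs (CartanMatrix.D 4)))) = true := by
    decide +kernel
  exact fun Y hY => stableList_of_stableCheck (List.all_eq_true.1 h Y hY)

theorem pPowerClassCount_dFour :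
    pPowerClassCount 2 (cartanWeylGroup (CartanMatrix.D 4) (CartanMatrix.D_diag 4)) = 10 ∧
    pPowerClassCount 3 (cartanWeylGroup (CartanMatrix.D 4) (CartanMatrix.D_diag 4)) = 1 ∧
    ∀ p : ℕ, p.Prime → p ∉ ({2, 3} : Set ℕ) →
      pPowerClassCount p (cartanWeylGroup (CartanMatrix.D 4) (CartanMatrix.D_diag 4)) = 0 := by
  -- 12 is the least common multiple of the orders in `dFourClasses`.
  obtain ⟨h, h0⟩ := pPowerClassCount_weyl (hA := (CartanMatrix.D_diag 4)) (N := 12) (by norm_num)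
    (by norm_num) dFour_tableCheck (by decide +kernel) dFour_coverVerify dFour_stableList
    dFour_distinctVerify (by decide +kernel)
  refine ⟨(h 2 (by simp)).trans ?_, (h 3 (by simp)).trans ?_,
    fun p hp hpN => h0 p hp fun hd => hpN ?_⟩
  · exact congrArg Nat.cast (show (dFourClasses.filter fun c => isPowerOf 2 c.1).length = 10 by
      decide +kernel)
  · exact congrArg Nat.cast (show (dFourClasses.filter fun c => isPowerOf 3 c.1).length = 1 by
      decide +kernel)
  · exact prime_mem_of_dvd_2_3 hp (hd.trans (by norm_num))

/-! ### Type `F₄` -/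

/-- The steps that produce the reflections of type `F₄` from the simple ones. -/
def fFourHints : List (ℕ × ℕ) := [
  (0, 1), (1, 2), (2, 1), (2, 3), (4, 2), (5, 3), (6, 0), (6, 3), (8, 1), (8, 3), (10, 3), (11, 2),
  (12, 3), (14, 2), (16, 2), (17, 1), (18, 1), (19, 2), (20, 0), (21, 3)]

/-- Orders and representatives of the conjugacy classes in type `F₄`. -/
def fFourClasses : List (ℕ × List ℕ) := [
  (1, []), (2, [0]), (2, [2]), (3, [0, 1]), (2, [0, 2]), (4, [0, 6]), (2, [0, 12]), (3, [2, 3]),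
  (6, [0, 1, 2]), (6, [0, 1, 3]), (4, [0, 1, 5]), (6, [0, 2, 3]), (6, [0, 2, 11]), (2, [0, 2, 12]),
  (4, [0, 2, 16]), (2, [0, 2, 23]), (12, [0, 1, 2, 3]), (8, [0, 1, 2, 9]), (6, [0, 1, 2, 11]),
  (6, [0, 1, 2, 23]), (4, [0, 1, 3, 18]), (3, [0, 1, 3, 21]), (4, [0, 1, 5, 16]),
  (6, [0, 2, 3, 12]), (2, [0, 2, 12, 23])]

/-- The certificate that the classes in type `F₄` are complete. -/
def fFourCerts : List ℕ := [
  0x8104142042641058810a9040f2041c4102c81059041120812408188107904042081a408148101904012081040804810390400404204004,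
  0x1021028932102441854840390c0f4190c0721416894060190a0643906054190800a0220c028721001000c000,
  0x112830508409a58840610e1047204b20a0b4510e092100c42018870090c0d21008834210c014290a00e00004214010,
  0x54890a25c890923d0a390a07c25143d0805a260a874320c8a02c0c88012050010240200101204,
  0x1e1449a1c92120c22c208b40e072008c04a068060190e4480506814044211001600202220008,
  0x10228288f44a2d02590e03c106a1c0741c260083432046a1005410743000408814391801401004208,
  0x811a0943a35068323c1e8723c06390e05a10b214002060e8700482008d42808932380841005024501c8e00d0411406204,
  0x4d284584e2c458188e08239188b45211144601906250e00a1204831a8700606250c0140c82020743002c,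
  0x261447a491d0945a360e8384c150480c8220041a09088421004000c0101214,
  0x552882a1247a0a03e0a811a8981918894121e1080021d910341c90039220040301920008087410,
  0x8b450288b44a3d208381601a1e130043a1902351300a0c91004024060039110050110601218,
  0x4d28938412a011c8a041168c472190282e0a479220440c09003d1102410900140c84000444001c,
  0x169449a050c9045c01048284a289700401c21005d1001a0072220442124001e8881c85011200a21c,
  0x300941a350e9045a0472280e4312e0e250010144b81086000e450024201c970090c042100a42030970060410806210,
  0x902934221d208b40407218870420472280a21c0c85400418c880d0580831110292202e072180015110096414,
  0x20350e8941a0c8605908072181c4203c8409126030112100c8f24c0281148a0045a280442126092502042008930089418,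
  0xf4a24e248a84a2d0a8743201090243c1103012061c840088c021160281910008087430,
  0x64a23d0a8e8022d188e47116014291c0341422030381211002d0901118032280235080109438,
  0xb4a23d008644a2e028a434060a81006268402100590c01a081a10044211802450f420041d0c0409430,
  0x201a8e4820d1b0b220128383a107a14054891006400b42800862684809088423c1049090a912008090428,
  0x39008a4223d03010e8501512478190a1d0e04a09125d0b04112011c8701a0a4d0b069120e2340a390a008e42c0111224,
  0x1a350710472250e8545a19188922c0487842046a1608248481c52120222858012a448189a1200809242c,
  0x48145a212290440b43802806874220106250e03215024d0a0185438038102d0a018942810550e009643808390a020d428,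
  0x4d02824221d208b462390c8480b0520c6a1c01808b4300e4680c4a1c0210860148b0140c8e041160a230,
  0xd0691e03234124781c8d0391e0b23406478388d0791a1623c03c22468248d0a11e0123c26468348d0211e0523c2a468408d0411e0623c]

/-- The long roots and the short roots in type `F₄`. -/
def fFourVectors : List (List (List ℤ)) :=
  let T := (table CartanMatrix.F₄ fFourHints).partition fun t =>
    -- A long root has an integral coroot, and simple coroots of short roots are weighted by half
    -- the root coefficients there; so long roots are those with even coefficients at the two short
    -- simple roots.
    Int.emod (t.1.getD 2 0) 2 == 0 && Int.emod (t.1.getD 3 0) 2 == 0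
  [signedRoots T.1, signedRoots T.2]

theorem fFour_tableCheck : tableCheck (simplePairs CartanMatrix.F₄) (table CartanMatrix.F₄ fFourHints) = true := by
  decide +kernel

theorem fFour_coverVerify : coverVerify CartanMatrix.F₄ fFourHints fFourClasses fFourCerts = true := by
  decide +kernel

theorem fFour_distinctVerify : distinctVerify CartanMatrix.F₄ fFourHints fFourClasses fFourVectors = true := by
  decide +kernel

/-- The outer automorphism that exchanges long and short reflections preserves counts over all
roots, so the two lengths are counted separately; this distinguishes the words `[0]` and `[2]`. -/
theorem fFour_stableList : ∀ Y ∈ fFourVectors, StableList CartanMatrix.F₄ CartanMatrix.F₄_diag Y := by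
  have h : (fFourVectors.all (stableCheck 4 (base ^ 4) (simplePairs CartanMatrix.F₄))) = true := by
    decide +kernel
  exact fun Y hY => stableList_of_stableCheck (List.all_eq_true.1 h Y hY)

theorem pPowerClassCount_fFour :
    pPowerClassCount 2 (cartanWeylGroup CartanMatrix.F₄ CartanMatrix.F₄_diag) = 13 ∧
    pPowerClassCount 3 (cartanWeylGroup CartanMatrix.F₄ CartanMatrix.F₄_diag) = 3 ∧
    ∀ p : ℕ, p.Prime → p ∉ ({2, 3} : Set ℕ) →
      pPowerClassCount p (cartanWeylGroup CartanMatrix.F₄ CartanMatrix.F₄_diag) = 0 := by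
  -- 24 is the least common multiple of the orders in `fFourClasses`.
  obtain ⟨h, h0⟩ := pPowerClassCount_weyl (hA := CartanMatrix.F₄_diag) (N := 24) (by norm_num)
    (by norm_num) fFour_tableCheck (by decide +kernel) fFour_coverVerify fFour_stableList
    fFour_distinctVerify (by decide +kernel)
  refine ⟨(h 2 (by simp)).trans ?_, (h 3 (by simp)).trans ?_,
    fun p hp hpN => h0 p hp fun hd => hpN ?_⟩
  · exact congrArg Nat.cast (show (fFourClasses.filter fun c => isPowerOf 2 c.1).length = 13 by
      decide +kernel)
  · exact congrArg Nat.cast (show (fFourClasses.filter fun c => isPowerOf 3 c.1).length = 3 by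
      decide +kernel)
  · exact prime_mem_of_dvd_2_3 hp (hd.trans (by norm_num))

/-! ### Type `G₂` -/

/-- The steps that produce the reflections of type `G₂` from the simple ones. -/
def gTwoHints : List (ℕ × ℕ) := [
  (0, 1), (1, 0), (2, 0), (3, 1)]

/-- Orders and representatives of the conjugacy classes in type `G₂`. -/
def gTwoClasses : List (ℕ × List ℕ) := [
  (1, []), (2, [0]), (2, [1]), (6, [0, 1]), (3, [0, 2]), (2, [0, 5])]

/-- The certificate that the classes in type `G₂` are complete. -/
def gTwoCerts : List ℕ := [
  0x441008810010401204008004,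
  0x50120501000c000,
  0x680a00210008000020c,
  0x1412060080200208,
  0x1a0102808010402204,
  0x40080240800820110202208]

/-- The long roots and the short roots in type `G₂`. -/
def gTwoVectors : List (List (List ℤ)) :=
  let T := (table CartanMatrix.G₂ gTwoHints).partition fun t =>
    -- The second simple root is the short one, and the squared lengths have ratio 3: long roots are
    -- those whose coefficient there is divisible by 3.
    Int.emod (t.1.getD 1 0) 3 == 0
  [signedRoots T.1, signedRoots T.2]

theorem gTwo_tableCheck : tableCheck (simplePairs CartanMatrix.G₂) (table CartanMatrix.G₂ gTwoHints) = true := by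
  decide +kernel

theorem gTwo_coverVerify : coverVerify CartanMatrix.G₂ gTwoHints gTwoClasses gTwoCerts = true := by
  decide +kernel

theorem gTwo_distinctVerify : distinctVerify CartanMatrix.G₂ gTwoHints gTwoClasses gTwoVectors = true := by
  decide +kernel

theorem gTwo_stableList : ∀ Y ∈ gTwoVectors, StableList CartanMatrix.G₂ CartanMatrix.G₂_diag Y := by
  have h : (gTwoVectors.all (stableCheck 2 (base ^ 2) (simplePairs CartanMatrix.G₂))) = true := by
    decide +kernel
  exact fun Y hY => stableList_of_stableCheck (List.all_eq_true.1 h Y hY)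

theorem pPowerClassCount_gTwo :
    pPowerClassCount 2 (cartanWeylGroup CartanMatrix.G₂ CartanMatrix.G₂_diag) = 3 ∧
    pPowerClassCount 3 (cartanWeylGroup CartanMatrix.G₂ CartanMatrix.G₂_diag) = 1 ∧
    ∀ p : ℕ, p.Prime → p ∉ ({2, 3} : Set ℕ) →
      pPowerClassCount p (cartanWeylGroup CartanMatrix.G₂ CartanMatrix.G₂_diag) = 0 := by
  -- The orders in `gTwoClasses` are divisors of 6.
  obtain ⟨h, h0⟩ := pPowerClassCount_weyl (hA := CartanMatrix.G₂_diag) (N := 6) (by norm_num)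
    (by norm_num) gTwo_tableCheck (by decide +kernel) gTwo_coverVerify gTwo_stableList
    gTwo_distinctVerify (by decide +kernel)
  refine ⟨(h 2 (by simp)).trans ?_, (h 3 (by simp)).trans ?_,
    fun p hp hpN => h0 p hp fun hd => hpN ?_⟩
  · exact congrArg Nat.cast (show (gTwoClasses.filter fun c => isPowerOf 2 c.1).length = 3 by
      decide +kernel)
  · exact congrArg Nat.cast (show (gTwoClasses.filter fun c => isPowerOf 3 c.1).length = 1 by
      decide +kernel)
  · exact prime_mem_of_dvd_2_3 hp (hd.trans (by norm_num))

/-! ### Type `E₆` -/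

/-- The steps that produce the reflections of type `E₆` from the simple ones. -/
def eSixHints : List (ℕ × ℕ) := [
  (0, 2), (1, 3), (2, 3), (3, 4), (4, 5), (6, 3), (7, 2), (7, 4), (8, 4), (9, 5), (11, 1), (11, 4),
  (12, 4), (13, 5), (14, 5), (16, 4), (17, 5), (18, 3), (18, 5), (21, 3), (21, 5), (23, 5),
  (25, 2), (25, 5), (27, 4), (28, 5), (29, 4), (31, 4), (33, 3), (34, 1)]

/-- Orders and representatives of the conjugacy classes in type `E₆`. -/
def eSixClasses : List (ℕ × List ℕ) := [
  (1, []), (2, [0]), (2, [0, 1]), (3, [0, 2]), (6, [0, 1, 2]), (2, [0, 1, 4]), (4, [0, 1, 8]),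
  (5, [0, 1, 2, 3]), (6, [0, 1, 2, 4]), (4, [0, 1, 2, 23]), (3, [0, 1, 2, 34]), (6, [0, 1, 4, 8]),
  (2, [0, 1, 4, 28]), (4, [0, 1, 8, 17]), (8, [0, 1, 2, 3, 4]), (10, [0, 1, 2, 3, 5]),
  (12, [0, 1, 2, 3, 13]), (6, [0, 1, 2, 3, 30]), (6, [0, 1, 2, 4, 5]), (4, [0, 1, 2, 4, 23]),
  (12, [0, 1, 2, 3, 4, 5]), (9, [0, 1, 2, 3, 4, 19]), (6, [0, 1, 2, 3, 5, 30]),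
  (6, [0, 1, 2, 3, 13, 20]), (3, [0, 1, 2, 4, 5, 34])]

/-- The certificate that the classes in type `E₆` are complete. -/
def eSixCerts : List ℕ := [
  0x61e404107901011e4043c40808da02202043640808ba021d204304085c810d102192042840848810b10202348085481071020c20404590108902022a808408104102082c808088a020b204044101011020e2c808208a02021680818810410404004,
  0x1110423208068d020f2251a0400428186d1e8d02001f40c309749906003881851248f20c1e410348307231264102483049040720c108326810348201906032080489268100c6a040720800c008000,
  0x44882085840f90a1e5090a00428206d0a8505001f41028974b200e208001483039144303d228008830212869040210c0945a00860290a0e2a8200300d048a2140141041040040010410404,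
  0x8884119081e4f46d0631030c1b8ba4810f45030612f134702268a060a2491e801e7d8606a39188726830250024e30c074420c0133f020103a0c0340874180089004d0c08030034e408072180100802204,
  0x890283c9e8da28890dc5d0a448512f0f40909c39268114838251b084510e0d408441c0687829100421c0e8121c008a22002001c0100602208,
  0x224a1a38c407d369d3c840750a5d0b12018021475890a25d2c80388402010d3c7e890420c10530828907a2d188e4a1a420084580d02458008b02a1d02c040c8312024e1d3cc400100838b6240200635020da0408,
  0x893c8c06291c121e8a209020e1b4723d15174b2250a46812148f88a06821044cb30e0444c050084148580869161c0080682448230760902116000c8380381c83018c40c,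
  0x224f2823d1b4110a25d1e8a8725a12938244d0a480461b084523504006804291c044320506310400f00e004004043a0c02218,
  0x1121c009390906d3e9e4ea3400f450785d24087a283c289787a0984e1093408a43c068c472288f03a2d1281208701503802250e0084438008240080423801030034e40802214,
  0x144c279151b45216008547c091e8689c39268114888411108451220b43a2e06310e0a822c8e0f01a041a1c001c55900143801a3d07809844922000388203811345030082a1614,
  0x140c410e954623534924a24d1e8f89c390c290b220a00210c220946c2104290b22040c8591020010861101a1e060099f84804110b22064288800421644008d003d0c24070024e424024288802444201c5a0610,
  0x89369f49c513a890058f4200847a2a2e9641a1c0163d080220a8f85a311c8828698e0220a028042c1d01402251001204012268a8e0210c0112870108e008712c3000e9e618,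
  0x1e9342a6d149d429742c980280851d64c28864b20904511b26082141e611b26021e69930590a0c2141c4280899664c204280d224284885029b40c981d2a4280882260224c0c7d03260542828085a261924c1045050117414,
  0x2247a593a944dc6d02810028fc200a81a16128545a291f11406042089966401886809344c3000da061816007a38400480088300a070e024d14200040061ac804490018b32c3008497618,
  0x893c9b4a26a1e988ba206a36540b0e4b425270849a0a80d008985219028680c150201055070140c6212028038210e0081801c5607010442c,
  0x893ca08f45d0581c9b44a12289187a49150d48a2808e210a818007150a82108820028b42a01148a80d0089851280640a0c51862001c0a4a02888004440184104838c1d624,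
  0xda792d184d44d289747a2a0081088b8190b0c41702a1d1b084523501c06898292a08831741c0c34e30e0318658900840aca805021107004348b0111434,
  0x840231049b45c512e954bc390883128a03a1200c9f850228d4521801b410a80e09063e8a80b80d0309421630ca819029e22805810351b2a0a224048107059e41c1400d22824,
  0x448301b4fa5d3a9c40061ecb0651080043d9601a3c96062510e8b47a1e1c828011e8a0221281208a0110829140080044214000620ca00109052200815140040c0133f05064da1620,
  0xa261369f4f21515004523e048f4344e1093408a458170c472289603910072241244022062916019120d2201a4480a1229160090491200388400c6a1202230,
  0x224f26d289747a3921094423206952e7d8f0022a0c8145c1e1f0240200307c220883406130a23c10690e0147009d3d0781207040a8700216009968441c00c1d838,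
  0x174f26d008683249210d462390e8949c212681c034542616863688834216310880438a644224ca32201808a43c0a20d32005468336860f00a0e0229100042c79e6381c00c1d840,
  0x1080462092e8b8726d34831275920a2292a9247a04481a47834910223a070a8991e1324406818a973ec78120c81401228c9008868d9c63c1449809021e0b3c878307a164c,
  0xda0118984424528974aa221f04432090c711101002a1d0a3503200383c2e0b0344c251024d320062e88854da201536888349100a2081f6401050d320143a8801cda1640,
  0x140c551a9a4924d20984421d068c46c510e451205a3d0f0e471c448167512041734c90251e791202220fa240d2c8900c89b64800848180267e120a2144801222481c0c81b848]

/-- The roots in type `E₆`. -/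
def eSixVectors : List (List (List ℤ)) :=
  [signedRoots (table CartanMatrix.E₆ eSixHints)]

theorem eSix_tableCheck : tableCheck (simplePairs CartanMatrix.E₆) (table CartanMatrix.E₆ eSixHints) = true := by
  decide +kernel

theorem eSix_coverVerify : coverVerify CartanMatrix.E₆ eSixHints eSixClasses eSixCerts = true := by
  decide +kernel

theorem eSix_distinctVerify : distinctVerify CartanMatrix.E₆ eSixHints eSixClasses eSixVectors = true := by
  decide +kernel

/-- All roots have the same length and form one orbit, so there is a single list, whose stability is
inherited from the table. -/
theorem eSix_stableList : ∀ Y ∈ eSixVectors, StableList CartanMatrix.E₆ CartanMatrix.E₆_diag Y := by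
  intro Y hY
  rw [List.mem_singleton.1 hY]
  exact stableList_signedRoots (M := base ^ 6) (tableGood_of_tableCheck eSix_tableCheck)
    (by decide +kernel)

theorem pPowerClassCount_eSix :
    pPowerClassCount 2 (cartanWeylGroup CartanMatrix.E₆ CartanMatrix.E₆_diag) = 9 ∧
    pPowerClassCount 3 (cartanWeylGroup CartanMatrix.E₆ CartanMatrix.E₆_diag) = 4 ∧
    pPowerClassCount 5 (cartanWeylGroup CartanMatrix.E₆ CartanMatrix.E₆_diag) = 1 ∧
    ∀ p : ℕ, p.Prime → p ∉ ({2, 3, 5} : Set ℕ) →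
      pPowerClassCount p (cartanWeylGroup CartanMatrix.E₆ CartanMatrix.E₆_diag) = 0 := by
  -- 360 is the least common multiple of the orders in `eSixClasses`.
  obtain ⟨h, h0⟩ := pPowerClassCount_weyl (hA := CartanMatrix.E₆_diag) (N := 360) (by norm_num)
    (by norm_num) eSix_tableCheck (by decide +kernel) eSix_coverVerify eSix_stableList
    eSix_distinctVerify (by decide +kernel)
  refine ⟨(h 2 (by simp)).trans ?_, (h 3 (by simp)).trans ?_, (h 5 (by simp)).trans ?_,
    fun p hp hpN => h0 p hp fun hd => hpN ?_⟩
  · exact congrArg Nat.cast (show (eSixClasses.filter fun c => isPowerOf 2 c.1).length = 9 by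
      decide +kernel)
  · exact congrArg Nat.cast (show (eSixClasses.filter fun c => isPowerOf 3 c.1).length = 4 by
      decide +kernel)
  · exact congrArg Nat.cast (show (eSixClasses.filter fun c => isPowerOf 5 c.1).length = 1 by
      decide +kernel)
  · exact prime_mem_of_dvd_2_3_5 hp (hd.trans (by norm_num))

/-! ### Type `E₇` -/

/-- The steps that produce the reflections of type `E₇` from the simple ones. -/
def eSevenHints : List (ℕ × ℕ) := [
  (0, 2), (1, 3), (2, 3), (3, 4), (4, 5), (5, 6), (7, 3), (8, 2), (8, 4), (9, 4), (10, 5), (11, 6),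
  (13, 1), (13, 4), (14, 4), (15, 5), (16, 5), (17, 6), (19, 4), (20, 5), (21, 3), (21, 5),
  (22, 6), (23, 6), (25, 3), (25, 5), (26, 6), (27, 5), (28, 6), (31, 2), (31, 5), (32, 6),
  (34, 4), (34, 6), (36, 5), (37, 4), (37, 6), (39, 6), (41, 4), (41, 6), (42, 6), (44, 5),
  (45, 3), (45, 6), (47, 5), (49, 1), (49, 6), (50, 5), (52, 6), (53, 5), (55, 5), (56, 4),
  (57, 4), (59, 3), (60, 2), (61, 0)]

/-- Orders and representatives of the conjugacy classes in type `E₇`. -/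
def eSevenClasses : List (ℕ × List ℕ) := [
  (1, []), (2, [0]), (2, [0, 1]), (3, [0, 2]), (6, [0, 1, 2]), (2, [0, 1, 4]), (4, [0, 1, 9]),
  (2, [0, 1, 60]), (5, [0, 1, 2, 3]), (6, [0, 1, 2, 4]), (4, [0, 1, 2, 27]), (3, [0, 1, 2, 49]),
  (4, [0, 1, 2, 60]), (2, [0, 1, 4, 6]), (6, [0, 1, 4, 9]), (2, [0, 1, 4, 36]), (4, [0, 1, 9, 20]),
  (8, [0, 1, 2, 3, 4]), (10, [0, 1, 2, 3, 5]), (12, [0, 1, 2, 3, 15]), (6, [0, 1, 2, 3, 39]),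
  (6, [0, 1, 2, 3, 58]), (6, [0, 1, 2, 4, 5]), (6, [0, 1, 2, 4, 6]), (4, [0, 1, 2, 4, 27]),
  (4, [0, 1, 2, 4, 48]), (12, [0, 1, 2, 4, 56]), (6, [0, 1, 2, 27, 48]), (4, [0, 1, 2, 27, 54]),
  (2, [0, 1, 4, 6, 36]), (12, [0, 1, 2, 3, 4, 5]), (8, [0, 1, 2, 3, 4, 6]),
  (9, [0, 1, 2, 3, 4, 22]), (10, [0, 1, 2, 3, 4, 48]), (8, [0, 1, 2, 3, 4, 56]),
  (15, [0, 1, 2, 3, 5, 6]), (12, [0, 1, 2, 3, 5, 29]), (6, [0, 1, 2, 3, 5, 39]),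
  (7, [0, 1, 2, 3, 5, 44]), (6, [0, 1, 2, 3, 5, 58]), (6, [0, 1, 2, 3, 15, 23]),
  (6, [0, 1, 2, 3, 15, 56]), (12, [0, 1, 2, 4, 5, 6]), (3, [0, 1, 2, 4, 5, 49]),
  (4, [0, 1, 2, 4, 6, 27]), (6, [0, 1, 2, 4, 27, 48]), (4, [0, 1, 2, 4, 27, 54]),
  (2, [0, 1, 4, 6, 36, 54]), (18, [0, 1, 2, 3, 4, 5, 6]), (14, [0, 1, 2, 3, 4, 5, 29]),
  (12, [0, 1, 2, 3, 4, 5, 40]), (10, [0, 1, 2, 3, 4, 6, 48]), (8, [0, 1, 2, 3, 4, 6, 56]),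
  (30, [0, 1, 2, 3, 4, 22, 30]), (6, [0, 1, 2, 3, 5, 6, 58]), (6, [0, 1, 2, 3, 5, 29, 49]),
  (6, [0, 1, 2, 3, 15, 23, 35]), (4, [0, 1, 2, 4, 5, 6, 60]), (6, [0, 1, 2, 4, 6, 27, 48]),
  (2, [0, 1, 4, 6, 36, 54, 60])]

/-- The certificate that the classes in type `E₇` are complete. -/
def eSevenCerts : List ℕ := [
  0x7a408f881013e40412f901073e4041cc10104b04041cb101013040412b101072740460408096202094e808cc81161020250808093a022f204504089c81012240456408a8811190222204046d0113102252043c40870810d90221204049901101021f2042e40854810121404344080902021920420408388104a14040469010a10202328084c8104902104280824d202022880834810113404044085d0a02103480824a202021a8081c810493404004,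
  0xf5784180dd2043a20876410e0821c9043520806e5021b9043120860836e810d082003640c588a6e8100da2040064818a14e8a68810017206005a8188d4491688107483002940c3c9c4da60830c1041620c0091030ba553a4104483089040f20c208e419d4082c4102883051040820c128a3a8100cb2040f208064180c8201244ea040a2c8100c7a040820800c008000,
  0xf578420038e91a39e3083844936cc20d50ab905049364c20c560ae214124d6b08006c820b164428a485003241050a75690a005c820016a081e512156a0a2140294100049060ba6d2443061348048820005a0c104f26410164304528800883025184285d020804218148d4010c122140a42840ca0800c0341214920a0b214014124d040040010493404,
  0x1eaf110ed061d1083b21070420e4841a908305b90831210612c5a108031ccd86164a14e831cbd861449e44950461ac0c031ca98611a8a369d4a8222c6060f271371840185cc30592008b318182e95441d418228022a58607a411cb17682020b20c0a400a48c302112b172820d5da0804108300d022106002c5ba083572820e1da08082180100802204,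
  0x1eaf1030749222c708c22c6ab04311631584b102c0a490a164a14e922285127912308a059141e5146d30852283b174dc7502490808a0505a20922202c8116840291f09461120b2201e81088400d11122240a448108804204880021492120b2240240200100602208,
  0x1eaf089112a43470b9448226ce0a068210ce0a1aa5d021a1a38f18918ac15c97409189003642450ab58848a5568c36c98a112953a120224ad8a12a790a6d6b1401e21410b4ac501411e6eea8a0ba6d06086235f450613480488482410f4ea68a04a793212030414e2aa28228d47241189740848108e01a048e0011c2254d98902a21038040c9b140240d12254ec480100840d628024063d02112a408,
  0xf5748876860ea10e9081c2c16a8a04712bba2858b1584381926f0509d04cd08164791c0c5b482804bd081429e2e98412a420252248285228c240171b49262348a4292004811d42c402d231441004a10921c022c69880222a0280450246ae0a020b438043ca310004034121411046ae8a050238960a0211c000e8400402083018e40c,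
  0x90e8040841a3d1496428258b60d08a753e8258b58d0c26d4a8250a58d012752c688954805c8600912d6344eae2303c8064860141225b068856446000eb46302e806c86075a218073a798c0d2d88c00166ec60410e611b18166e8601cb1763028801ee58c04a2d12b6340e44e3180f728601c7906301a8010ed8c02a256c681512a6340e28ab1808768601c4096300e460895a1a0b44a98d112a434063473183c23006e902013e408,
  0xf578ba5d40a8e160b559cb162b097c9d184a0b250aa831281e53c8930828128ba6d43114ec2e209d461261a8525a09124b214930a43e128c244168f41301a010c49014910221d02831c820309201201100400404420c02218,
  0xf5788d32f9991c2e5024d00d0d560b8768b0c56128433876cb00c8b958a255a2c1b273090a54ea016c1ac24254f23c011630906d309504458c241d8ba6e3a810c2d9208a0c05a12861689059022d1201a39208c459240846a29024d110312c05411008a4440211110020b80b00201091004e1da0802214,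
  0x1eac16cba44097ccd0e110359b341e41c11a5d612c4e20d84a50a74923217224622d3105802610a9d88c093a810c2d9408a1e2d10430b4502c81168a04d130943023269a5240b2501a8846c0c7222060051027a483208d348480681068880081964c0505248c8400204f0900c050aa2600488204011663030082ad614,
  0x3c9850ae924b8462d5608640ac258818703249e1a164a1268910a1f434288426518206b38681c9887a814315400224ca85d2c9d409274ca84523168824895038b5aca02c0095b0a0291f094212468042d6b28040eb594020012b61401a22244d031bba65804116b28075a8a0004ad6500085248d049ab96580ce1db2c025a8a00262420206aa610,
  0x874144d1a994a281609a5327d58a15229550a754aa918d91c1122cfa360b668d87924d91c0da610acd1b06814cea150ba0012381d409276ca845664d82c093750a84124ed150b2045bb6541484024dd42a09468c32fa1905bb4541e8108ed9501a049ba6542434cbe8641a14cbe86408ed1504205da2a0721c22091a55f4c8505937d0c834cbe664764a80210ed06003e410,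
  0x1eaf097089d47470b9428214655d3205043ca2ba646285248e8d12e08fa086460a94d022c7e19003645c44ad4f024c9d4d322553aa13c0912d734c8082ab66c0415533617410016b21b01d0d2085a566c389e4da0c10b2abe9b08a0c10b2a969b002445c0608bb5734d8252c830414e2aa6c044503320d472410a822c699901822e8d7d360341822e8d2d360304158b9a6c16830454b1aa64108504411aba6c0a081924d4c80901406088a04f4c814920a050420692a6405c227505112a41c,
  0x3d5c220abb66c673947b844c60b5440d70cd8a162b09728904119b221d8f2a5568a00856426168ba614a928500349e1304a852288008564260b8da31311a41a2001a4f09826127933220548c351c9046424ba0644088280a010200a9d6b488161080a0114898090a08823574d8040152cc6910210c01148881091008814c30012a7618,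
  0x182cd22d11d1c2e5044d9b30021acd980c2156a3a1d48a1df2300c4b2099a302849215568c36c9981122d04495b30254f214dad6600144282169598011e6ecc05d0e983e8d9801184ccc06904822ed1980490a023a8598089c68cc0088a06601a42838850810a0756c998011634cc04c8501a50850a90a075cbd9802a254cc02132428089a30022600740ea55330055a828086a301f260125105011b414,
  0xe174822ae59c184cd67305aa1ca3b67030b14a3644c4291410f66c98ad3c9a544a14a9742ad78c988a252240a3218c9e3260c45c0d249882c290a8d411d42c982d231440604a340186f09808b1a64c1c87809662c300112a6182004eb584c1a008b484c0480088300a07080ad1c4381002598c260040071ec985093018d3ec300851b618,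
  0x3d5e2e970b05b4110d5672c58ac250a74210f29a449851c5d411a50eda008a32391b50c247b46803b05882750c5006a149684a492c840034022a188b43a050f018313c05409049942005031c8500f80f00e084400270ed080104438,
  0x7abc5d2ea09c6aac5b4be60b1592c99a4c2757a159a4c28554130794f1b4c21284a20a250c293b048ba7509029114aa2e248f4a22c090271001c0081710025184f811040059a880022d2001a010c8a8593c0740a0c59c62408c0200a4f02c890045001c5505040e25628,
  0xf578b05cae2708522859cb144b090c9d28c12211a9a351d4f27141184b24a2e9b40840cd4045190b80218a80620422500742c3924850054423e1285189002d1e81003454100851910014a004c1cda100170ed88018e3ec5030a400840ad00050211080043c8e0114440,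
  0x1eaa13cae51ae160b559cb1128c97c01188682032ab222072194702512611b128ba6d187d8352194ec6e209d461460d101106291e0842801f530f049288f45a1c022551000e18508120ea52002801a060a312605210d1c6800e81539160c298094123da3400b22804a90806a74201601031828,
  0x4a0d028d444e132b542281628f45a992a9654249389e4ea8930a3461960d085d368c2ac1a208a760a6583421042126cd1031d252052ac1a20525a32c121060126e621020b6cd1015d25215609103e070c2880a049b988408d9221d1520780218a7029440126e5a103a0a00206b180c29c09c088244580274460006bb620,
  0x3d5e2912a76a870b95aadd223d63388c50a4249d9c4631572c10ac56a8962890e01ab989c06c9cb4e294da6422c71138953ca4400722d28613e9d84a001116943a81249180d22528392e9228c108d48a22208c41e0091478130a40934780c84420b47858b99b3c000e4d9e002150120a448102a3c00833876c587d12d624,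
  0x7abc4d267cd60e172b46a950c5ba5431582d172e92a1848970ed2a02924b052a7542954f2898b747c0e01a3587c269dab3e17410062de1f0da450e018b787c389e4dc59349842c0280044a1f04a2c623e020014943e010a499f01a392085429247c108d452049a3e0b4595403e01148f804223e00409031540524848109f004c5ba1202234,
  0x3d582d970b94415c032b83c85c234bac2509c42d172b1448c494a54e9242a6217004c22d3b118127502185b4a1143c5a12861692859022d2506c3920830c2da50594a0822410450288904c1850b694062d25019140f2241e4500a0b0142d2500a0511400488480c7a140223c,
  0xf536a444a3920955aa012a2562e8a8628254258697331501e5cac5122d0b2953a15249e4646cae102312f174dc692c9a82d0583183a1f01c45100461187c1600f2689006888543c01146c6a705a146d20211a8a40934842808da089c402d83589c08402292100844840505249601c035731381492140428400d909069960c6008ba0634,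
  0x25068d5c21102812354ca2d628f542492aae50289569654a9938a54f27536984300042d654c1d8ba6e0c04191675302839b40e2a608a0cae0b4109b06840c085af6d53020091671300800b26b2a6009026d0839208c45825eda2604204a3a684148008d9a10c0f54c22302a11004533684000853440058b74a848493b388c24458049b9684010c74858206b3628,
  0x3d40209209544a393c9b51a5d48ac4e292452853a954f289124c2a76b0f81400268d69f0e42401240ea9f1811420500b58c61f0bc141983f1086e3496418c22d08149214030024e2ca841d1144011846210d8052ca2909a26000df34205550050ce2906a2106508040037d1082d0800135735200d020d21009f60d480a0a492d03806ae62402d0fb04a4047d0c040d60c70082ad634,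
  0x49f5b221068f45279028469743a95389b54ca95692420012bdcd48020040e3ba904b0c45a5942012b78900085066184440548a7504a59314091099a4440302250b1a88160c6308887846061208b0630ac44091081bc44030224d35a88268984a7c432711201419559110350804cbd8881b031c9105452f6d1202800e2cc6a4019560d10041a440132f5a2029260c50092af6b83c74fa98900b832f5221b118021ee59003b3428,
  0x182cd046d2f1c2e5044d9b58021acdac08a1785930877c960153a826696089168c52a9d5092411256d68082aa6b42e820031645a01a1a410b4ad68713c87489c68d6808c266b4226d035a024b0034c62d0491a023a85ad0b1a62d68088a06b41a468388d0811a0c50bdad011634d684c8d01a508d0a91a1256b1ad02a254d682132468089a58022b003c16953b5a0926868086a581f2b012510d011b434,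
  0x7abc5d2e160b5562ba50a85ed9b118a7957274c2a24d224d1e66d888e2e9b43208a1a209390c293b09474750c4069936a5920022e248740a3611118620b00800e230a0260f018322a1649025022202942f6cc901801207040a888021a00b1a8502000e25844,
  0x3d5e2e970b05b41a0c56727574c244ac4330ba8250914e4794d1b52ddb20c216471b4d4285986c8388c8825934830831b20523001d4319025168f00858464140a74f464034022a0a840a49b003a050f0185c30b0017048c4cc900a0a0c7128640440c5800e083112004318bb6483814f2a86c,
  0xf578ac542c16eb29aa8634e1db641b51aae4e9d4f29a449851c010f1e5e9a81d191549c8d9a6a0f434392086a06442292d0949259044068b854311a87448a03c21a390a00440b6502858bb28062c4030116890144a064c0a8f06896c24093699b200a0e022d13004348a76442000e2584c,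
  0x7a9b4822500a44aad51cac58a0950a74a4794d22502462ea082a99080c8ab8c031011a559a05a312f1d0070f4600e8d259248a42841c4a32024160a110a38c80d406888541462640c83a05064d8062c00ba18c40a5900c8082336540504608d019868f336c40704188a0099a220d608a80c73866c,
  0x941a05709946a088d508a058a3d50a64aa7916a24c2592e924e24516094328c43a9b5143c021751a8760e006a76f5884110712b6a10029d5c6a06024dbc6a0a4b4313276503a210288c410086ae8d42a95e36a15608a801150c48011a61a56207462174ca01e1899f3280e02a554620541a023645405031c8e01a0a17b66c4054080862d8500138768a800a3a64c,
  0xf578ba5d41b0d558b15549d6532489258da0c15ead4da2c2184f1a0a920803ccdb41422928bd8368244f2893e984aa122e8f4a252228f8941104006928c4210d029134620e006d1beac4129189160012249b1020116323101a010a8a820b18d801d02831c499602c189202864c0244b002303cd1c868542d62e868,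
  0x3d5e29d68b18dab14494982c52a9a83707a7150aa8b2014f1983a30a306d01c9050421149d8245d3a8240400a55bbad4228c85c350c25336a0c420012b5e56a0684a0508870a25046a0641a74f224010a49b10542cb103a844802c5db240e062d9c3201249883093029620124890020401ab986c1201ab9870,
  0x1eaa13cae51ad558b697cc112b2480c2c6634002191904065564680e4628e049b4c23625105129de26e204ec0c5256582e9d461460da02d329548aa458248f2481e4a0112103861660b8b124162500681820246ce340c9b52c90120e8140152ecb084027671a00a081124648164c00952240d4e890388ad660,
  0xf53690522556aac44a0200b1592394e85412a1550241e43466408c4dc62448b45242080cc258c02e9a4b25206108b60040009633ac4170487a51248a02514c6a0388a110a1d73620540e5b501a060c9a3ccdb105a146d881d0285062ce434145ec1b406128052c826b1c3240218bd94030d60ca02d62e668,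
  0x4a0d028d444d5408a85a65629642299388f542492a9e4ea6d30a3461960d9841448c2ac1b4052760a087925b5805d0849b3683a2dc1004b983f588451f12043d6c600c024dcc66075cbdb10a26c8b57318860fad6c8070c2d004008a78c00e1572f8c42611bba8c80f00432a17b66c4125d7360074144019c7b0c81b00a8a013267188d5ca2c0089b572cc8006bb648,
  0xf550b05ca8d709e594b958a24ec86008c434152266d41c9d51c7112984a24a2e9b4380ca32131183224da66d408874121d22281241302a210a3d532603828c4d4110d82c0d150640e5b50522452064c0e6d140ca244c32891402894cda83c9400a249a964c125d0326174a8982112d64c,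
  0xe4425172814220650934d28914a290a41468b54475549c49214d306c82c928e46d10196348d41600ba68c8228b8025d188858d1b503a6111144ab5b515970054a4310a76501293046dac640d04b97c6a0f5d12a034544431c3f190200177b19048226770a01cdba65402e1db2a0d1e419b0616e18387db2010f76cd848213690a0027049820cbd64c,
  0x7abc4391c2e56ab758aa1688130c1b61728930c13615aa5369f92a9137316e9a07d4909410062de340c274cc068700c5bc680e4f2080184f198211a98421124d983e2e9340984c021114444108840c2db008134c0130a40934c0168b25c1631300080044e30000726d80010b048212458081433600098b74682a24c26864,
  0x1e4c285708c5aa191928492055cb040cad512c4ca449156d806c9cb6c0f502287126d82a988b24d431c400224db025109d409274db00d1c8f8ba48b604144581a914444120993608244581a9516049b40cb029229d16051258db01112a516079a4580651132c0048924edb01218ddd32c175a8b002624b06133d658,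
  0x1eac16cb85ca2952720f549c85d50f1390e279612251a1d0a54ea842a2e1911246db305a3123128024524968c4092c9a4c21e16046138cc128b189982c7986cc021493660d87241062c636605249982097028824cc8289704c2858c6cc06149366030a49990792e052459990140c0148926cc0a4919029124cc801222e050648b43202274,
  0xf5008244a3920954f26d4697522a138a4972b144aa514a54ea5420c22d98720a60fb6630260408c229985e0a0cc1f8cc371a4b20c6116cc0641a00e2c8cc2b11440c22d9834011431b80c990843a168b4ef1b7041320826c144c8260a8238a9b7019360f2641e4d80a0e812011248dc06c144d80c7a32031e8d8082ad674,
  0x93eb647a2910834f20c08d2e875527136ae52a9618a994ab02b46b1a0490a9646002275f56800428330c23405a453a9f608c824426691a00c08942c6b4058318c23404957acc861128b0630ac68091081bc68030224d35ad01b0e482200154cd2b402832ab23400834680035eb3403148d0260a00498455a02001540deb402197acd03dc2340132f59a0d93228789c83000922a2b401c0cbd468063d9b320012559c03b3460,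
  0x1d0487603442291e9141d0b26136852743a9f5122c9d0613a2553aa1244e8095a7402549d05c9d00024add014923a1a27404953a0e13a1e2740008fb742027404993a1093a023e9d08c9d029e47404853a1313a02409d0150a3a05468e82cf23a2927404693a02a647404653a05a1474168d1d1693a2e27404513a05a6474044d3a01174055a8e8c89d02ae47404353a00024e82e851d0ba3474,
  0xf578ba5c2c16aac58aa14ea48f2892875d346184ba6d3f114826e330a478224aa2704a562703418a16d3001190e83a05291b40b99f07c4a26820014718a98210d8444caa08c48a30981309e2104c1e030b8542c623e094c8f00a2e2932889c0b0481c10286678012018c5dc4c1306896bca84,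
  0x1eaf14ea25826d58b4542a6628046c5c3a8751381d38878fc592a974cc3d228e4824e108a4ec251d1d41e01a400916313032170d428750d302c42147130589ac631104a2301809248c26048ac8880c8d0054c44c1a3a79a60442a16520184a668010851b3c285ed9a700a1207040a19a000434a9868450097b6888,
  0x7aa24bae16089402a5509c58a7901274caa21c9f82a09191b41e08a8a20938222858c67c13058c4511e834323e123dbb3e0b83a051b140a797c42118626422c711383c6984f14814f2f6800609021734f80636994b3e0a8342c221471080a50097b689806285b4c1a50eda002942080239039a801e0ce218800e004358a450097b6884,
  0xf5369044a01489558a394eae8128958948ba8250a64c4794d0c50218c336a8231320d1ac541242a7130cd2a074589f0b1420b4525e090c8e93e1d2840688854517b067c0b0740a14c25a01878224aa270a2a60cf8149258040431544e02801c3cd501083008d229ea701c10624a02668f8306a769c1c14c328b4,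
  0x941a05709946a0f8c508a648c3d44a04aa5d24a848a753c8b51a612e0d6b788c2c9b49044aea260e25a0808b3688c20970cbd844c1a41822879dd4c0a420c2ad30313276940400c3088c2c797b4c1e00a9844c0c469da70022a0a9240b9a303a310ba6940f0034bda505c5c0275f118c5ba540418b5a701428292391701107802a6111830a7020218b625004318bb69c18010ba890,
  0x1ea6d58a8402dd2ab547241532344a9d349e5228940818941e0a87484620e3d134c0b47a09040032b655303a0800c8845218b33680090f8a41a068b8540a1a860a1d444c011ab1a20e0828b2290a9878d1026168d9b400b007934481610851c441e5e90014ca86982c5080507040a19a80a9878d00348a76882000e258a4,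
  0x4a0d028d444d540b145a99231649265389d4da11469047aa1149552279449f4c25a080d1b98a82e8f34918512875db461147c60e3b6a82eb52a0a2f48c28bd270a9666d18187a169c07143ae9a3081248d50590a460634cda703c010a904ecda3021e6cd501d05172cb59c54058314e0f3ca9a309156008c9c3ad50006bb68c,
  0x722142b440a6d34a25145124954dc061e9c5424d2c804c22d0e9e4445608a18b8162ee2710a7494091c8eae8a70bb149020058bb89c228b86a30f2520c48314901489489556d6811024690185d290320d3a7925081d74d385c3a8751382cca96900ea1d34e0162eda704802cc22d0a2f60d3830a9080750ea27091368d2802625202133d690,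
  0x3d402c138a34ba794e825628905155427d391047235471784a4d288e8f46d0a0329584c481a375148795a520b4ba35ed481d210056f5a9092042066a00a8056b5a90ab24a0008d8b500346208d366a00b032494030fa76a4108a46ac4a004adb352082a85a8080234ba29022348356a4028216cda9048224ae290f384a010010b78a4,
  0x43a0a3294502694ca850a4d54a246ab550a92e0da313ab6b0531f8fa8a5456091128004a1ae012d60d600d5e550393cad60950212f1845ab4b01e2533e8a82e902cd1aa10085eda2a084452820f208a82084448f6ed50385166b15026148e1495ac540b4b823ae22c042050d503c19a5115050c306a81269735805824913af6a82e75db5400818234ba2e003e4a8,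
  0xf5008244a3920954ba6d389e5228946a494a9d50a99449e0ac12c059580c2b0472298158112b0245607a391b8b158162b430560149258178ac44ad0e9581d2b40a612c0843a1656860ad029d4b00a752d05984b013052b42456814c25a0b3a9602cea5a0282d0615a05249682cc25a113a96044ea5a022bc,
  0xe57808af02f0195e082bc145783caf0895e023697858af0c15e1b2bc04892f0e95e1f2bc44578093a5e025097894af1395e282bc04b12f1515e2b2bc069d2f1615e0260978098a5e2f2bc0ed12f01ac4bc6057809a25e312bc04d52f1995e076e9780d825e342bc04dd2f1a95e02709781dca5e07749780da25e372bc04e52f1c15e02749780df25e0a689780dba5e392bc04ed2f1d15e3e2bc22d12f05374bc06e52f1d95e3d2bc06e92f013e4bc]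

/-- The roots in type `E₇`. -/
def eSevenVectors : List (List (List ℤ)) :=
  [signedRoots (table CartanMatrix.E₇ eSevenHints)]

theorem eSeven_tableCheck : tableCheck (simplePairs CartanMatrix.E₇) (table CartanMatrix.E₇ eSevenHints) = true := by
  decide +kernel

theorem eSeven_coverVerify : coverVerify CartanMatrix.E₇ eSevenHints eSevenClasses eSevenCerts = true := by
  decide +kernel

theorem eSeven_distinctVerify : distinctVerify CartanMatrix.E₇ eSevenHints eSevenClasses eSevenVectors = true := by
  decide +kernel

theorem eSeven_stableList : ∀ Y ∈ eSevenVectors, StableList CartanMatrix.E₇ CartanMatrix.E₇_diag Y := by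
  intro Y hY
  rw [List.mem_singleton.1 hY]
  exact stableList_signedRoots (M := base ^ 7) (tableGood_of_tableCheck eSeven_tableCheck)
    (by decide +kernel)

theorem pPowerClassCount_eSeven :
    pPowerClassCount 2 (cartanWeylGroup CartanMatrix.E₇ CartanMatrix.E₇_diag) = 23 ∧
    pPowerClassCount 3 (cartanWeylGroup CartanMatrix.E₇ CartanMatrix.E₇_diag) = 4 ∧
    pPowerClassCount 5 (cartanWeylGroup CartanMatrix.E₇ CartanMatrix.E₇_diag) = 1 ∧
    pPowerClassCount 7 (cartanWeylGroup CartanMatrix.E₇ CartanMatrix.E₇_diag) = 1 ∧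
    ∀ p : ℕ, p.Prime → p ∉ ({2, 3, 5, 7} : Set ℕ) →
      pPowerClassCount p (cartanWeylGroup CartanMatrix.E₇ CartanMatrix.E₇_diag) = 0 := by
  -- 2520 is the least common multiple of the orders in `eSevenClasses`.
  obtain ⟨h, h0⟩ := pPowerClassCount_weyl (hA := CartanMatrix.E₇_diag) (N := 2520) (by norm_num)
    (by norm_num) eSeven_tableCheck (by decide +kernel) eSeven_coverVerify eSeven_stableList
    eSeven_distinctVerify (by decide +kernel)
  refine ⟨(h 2 (by simp)).trans ?_, (h 3 (by simp)).trans ?_, (h 5 (by simp)).trans ?_, (h 7 (by simp)).trans ?_,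
    fun p hp hpN => h0 p hp fun hd => hpN ?_⟩
  · exact congrArg Nat.cast (show (eSevenClasses.filter fun c => isPowerOf 2 c.1).length = 23 by
      decide +kernel)
  · exact congrArg Nat.cast (show (eSevenClasses.filter fun c => isPowerOf 3 c.1).length = 4 by
      decide +kernel)
  · exact congrArg Nat.cast (show (eSevenClasses.filter fun c => isPowerOf 5 c.1).length = 1 by
      decide +kernel)
  · exact congrArg Nat.cast (show (eSevenClasses.filter fun c => isPowerOf 7 c.1).length = 1 by
      decide +kernel)
  · exact prime_mem_of_dvd_2_3_5_7 hp (hd.trans (by norm_num))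

/-! ### Type `E₈` -/

/-- The steps that produce the reflections of type `E₈` from the simple ones. -/
def eEightHints : List (ℕ × ℕ) := [
  (0, 2), (1, 3), (2, 3), (3, 4), (4, 5), (5, 6), (6, 7), (8, 3), (9, 2), (9, 4), (10, 4), (11, 5),
  (12, 6), (13, 7), (15, 1), (15, 4), (16, 4), (17, 5), (18, 5), (19, 6), (20, 7), (22, 4),
  (23, 5), (24, 3), (24, 5), (25, 6), (26, 6), (27, 7), (29, 3), (29, 5), (30, 6), (31, 5),
  (32, 6), (33, 7), (34, 7), (36, 2), (36, 5), (37, 6), (38, 7), (39, 4), (39, 6), (40, 7),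
  (43, 5), (44, 4), (44, 6), (45, 7), (47, 6), (48, 7), (50, 4), (50, 6), (51, 6), (52, 7),
  (54, 5), (54, 7), (56, 3), (56, 6), (57, 7), (58, 5), (58, 7), (60, 7), (62, 1), (62, 6),
  (63, 5), (63, 7), (65, 7), (67, 6), (68, 6), (69, 5), (69, 7), (70, 7), (72, 6), (74, 5),
  (74, 7), (75, 4), (75, 7), (77, 6), (79, 4), (79, 7), (81, 7), (82, 6), (84, 3), (84, 7),
  (85, 6), (86, 6), (88, 2), (88, 7), (89, 6), (91, 5), (92, 0), (92, 7), (93, 6), (94, 5),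
  (96, 7), (97, 6), (98, 5), (100, 6), (101, 5), (102, 4), (103, 5), (104, 4), (106, 4), (107, 3),
  (108, 3), (109, 1), (110, 1), (110, 2), (112, 2), (114, 3), (115, 4), (116, 5), (117, 6),
  (118, 7)]

/-- Orders and representatives of the conjugacy classes in type `E₈`. -/
def eEightClasses : List (ℕ × List ℕ) := [
  (1, []), (2, [0]), (2, [0, 1]), (3, [0, 2]), (6, [0, 1, 2]), (2, [0, 1, 4]), (4, [0, 1, 10]),
  (5, [0, 1, 2, 3]), (6, [0, 1, 2, 4]), (4, [0, 1, 2, 31]), (3, [0, 1, 2, 62]), (2, [0, 1, 4, 6]),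
  (6, [0, 1, 4, 10]), (2, [0, 1, 4, 43]), (4, [0, 1, 10, 23]), (8, [0, 1, 2, 3, 4]),
  (10, [0, 1, 2, 3, 5]), (12, [0, 1, 2, 3, 17]), (6, [0, 1, 2, 3, 47]), (6, [0, 1, 2, 4, 5]),
  (6, [0, 1, 2, 4, 6]), (4, [0, 1, 2, 4, 31]), (4, [0, 1, 2, 4, 60]), (12, [0, 1, 2, 4, 75]),
  (6, [0, 1, 2, 31, 60]), (4, [0, 1, 2, 31, 70]), (2, [0, 1, 4, 6, 43]), (12, [0, 1, 2, 3, 4, 5]),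
  (8, [0, 1, 2, 3, 4, 6]), (9, [0, 1, 2, 3, 4, 25]), (10, [0, 1, 2, 3, 4, 60]),
  (8, [0, 1, 2, 3, 4, 75]), (15, [0, 1, 2, 3, 5, 6]), (10, [0, 1, 2, 3, 5, 7]),
  (12, [0, 1, 2, 3, 5, 33]), (6, [0, 1, 2, 3, 5, 47]), (7, [0, 1, 2, 3, 5, 54]),
  (6, [0, 1, 2, 3, 5, 73]), (6, [0, 1, 2, 3, 17, 26]), (6, [0, 1, 2, 3, 17, 75]),
  (12, [0, 1, 2, 4, 5, 6]), (6, [0, 1, 2, 4, 5, 7]), (3, [0, 1, 2, 4, 5, 62]),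
  (4, [0, 1, 2, 4, 6, 31]), (6, [0, 1, 2, 4, 6, 82]), (6, [0, 1, 2, 4, 6, 119]),
  (6, [0, 1, 2, 4, 31, 60]), (4, [0, 1, 2, 4, 31, 70]), (4, [0, 1, 2, 4, 60, 82]),
  (12, [0, 1, 2, 4, 75, 85]), (2, [0, 1, 4, 6, 43, 70]), (18, [0, 1, 2, 3, 4, 5, 6]),
  (12, [0, 1, 2, 3, 4, 5, 7]), (14, [0, 1, 2, 3, 4, 5, 33]), (12, [0, 1, 2, 3, 4, 5, 48]),
  (24, [0, 1, 2, 3, 4, 6, 7]), (18, [0, 1, 2, 3, 4, 6, 41]), (10, [0, 1, 2, 3, 4, 6, 60]),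
  (12, [0, 1, 2, 3, 4, 6, 67]), (8, [0, 1, 2, 3, 4, 6, 75]), (24, [0, 1, 2, 3, 4, 6, 82]),
  (8, [0, 1, 2, 3, 4, 6, 119]), (30, [0, 1, 2, 3, 4, 25, 34]), (20, [0, 1, 2, 3, 4, 60, 82]),
  (20, [0, 1, 2, 3, 5, 6, 7]), (12, [0, 1, 2, 3, 5, 6, 41]), (8, [0, 1, 2, 3, 5, 6, 61]),
  (6, [0, 1, 2, 3, 5, 6, 81]), (30, [0, 1, 2, 3, 5, 6, 119]), (6, [0, 1, 2, 3, 5, 7, 47]),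
  (14, [0, 1, 2, 3, 5, 7, 81]), (12, [0, 1, 2, 3, 5, 7, 107]), (6, [0, 1, 2, 3, 5, 33, 42]),
  (6, [0, 1, 2, 3, 5, 33, 62]), (6, [0, 1, 2, 3, 17, 26, 40]), (4, [0, 1, 2, 4, 5, 6, 88]),
  (12, [0, 1, 2, 4, 5, 6, 119]), (6, [0, 1, 2, 4, 5, 7, 62]), (6, [0, 1, 2, 4, 6, 31, 60]),
  (4, [0, 1, 2, 4, 6, 31, 119]), (4, [0, 1, 2, 4, 31, 70, 82]), (2, [0, 1, 4, 6, 43, 70, 88]),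
  (30, [0, 1, 2, 3, 4, 5, 6, 7]), (24, [0, 1, 2, 3, 4, 5, 6, 41]), (20, [0, 1, 2, 3, 4, 5, 6, 55]),
  (18, [0, 1, 2, 3, 4, 5, 6, 82]), (18, [0, 1, 2, 3, 4, 5, 6, 119]),
  (12, [0, 1, 2, 3, 4, 5, 7, 48]), (14, [0, 1, 2, 3, 4, 5, 7, 87]),
  (12, [0, 1, 2, 3, 4, 5, 7, 98]), (12, [0, 1, 2, 3, 4, 5, 7, 118]),
  (15, [0, 1, 2, 3, 4, 5, 33, 55]), (12, [0, 1, 2, 3, 4, 5, 48, 77]),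
  (8, [0, 1, 2, 3, 4, 6, 7, 75]), (9, [0, 1, 2, 3, 4, 6, 7, 102]), (8, [0, 1, 2, 3, 4, 6, 7, 117]),
  (30, [0, 1, 2, 3, 4, 6, 41, 75]), (10, [0, 1, 2, 3, 4, 6, 60, 119]),
  (12, [0, 1, 2, 3, 4, 6, 67, 75]), (10, [0, 1, 2, 3, 4, 25, 34, 71]),
  (12, [0, 1, 2, 3, 5, 6, 7, 107]), (5, [0, 1, 2, 3, 5, 6, 7, 116]),
  (6, [0, 1, 2, 3, 5, 6, 41, 92]), (6, [0, 1, 2, 3, 5, 6, 81, 119]),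
  (6, [0, 1, 2, 3, 5, 7, 47, 90]), (6, [0, 1, 2, 3, 5, 33, 42, 68]),
  (6, [0, 1, 2, 3, 17, 26, 40, 86]), (4, [0, 1, 2, 4, 5, 6, 88, 119]),
  (3, [0, 1, 2, 4, 5, 7, 62, 118]), (6, [0, 1, 2, 4, 6, 31, 60, 119]),
  (4, [0, 1, 2, 4, 31, 70, 82, 90]), (2, [0, 1, 4, 6, 43, 70, 88, 119])]

/-- The certificate that the classes in type `E₈` are complete. -/
def eEightCerts : List ℕ := [
  0x156f40445bd010d6f40425bd01056f40405bd01016d404de409c081369026e204d6409b0813410202d8809a8813290202d48099c81309020ad48080b3a0264204b84084352020ace8080b220260204219d01084940415910101604041525010864404210d0105604040525010543404218101083d40420f10124902028680829ea020a7880841b2024e2048640809ea02027880829b202105e80920811e9023c20404dd01013640414bd0121102412046e408d881013040404bd011d9023a20462408c08117902024e808d4811a1023320454408a08113902023e808b88101354045a408b08111102202043e4080972022620404b5011290224204344086081052e4040499010f102024a8087481091021020424b90105264040479010b902023a8085881051021a5c8084932020a3c80808ba020f20404590101102225c808693202123c80828ba02021e80820810516404004,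
  0x8f8a041be28104f8a040be28100f8a0471208e4411bd01c90336a038a066b749066845df408cc41995077d0231106616f90403b681174832e38c822d90403ac81160832f10457208ac4100e8a045a208b241148822890403b481154822a1044c2089641125075502281044f2088a410029a064341d0408073d02251043e2080135031eaf117410201ca40888410023a06008c818dd6c8b948100e2204008081801fa0631582bd17110214906007281801c2062a5429d271102119062320842418019206225027d524106c830d9041920c00ad030d26106a502109041320c2641044830924116a50201a1408324102c83059040920c1493528102d0a04033281044820190603208049b528104d0a040b328100c8a040920800c008000,
  0x579a0a0de6828179a0a73214e8429c5ddbd0436bb901a5063490c6b74908687310a66210cae9214c442185be85d282974842e23c866610b68dd282960840790c4c215dac95d282828b536101e42eb085268a36020a0a2d35840790b0c213196c942c0414145a3b080a2d198422a029a08436010a057282828b3f6107c809a820f578c72147242828b38610011d0400464106eb65f90a32214010104003f41054b057ae08517201ca08007082000e20c2253a15c20a1c21846a640324100051060d27d54d5040a10c1b4f2015a080018830492a428896a080c21826974004418149c2141a428692a0804218168f4010c053882850850290a123a8200300d048d3882814a20a0c2140141459040040010516404,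
  0x4cbe82116fa083ebe820fada083eae821bddaef8169e2c31b60643630c6b74ba108271b0c6672a271a0c6270b7c8404de418badc719085b2101365062c378842b908562101351062d10859210a4421448424b54842a1084c210964212686d02109e421148401909cc310e7abc651083e2100642430c3d9e4dd6cc42100642130c032105861bcda60af4c02473206019074c30c5612f93aa53008dc581806419b0c2a5429e3ea3402380c308530089be81844a04fc254a0c1b401b72c30652408cbe81834985f5941012850609a009b26182292482faaa083ea882024ca0c0b400b56c302514bea0820fa7a0845a8820104a0c03408941800c5a0820fa5208459e8212ea208092180100802204,
  0x15e6840379a1005e6841cc883a1106d77bb6dc83e48385b6a0e6b74ba13fb109333953fa90931385be853fa9892eb7103d50a2da34fea624b081e88515dac953fa98900f34283845149a2c94a9141422898cb64d0d1c450348a22a34e212439eaf10c450f90a71091ecf26eb640a0e1120528848de6d3057a54890a1122a584be4ea3469120c224532253c7d5281388386d0a44886349f8e10e21409441c268121989254880a10e19408c41c16918527088069100c21c2281088380d1305388405088029100421c128121c008d3884014a2100c22002001c0100602208,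
  0x3f542cea459d88b39aaf46c620e2eede841b5dc8304635f3a240a099e3dd449a1d482d1d1893327f4ea624cae8d8841888830b7dba45974882e2692d3620aee222cb0441691408b4e824a487c48583c1099d049551408b4882496cd22c1e084c88249ecc45022d060924b4c8b0f20bac403c1098304915014d0821b010f4d0b0f20b0c40f90135081baf176f5081ca692ab62076808c84054fc762460b46c840c90471db123455234fbf6244eac5e840b90451a3122c42825542b51222429f70c480680c115630a8911a990431631205048a551a24349f553542006086a8754486d3c8056840281115eca890525544b50801820a819d121347a4124a767358806a692a10042300681230004601c8b13b38cc40151281802065989012388b00b15ac5ec400100848f62402006450213b3408,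
  0x2c12ad7ba89058245af751205044b5eea24160b5ee824daf175ba6dce6238d2eb81339cc39a109a50c2fb95200eff3824b6e16fc2c120595e892b371137d072dc2c128694a8928a26da0e576b42c131772e8924a26b20e5268c2c128697a8921a268a0e4c65b26160902cb3448f578c5414e41c8710067284120b0481654a246cbe414841c7b3c9524019495048bd050907014141c6eb69124018c890488d04e9070e4c15f1a5726d04cd070a91c1493a4938a39324d1a470323e8252b9870a26e3c8b4291c04821c4300485330e0c49c5d038148b04c5dc12042886008c9e61c088b80a010a08931774482c1286904810621802225d8700201a091609131774481411250d289058240b2090211800108380382483019040c,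
  0x3ba22006e8881d0903a9206d765bdd76e75ba5d31125a991342295e963ccce56fb89c2dfadb75b88f7d8d922dd59b08f7d79922bb5aa2c947867d7a12293469d43478e7d7a122632d93489eaf18a862a8910e85419b2f92a490f679375d4bd1c4903492152da60b391a18920e4895f275746d04853148d27d52952444d1350c32249c50a34910f42d33048a91e144ca14910bc46148e2401a4783122822034025490031200523c088840a0c8208062a880349001000f004004044a0c02218,
  0x3f5450ea4a1d89439a13aa266d77bb6dc8327c9900616dac81a1cce9b44301dfc508195196f1b206270b7d799d162eb71b56d132baf3222c586d204722e5243bcc8cb038972aa043a2e4b64a1c9727b31024b92686d2b28980b9151c4b10e6ebc65d444c7c8725880bc9eac10d2ea3263b41606038f56101cad94ea5190e642034552301bf9f080c95ea3528c791610162a64491004df4201f54a0461c6403698044df420218d27e18711010a0430c6402682a19852550c31100ca04622003482491c4983518480251e8b409643c0e4a0189302a078045a1e0108878011c4a00a0098020108f0052ea20802214,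
  0x110732fc2c0529d1960294e6cb1add0ed77b7ebee3b1ba6d2e6850440fa75206672a8093e9d08125c28c00e39c245361b71194f4b245b66af1142476085caed66323848f830b82438ac10b949a28e264121c7c185c122b032e2a65b260e4c8c5123e0b2e2247130439ea0c8a13487260393c9bad9409c4180ac5260af4aa51470d8649d468d462a63705802a50230e3241b42a862702461c44842810c319209a22331247023a7a25200618890650231120b22a148e005d2afa400c08e9e89480309207a251f0320878143946580c00ba55f4807411e890800d020d0f00123ac880a0a50ab2c05288b0480255f0800a85cc2220056820481197d030082b8614,
  0x451d52ac264c0d3ecc265f6db5ddac964db9a6ce75ba5d0a91aab542e6672ab8a31d30b98954df8a055cc74d2e23512502cce70b96e5c9b474ce6cb95eaca646d0e8cb871a4d159807f367524154a33196b300ea453a48868e46b152a18b6d848873d5e21902870640a2fa5c7b3c9bad9034929c38c2e1006517c2e379b4c12cce1bb7942e0a12c3042e23984253aae86891f061708314b5ec90906e22a554addb38cf0909a30cc2d7b04241a4cab80cab36e9210af5838cf0904d271989204af565c4c06854b749020638648180053884816918521ca22e04288b8086386480821c324040029c4240344c1439465c284b83655164c0411c32408708900053864800950d7afc2605288b8522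cf64c0d2ea3260270890027c420247b3610,
  0x21ce468eac6c39d9439aaf46c650e2eede8a1b5dc9304a32f5a580e09f4ea14b1a1d48504532f5a58cc850455a42a58c2e8d88a1910587b32c5f6eaf3164658b8aa6b1994293873a2858250aad66ba4d0a340504a5734a600a094ae674c02810e2d229825b3518094ac5d4c13d9885042ceb4a5886c8928a0a95b56500a08897694b0f99087794d9620214a234444d02489616010e90cb0dd78bb7a8a0c93c08ca485876808c8a03013ad7ce9613ae10e097b2eb4b014107393a96162a95eb043824ee3ad2c2e410568cc0082b366034090c99b4b06904006368600680e08d319d4b08d3c8218b198102893eaa6a8a00c10c30ea9809a0c10c30b298002b4500608d459f4c0292a9941820a819d300226959607a4124ab76f59402a08c9e6580608d28754c00d0608d28594c00c1057d3e9803a310608c193d4b0250a08928694c01410328b6960131a44965001406089a55f4b014a20a050424794a5805026850521ce414,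
  0x4871f2edd300f132edc300f132eb4307376bc5d0e9b72475f0644cce3b524746e644cd5f72a20069d50795dc2df870931521829371560b6f283c9d090e62a4304b6d246ba22488498a8cc125aa91a4889061c247cb86086cf662465a224984871f2e181baf18a8209398f21d01123e5b30305f20824863c533c952e54ebb410482c782c02e7b0888644b251ad1390b0099b422198d2b936ac44805cf6110a42c01e5f088292aa39324d1201336844191f452a6ac7835371e41a2401e5f0882a2b0a44b58f02a4e1e904920401853328f06c28d2563c088280a011e265da8600200c218b478161280a0116888091e265d58600a08928694c00401832fa8f0210c0116878108f008916c300162f618,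
  0xfd51a3a93476268cce96fb8ddaee4fede4ca80b1ee654d0ea4168e8ca80b36c6543fa7532a494169d4ca9398688ddc9952e934485e223871654aee226882da41169cca9490f891a010f9cca955045a432a4b66934021f219527a8d045a0b2a08ce8a94c9a14a087c165436829c8a823222a1542b8468429341484546e88c08a8711a995da0a0a2a153f1d95182510a8238ed951a2a91a7dfb2a27462b90451a32a2c412aa0ca8890a7dc32a00a1f52b99501236aca8990431632a024529950d22104a5732a1b48a195011b5aca87904823511950510a08771d9501214cca84d044654044d2b2a0f214204284885044084ca821a3f6540464f32a162140697214304281c9a043974ca8153b3654129d2140459150112a0e26806810c99b2a0570828087a2a24254145d05011f414,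
  0x2a0e651864220a7de864220a7d9864dced78b7dd366b33a5d4e8b424806ad70899ba222574780d1b2112db49bf0e04627c325665a92fef644930704627c32516733a8702313d9924b21913c88829f6e1921b0598c18bd3444220a7d686446bc62a088ce6442f351117220bd466436be411190c88ed2f19111529926b7811182c88dd68a24f215c5d644611c982b1349582b8b0c889e2a9493a0538a386c35fd86441a8c81a094ae644289b82c2d0a8f478047421101214cc88312717406052480a9990883c01b9508808c9e644208880997cc30013b3618220a7d786424050c58441e009c48440480088300a0711053e9432090b125c32120265f42200400822c885c91018f48c300859f618,
  0x3f5470ea4e1d89c36bcad56f745b9d6e974399c75f4c9acece995af791d31385bf5b6eb710b5f1b36576b36192d3a93451c4f90d9b4b6741c9f1e3318d49a44f507c8a8e278873760cd97c8727854bc9acc15ea341e18c895b274f37b2ce86d2b288d2965d1e61519d09aa61b208faa51c4e89a1446233a2182c4938a14313a1e85a6614954a265074068045c389b06a311081444060e4e0189b02a04028ea0e0281904241c4e00e00d80e08438029751070104430,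
  0xec509dca13a217b2406d765bdd76e75ba5d3214591a232a3452bd30e189c75b60e5490c2dbafb75b8de5b6a490acd85a85bdaa242bb5aa2c947d7b2d2931a34e9ea3ea766949b4564d0a86b66341291d0efe0b483a9e2f984850f05a41fadd7f052417a1ca41d2a90b0524182ce468481c912be3eae8da118a6291253aa50e5109a16a18246938a14220bc4d308c838d47028914ba300922d0e820009190e8291c8d27008820030f43a01188e80d00872800c8b861360840a0c62062008408001c0a4d830880045c020670484902c624,
  0xe37ab440dea91037a2446f76bb2d568733add2df8d70498c76359e8498cadf713850a06be387492dd6e2140dabf0e96986d86bd5daabc4714e52a933d9d0729c973765b26913d42718238bbc67c872ea0cd94e872ef19f18af26b2697aa52ef11f152a15b1e91a853922502960210734c1b4ca56291a4fa38a60aa04206698268d8640138862981a8108930210b1042954742884c0544a4614840214ac3a051a8e8312280e0345c1c6a440402146c3a0527415083e838065d461c064123120d1c91034a200840ace805021107004448c0117438,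
  0xc57ab4a062bd1a534395daecb7b4eaeeb64b3ab4e3a9b99bd5f71385bf5b5bb711a084caad5216e54b04786976624130da3be27202891c776b3e31692e53200d36d54f90d50cc65b26913d5e3155a35eed8782b42a0cd91495474362a295f587c7500472356306820330da1f0828d0c9c944094e950523ac4e1b47ca6291a4faa52a1cbbc87c1a91e34e1d50c7e249c50a34bbc67c0883168d84a160123286c0e351e0a25d228c44004ece1d01c1438d6901a4f01210c91d02601a060e3524028d49016843c819d042055e45018aa4a0d29008c1446233a0c22404cd0707af41c18012be824,
  0x762a4ee549cde714e6941b5deedb720cdf2680285b6b406873395cb627343c225d9128481a7db12985ae98044f4c4a5d6e369af62d1b1a82c36a2805ec8a75014956b17b503d29229c40556632d92d067b88a64d11011593374a01c59345404a49916d06201dc38ed410186b055945f06201f2ed6f395eaf10a81a10b3da5528d1305dcca8eda0f4a309b29d5a521cc8942a10b3697528a9202c21a5bdb251927d469c2cf22c4a2c54c895680104da314a0439468036a450c2900089b4607289008502512001a4ca3082692a94280128f49a26248e46a0d8049a360a85a04b236072a00c84420c46c6ce60b360010599b002148140120a440102a3600834ba8c50913b8620,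
  0x169d51a739b5273420eead49b5deedb72301a3e510838616db109a1cce9b44301a3bf8aa130a3865bc710975c55f70c301a3ad62a12e23ad5b6a4a48e1946cc42586ab59ae9e5b81ab03158042b0025612d868584f663122a504d64b4acf66a47d29281f32118010a3af508dd78c467d14a018090a3af50901793d53b2ea2503b42944ac1a010a3af508c95eb04682428ebd422c552be613e948e08d10022458702cbe2b38298d20803e950e07d52811871a109a2003e950e081449f861c484329e4da15814002290e0292a8c1a8e008005290e004294670069049238a902a14a2380947a2d02591c03a31185400e0045a3801088e001285529008031500528840109c004fa52100222c,
  0x1faa56752acec559a1d6ed77b7ebee3b1b9acce9b444efe268cca8cb78da324b851801c7388ca6c36e2329e968caecd5e36912392f2931906392f2aa1c4a5e4b4715e030e9793d54892bc93072bc62832bc448e2b8873742f142690e57101793d582812a85c1c9cad94e9c46a8e293257a8d288554c6e190054a0461c68c368c50c4e048c389188502186346134446614831871a3030c48c3281189183e2092458c38d180c30c68c185182488049120b22015072ac0c2c634603189180c890891011224050e2ac0ac1631230090591200568400c8a1202234,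
  0x502d2b515995c2f356007197ad506d77b3298d0a83a16ec2a02f5c5477137654bb62eafc425d6e2c5aeca1ef2b4421f6d20432605255a18b02aa04b0053250c0208c00729f3a94248ea1a38638d3128618a8e43c30516cbaaa20026053673140f90eb781230516cfa2a21826479a3b140ed1105066e6daa7072b653a402d7ccc31e380c51c1664af51a1528a9912363e578a50230e34a2546a6a349f861c4943c994f41703018d210e00e2a9344811a4e1c060044b62201a2617360f027450160cd5b4ba94189943440947a2d02591e06025abad5421f1b3ed371917a50e166d2e2501e008b47802111e0152cb43e910814a256150859b4ba940a51090213c008c840441c0cd048083d362c,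
  0x128abeb71415da4f3663b56ebdb730176e8732a9632372ab9c4e16fa1de676c0ba8a4aa3a1f2f2360036d218b103c3d1cd543125b250e846640593434980cedebc6d3d00041150c1d3021cee3a8c5f21cb01bc457ab04a230396db120611828b3d91520e54aa7528c6d0e65483451c6564ad5748158a5192f1e7a9044a14faa55c32de389036860008636a90431a4fc38635bdaaa40301064e0d480b107d2cba9026832bc33042cf19e0ac1810c751aa4048127062401001859b5480124599e082492839ec8a7500351809d4689012812f459e05a002466780c392c0d9166f22002a0f8045c1678ab591f00238ac1f4a4a056517c18802845004b4f678010da2850247c1624,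
  0x40cc97195c2eb743b5deae952d662c29eaee8eb76750192c8a634d86dc6836d9a80458731262c2bb5904870610c49ab0160cee1ed5614924a5290b0ad2f47a207091f222c0c2ec03cd5138291d262d1d3b6e19102001ce913841448e43d10d724eb0b6ee883ea84d21d392b57892562974c886ca04e2ae2b27982bd2aac51cbe612751a582af8b0e01400289169c14c821400a25a34e0f08914a401aec70f0954a31b3e8703505066d243c1f8c15857e1e0f26506349b3c05288480c00a40da9e084b4f2981ca9c09a2408d270f07c0327f13859150007819e29be18747b0ddce015660184189c1e894193c01000f043c070642453a701884000a2cfa880681068f00523c69c050e06426cea700a512e04008b3e2202e123c49c819909048f78c60082b862c,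
  0x21bea6bca6cd75ba154b151d7d536363a7180bd8ab956f4970ab91d43412d5b687922581c8cb1895dacc6480393de3101802d8631292251c8300421c62035744593075ac2d4487077f134dd9110e7a812284d234148aa3a66441c842dd58a04c09a641fcfc5d107d2b3299ad16ad16c7406d8f44144ebbe4cf81000a753ea201002482a5442c91a35189702ef943e195300592a22002a52e04e6d87c0a0cdbc87c0a9350a0993f62438776b3e0a12b6243e03022933ea7c180c6bc87c2a9343121b4930d12c95c6a206031a621f05094b2a1f0181147a2d3e16454296a2a4cfcf510904bf97110141986d0f83d0804edc87c1f03208f8645ae63b2a20c0b751a2205802065f5440330f19f008347c0276e33e0528f18921097f2f7d440258e9af112148ca2202f0edc47c10df531202233d8e0441424,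
  0x11d04c8eac6c39dad333a5bee376bb93fb7935602c7b9ab343a905a3a35602cdb1ab0fe9d4d590d05a753564864a237726acbace5e2238716aca4e1ce96905aad66ba08fa6407043e745c0e045e445c0e045a445c4b66a3810f911713d46822d05ab0464ecd71224a5a29410f82d584d041e735c08cfd5ae0aa1906536821d21ae1ba2302561c42a8576828295854fc76ac4e8c46a08e3b6ac58aa57ac128ae411468d70082b36b804aa83561a41001ada2e00b0fa95cd58091b56ac3c8218b1ae10289108252b9ab09a088d7008dad6b8267d2b5c024c803cfa2e0511608771dab01214cd7064f3e6b8044d2b5c0f22c20458488b044084d583583a6b80464f35c1622c069722c304581d28d1b35c054ecdae04a748b01164ac045591a4496b403418b17b5c0a2c858087a56242ac145d0b011f42c,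
  0x762d0ee5a1b5e772b3dbdcb6e75ba5d0e672b7dc4daada851646d4c2d7586c4d8badc64b5eacd85ba1858e3529d49a2b74d0a6c6a436632d9d3d5e3028ac99bb8b46c6d46cb99a20476e33152ee60b07519b51f28d6f225acd25e9e0e8a0c6a1b58cc25b274396c1e4505b5074a2349f5741b04d53068925a52872d44d0b50c29211c50a1a80d3a7d93200046455288840a3e13138723504c0400813848150880c1cb30322e18480292a1e02983a8cc801a01981207040a878021e00c9e848240102c83c,
  0x7a7543774dcdaf2b55bdd16e75ba5d0e671d7d52ab03706165d44e0badaafd599d853a2e2382d7c71a149b6d861b36aed1431784969d2d910783c6631a9acd9c9d0f50ec7cc8434e4e86ec197ae60e854bc9ac9d6ca343918c694b304511a0dc04d2b20912b65d1f6529b60daa60b288faa50e03d0b186db610236249c4ca7906106b6c0b4680429a360525518910099e46c170a85146c034022e1c5a0150814a3660840a22030746434b3014050d5ac800a0a0c8148580dc03c0c5980e08351000435f546404015133860,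
  0xeec9c03baa706f76bcad567b2b89d6e974399a74951704f8b55e60e54f8c2da6db75b8dbabaf5b08a0ccb4c6c1900e9e40ad86eb6510975363e21b4160cea3cf198ca64cba3c1e5d48d87f45450664ea1d6a315dc9a3d2ea36c1f54aa950b59a4bd46a158c895b2743a274df06d2b28802220ea20b7c22749f0211d0d8c25a0e5f03951053e08a1a20924e21f019128b4cc292a944ca0780d190b830e4d41a8f44274482210f20848022463241732699205073eb6360316a01808c4400a292b220548834ee210071700a3eb5b600a0e0231110043c9af63c240102c844,
  0xa5653932b85daf2b55bd814c75af5d0b75aca9a0daa3b89ab406db75b8b16bb593ec969d4924862fc86cd8533a0fc00859965b615a3a912712cedf5ad430c54721ea5653e082d97c875bc096c3c001eeba4f6a3057a8d2f31912b64ea50f0f6c6c254ac4e34a59885af8e3602ab55304064da4661b808f30cb8a5141d93a875a8311a9a9080408a33084713c994a22d0a108148d8091542c14226511b01f00d130b83856f229d66051a9b03610814193001830e4e83200d268d40a5b00b03409b997a9201411e22e0e2e80e43c8a0b6a03820d44805050f06ccbcc900c84b660,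
  0x1e5d96ecaed276b316b3758db954a37439980df5db955ce270a72b6dd452551d5641b25a70780a3986cda5b3a0e9d6043d93489ea079150c1d3f21cee08a55f21cbf1bc452c2dc2e534b35182b55a5782b61a3350c2942b0c79ebe112314e8e1446276af836958ca6928ae9024d22091cdbb5f0301307f1a8853ea951095cc6f57c2788804d463e10c2000f5f2ab5092711281637c1202bda47c06025a547c0b4cc356af6482e1d638935a8844a5611a82410f731f0616586f81a0143dcf4900117261d0a6d7ad41a92023cdc4ad4108d4d4592044356e06480c393c080164ce3502a0b83851de90900a06411907178076307519b5078e7d7a1202021ae21200474757e909000bd1644,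
  0x443a3d22bd14036bb2deebb73add2e994aac0e09952a295e98dcc4e16db75bd56ab2342c8cb21171bc860af754841fbb95c22c36598bdd4a11457a8d0a96ceab088f51a832510c91429b844563b0a86b65f3097b3dab5dc219cbd7f050ca10146c87087eb749946cdd8f110874aa5c27d1810daf8ec46b34e449008a0b76305742d2ee9e3762995a894ea94411226d30848d27122974bc4d23148a96e0441001e52350943c0ab5b1a84001f5182b50523927142cc024ca36a0402306c6a034021d0a8b820c1ad9821028320519304002c189002864cc28498023644f2085c6631b3985c,
  0xec8ee8a21d10bd94436bb2deebb73add2e984732a3452bd31e989c75b470da376462e36ebed86cd790c56cb8c5168dd5181a39462bb46acc96a3150f6546274d911896cc64d2978bd480c5ab9e574062aa28fd8342a1af974bc9ecc12c36ad7e95d0bd3808c9ba35d03831d5fb6ba1126c5af75b6ba1bace368c04a1541ae8292a57c7d4d234451427224a750a991a049166b5c02d100048d395c012349441001a3ce570011a71b80bc4d308c8dc3069c6d0229746011c48b57008002460eae0148643154d00882003072eae00230737003402351a6002e185a021028d0640e428020073000c5510029680c1c8a002785a2f485844318c8858,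
  0x428bb38e6f7a2143f6704daecb2585baeb74b5a55c14832b65c4cd9ea0801e94f6fe7e59a830d9d85482e379aad66c34a6e8702365e3ae05ec943811b3efd704c622baa13e868823932d781f58b0a1a08ee1c55e0d94ea963a340bcab9ebf0bcf17cc2478b51b39d7e185ac7a1241c34bc38fc22aa502c167234ca7200af8ec04a29008469778dd81e209252c2401d128b50c12349c50a080100326952be09a3619071a9c03d0c296b7c0d420014e2c57c06852390284440514963e0320d42891003982010a51b505c30b5043044002faa3201006320c2c040250ac7001289a834910296a01288800204022cf86014022cf864,
  0x1d8c53b98a65743b5d96f69d5dd6c967569bd537138eb6921a67a476616dd7d6edc6f21401a6daabb152c11400d45c75d89a8ef72480a2568d7bb63b18b3172990069b6aaec7aa866d159342a1ad98d2d1af76c724749071a64ed763a9e2291c959fa1018730dabb090d32763b002550cb186c101986d1d841468d4e4a2049f43afb0e486d1f298a4494ea94a872ef23b17d85244aa1818b58c986938a1469778dd8313a9849b344c0e35390a2449008924044940e08083a8835d834b906464900c9240340c1c0225f06bb020251063b0e9f64c80121081401834c982289802f831d8090953ab640184a8099a200f5e880409b8654,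
  0x2a18ec39763195e8e176bb2decda63ad7ac8a82d68ee271d6d6ed9974a9badc6f301ac9f58b5dad1264a1c30fa552c223cad9d508c2543c9e91e1152b42a1ad9148e43c3452ba7a6bc004017cc25886777e3f1fa2838d574abc082bd0e8558c0960b391a0807244868ec543a4935abc12a35531f8dc9d52890456777afc188b4941019b5919869389e4ca5e06109b66040009b41ad419050e35ba024452e9445812eca3e01c3a2684428872da8152cf6f8068183984064f2282da8313286d4108142831882170e02326e8d741774f1bb06924052d82cda5b20021ae992030f78c9031b3965c,
  0x616e3d11e164f690cdaecb7ae27ceb57ace88e55c27d4b1253b66569a6eb5230b26b361408a6b545008f93d9c62634620bd50a666e31368a826150d6cc687d1d0d1e73843a9e299f6f7241a869fadd0e1a3ce9081a776b76064aaa91d30420336d795762d472c244af910f011d1eacd428840638dc682d1af76c722282030c8d6568188a8ad091c6ccd44ca14e22d10006b7855c0124114840d80dc0240acdb5e51b04d230c8da3422e631c0452e980ad71e7ad8200c11a73a73501c1872840d1446847004558a6d03556a0d12de453ad4068182861ce1018c205c40623b79ab3042053a7a4b26062aa28143284062a890dc6c8a719830722c029c8803e4a200c0039adfa58,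
  0x1a3ba3900d1dd5c8343bddaecb2b7acceb64b3ab4e3b1b5da75f713850605135e15f01828a73d2be1bb71a6dba1ac1af28dca515578860a95874af862d267a6c01a59cabe152a18f4b64d017aa25fc1829d7bb6be14cba72b653a551d21838556b63e13401528d58c1a0aad6b7c1051a853928902290e6506d2e958a4693e8e45073eb63e04a0ea3615138e219147d6b7c044420910ad1202871adf0510440a89429166c880e0e192cf8f80a353e04c3e0b0345c1c28a5b1f0192cf6f8168a169591041f4483a9d110ea74481a3948028a5adf0449200a28b3264414692b221a58888253b8644,
  0x20035ee7b24b4d577addd9507439962a94e50a80e35db952ae270ac871b4543566c496ea416adba1a251d576b45d1c87a933d9d0740a7053eb398aa0ef808c9a44f5033043862f0e3c21cba2c9e53a38bc36f0550b43854b3fa56c279321c11b8d76b6092a9508c5848d429514e6149af866a04a21d9e87280a79e36c194ac52411f43854ac3a57c3206f62eeaf81219b448f81800d2d8d8268c80271348d44b688df021368985071acb4d6c1758e1be1a194054bc3532f64814b52d6adc6c16047e2c6c0f04e5d47c114702718a1201a2e300245cc55e04c320491b02401ab91b05022da909034442b1969207013b5fa5240f2249980e8ebb963c069921b4091b60111a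8cc05021689090029648824edc644,
  0x261cde9738c140d6d699e5e21b5deedb720d1f27002cd76b806873395c36270a72de3718bae2aba5021cbd7ec60e16c38f3d8c5c6d3491a30e5bc763161aacc66425941a11906c1ee6b0496b748038732d5824f4a836cfa156e45603253248dc3b75b9297cbb5ed0d60c4409b78e18583bc8bdec61bce57aa74dbc50c1c08b9f4b630d10e0dfcfef630c93ea486081670cb8d1858aa55a7e7d293b11a9157298520803e951d86d7a7229409c500068800fa5476105120801b5f1c870c004a3d36842651b908c692a96409b4cc251344c491c84420618d9848b2660a85a04b266074623094060d4cc02001168cc0020b366004e8777550aad100b04821444c08143366009f4a45c7a1dcce858,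
  0x765080474e4d39bce29cd4c36bbddb6e419be4e2050b6d710d0e672b96c4e6938b8d673d8a13009a449b14b8d74980450e758a586ed69af5c8a005cdf6d885a8a017b229d884b6784adda441e94914e4427b15a4c965342974c64cc164411b6bb5b880b4571749e6e152973164adc770e3b98395e2dd721ae4e691f371f2d161405b2ee134733b480028bad56837a584b3ce3413a40021774eb40980450e7568224800389ad568324fa6d20014b4a75a0b150aa55a0041371442a651a911e04aad8dc1480044dc50a154dc2204a238dc080469c8dc0693314209a46a1069c6dc128f49a2624864741a0049a680a85a04b2680d919181224d8804420c4d0cba75368001059b400209880ea154eec4024147228040a9a00236014d384c4839bc7850,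
  0x3b19a77334aedf6dbb592c9b734d9ce873395cb627346d3f270c442a37390c54db8a94ad7a4311a89b4d79726d464a76d90c3450ef390ca4a65e94914e430ab31969403539c860e46a568a8337c9c31ba710c8d971463a6432030d609440aed6f395eaf103130e50c4863443837f3e43184d93a8b0e40a486132861c311c0dfcf70c22a55742c81470c30870008a4861b8ca59528702528c86269020011470c1489439450c42812945c301a41231a43925ae1850c3049744c1e9344c49161ca3690c24b543092b44c1eb113051f4ac982d26bd13098728be4305946ce181114c913089e44c065d3b260044d09945ee18121b2a8b261a70898027c4986d6dc64c,
  0x13ceaac00e75f3b30d0eb76bbdbf5f71d8dcd6674da2463afe2914c28e196f1c8a436743001c71cec526b25b88e194f4c8a5269af1aad66bb192620e2d5f6386441c4d26c70c8838997d8e4b46084cc1ad8e131051835b1c9eaa45b352c87241b42976b1c629166a586990d3aa9e8dd61614b102892136737a405e4f54ea84aa2707264af582710aa3864362650fb72234623553138a40152811871c509a51331b81230e28a194f26d110c0234b4720a418c38e28306a720c226db9008528dc83e2092458c38e280c60d6e40a51390492805125196059280a83a2c60d6e40614a372030a51960892805286596014d8ac29b2600a8149946e40a5116029328cb0015a2805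0650cc2c02268,
  0x293d596f35f3b54eb6b72c958e873269511370a79ba8a6fa6206dc42b4a1ed86ab59ae8e18da448e06422050f4341427b313c2d1699049a9d4a2392b4848add78c448902897658218602f25aaa8e2ed22011d7d7638855d2f582a1472a57cc28605f5bdf5d08d10022458f02cbe2b78298a052d0e3a14a7d280093a50161f741c030ebf4ae818046922d5d0405ad65deba102893f3502fa577ae8328c02361dbae836931051835b1c0a00a48a75d018216871d05518353c040529229d743800e6c478012459ba082495c45cc026f7370e0350c9ad6e1602b686aae81281876dba05a0c21f6e80e8c498960f7358207806022e74744fa29e001b0070e78dc1c4b8a5425e1a086dedc1834732e049b39ba0043a2d065c1c247c8860,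
  0x501c874e2556aae54ac546aa6131d76bd603396ed36434192cd6e331a44a10db0d5250ac4a15c940a9fd4e7964942d1285b25096db2f4bc4a13db4661122a980bc49e958bd2b9983e94a60f92d253d05dd4f40932fb7a3c6233e8a9816869e82e8696f4794cbe9e89d97514c0b3dc6de814a29e020132fc7a3257ac1100265f8f458966bd1bd17cc27d293d059ce4de8200448b1e8597c56f41000af38f4348200fa547a1f41002bce3d0095e6de84d1001f4a8f440a24fc579a7a194f26d13c0a001148f414840fd5cc060d4f404002948f40214a37a03482490fd54c02a14a27a0947a2d02593d0315e6e6031186601e8045a7a01089e8012bcd4c03f54500c660579a28042f4014cbe8a00a1ce668,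
  0x9b754e32b85d0eb76bbd5d2a5acc57737615017acea3b25914c69b0db8d06bb3500da5708758f3d8e5241260313a376c72aa5804b9bd2c70526031aa386c70c13a376470821c00219cec90923a34628e191c3228e6492430a24721e1408e43c96487d509a43a5656981c9fb4923050255571c9cad94e9c59a8e4f3257a8d58841a4db914c820a6d23723c25452900ababe3ae44a8d269c86a0a0cda48e43f100ac26ceae43c99418d26dc80b03c0206d1c86240519ae44a73909a246936e41e009a6924064b04a21100ac2453ae4188c5f61c90492c09260164b02a201e4538f40a8240cdc90193011258224c00a203a6ce8f413814013ab924060164c00c8a2c03228c0082b8668,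
  0x1d9e872ca6cd743ad54b151d7d5363602558eb78e3957b4970ab91d43412d5ae8792369021950293190c6815502680451c8a00b5742593075ac0d44980c6ab5cb1c8737415142693462b5c91c2b085eacd40ac06dc545ad9d87d3939562b24c7129f55bb3b06acc149b2c9dc3eec65325b0589163b11a510a9507caf41575fbb0ca340134382bb002a53832bf2db27677605066de4760c49a8548f1162185a5b0fe4cec14256c48ec06045267d5d83018d791d81e0e1658368a4c096a36d85abdd83018d311d8284a5951d80c08a3d16bb07c4124b21535fc8b59d8240185b12bb028330da3b008345c003ee32e03168b82a481a7d2e96381400a369ebb048030965576043b719708cb45c0276e32e1f2589e9297491c61614b0680144d85760321db88b80c8c1658a565190441454,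
  0xaee5453cd8aed5821698b9463a16ea260295c5197132d54aa02e9ddfb0006dc59a1a1e9f6d22428e4336d0292ad0c8440b0e9282c105b4491d1d5a3218b0e48a86009815cfbb6a7a00f9071e8126d691c5da224c8c9b29d408d0071e6cb08651c04bdd6cb08648d18724c842342a511aa094a7cd00608390a6d8412187e98263a109a100061c7b610741c7b5baba0d27e3258f239361079330c06366ceae8304e8dd91c180c6908e80e04b3ced5d055269805a720a659d0f4ed4591cde5efc0f0985c4439b66f2c00f105b2fa584300bc38c7e0943010e5edd740b43a3012d5d6ac0070c2d0ebd84161ad5b3eb080fc1c045c88e8b56d3f0143c0c9c11d0200b0ab9ec70a03b39755841006517c9a5c080874d8e8001e6b2e1206b666fa5c74336f2858,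
  0x5a6ba11e68c582dd72b4602edd0e659ab270e557b89208d4f895aee5004a292a8e8b20d0d0667a3d1cd541725b25a2840bcd97252062d065c931762c043a2e45468b392e5005a823a8a00bceac73a087124a588a7935144cc61269e92a9d349394265649528f2b47e21502b137224e8846fb4d7e1f54a54a1da91f86d22011bed35f88612022c79f5f87e450806351cbafc6c45bd4cf5f84001c4d6abf00895400a0234ae75f87423ca51f8b47189b14175f0414086a3975f8400145d6abf080062e6757e012459bf018097763f03abb0df83c61b492ec109833e8a5d821000a204eafc0e48b37e012f45bf038b82df8055d86fc2a3df3f83608384c29356c102a1cbd16fc022e0b7e072d3dbf002054e0d5add3608aca2f8320834e4f65c025a7b7e008a15a4cb80cb48664,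
  0x1e9aa25d71399d2a354bb5dc9fdbc9cf0163dce78dd76bd4166d8e79098682d3a9cf24325988505a7549e4e44341a48d05a7549e026ab59ae8a207043e749c0e045e449c0e045a449c0343a3810f91270252a08b429381688c9d9ce0723c115852704526820f39ce0467eae7055068329b410e90e70235747383e9c4293421411584e709111b39b9c27461340d2680471db9c2c552bd60942685c8268a70099a9c025541cf0d1340004b1ce02944683ea5739e0246d5ce0f1340258a70809a11134000491ce01295ce70949a012d5384c4d009229c282680a891a043b8ee7809329c2d26804954e02a64680aa11a06224681102139e3226804794e02ad46804754e062646818a11a0f0255424f1c13439268045d4e062d46804594e0119c23049a849e05708d0fc9a02b9468043d4e000253834991a0d28468,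
  0xac6d7a5cee564b7b86dceb74ba1cce56fb89c2db6eb42aed654aac0e997192d25bec550b0c366332a2bd4d0b61b65423d2d6e8aa3c6051554c2a10a9b6a541b2f946bd9dcc15eab932a9ce98de44b593a5d0d16806f229ba81b58c693ea485409a1e249f8ecba169114b64e0a94530a4c45a528a603418b18d20011b108e22102978fa572ce04629154b208005206ea40943e13162a01c938a14016026d7c3c0a844060e8c85c306a380a5a8d80a6e363c88941480b0481c1028666c01251afaa44816069dc58a78,
  0xec8b46d79dcacf6f72db9d6e974399cadf7136ab68acba9d82e35d164b0d0a4b5ea28e02addbdb48af8d5829d2dac8b03c62b499d3661ae698c9982a9063325ec6a83d604d1023b72b0896937470b3e9a25a83e4dac254ad9dcbd182cd9c95046a89bcd64e8735c160c713296a01a631a4fa9a15c26a8474492d215322812e636ad405a3c02852bad40524228820040a23b50060451c9d6a00d3a7d934200464351834e3a40840a3e1313832143157480a40a086cb340c774a0a844061b0e348170c2841439ab3802b168d8d080d81cd20240e0814733800928da58fa54a0e005d8bba70,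
  0x1093379b2c1bddaf3b959ec9616ebadd2e87339586e2604f51407adf4fbf55284ddb2e20da364aa5c64b55acd869541a4af66cf425bc72a1314eae9bdbc6ed8f1141c8ca9503eb1614df62b636622a554bb982ca7ca35bc016b0f8d8e34eecd4a3d096f1caa0858c81112485b0ca3a309a4ed093379b2a8452687882492d34408edcaa0744a2d430a484714283603490126fa2406c322a8f428860d20304a65112064b367d0f852270e40c04a24016024db43e064780306e240f2144d201cd304c2e185101852d674129943360d12aa450a94420365f28cf5400a1207040a199d0043cc1b6786009d4687c,
  0xc3b2b26876b92c2e7b7b1ea4eb61b0acce56fadd6b2a6ab42aecd6eb7192aeab29d91406646962e25b5b44a84c65b3a7abc60429390b862d1b1db002c92abd9dcc140be51a1e449908a8080d9aa0025e870248b44b6c3ab198441490742a3a048d8fa1c109b52d80d84d53278925a528736c088b18359c05416371c4ba45068648c288ca67060182bf2b235406421028f8b8544ea1e09c391a9c2cf22c4a111e6d7c4e0544e99d01824a9a7d3801839a81f5ac99c05c1a1811328878053004ea34480735c062c63481e61519d0293c0902412cfa74220d02687410004c589c6009d46878,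
  0xeaf585f36bcad56f745b9d6e974399c75f746c578c28bc5d6e37eacd86ac16be3768a4d14683188db5b0436352d847b36b960a93c69d4a83061cae9257ccda6a6451b39a6d817a2e8ca90c653a28129594ed81eb02829a4780388275b02d9bad9268c02791c9b6070aa52cc166a35928244870c95cca42c598d876e540da810b342f913831daa07d329e4f40404980272ea8198ac49189510a604a81a818024d725a80b45832b2654052150c1069c9481a20ccf1c875408802aba4da8034022e29138a155481081444060c8c828d1ce9050aa520a2ad5a0014951a6631401a0e4e0183aa4038215480014b0b4aa440010177065ab0,
  0x6f7ab2ea2bc6d795aac15c6c3add2e87331a78e8d8b0185a8dd5cd3d5ea000e6161b4c9f5193ad9067f9bc043622c1a2b8a4b29969e9fc3009cbd7ed90fa1008eb52c8814d3d4601f26550b760d1234362e995042805e422590d0a6b4ca8084601387a4db0184d296691149a41412256c253eb603b61b54c16511694a0e0080115abadb0f865b025b07436248f468042ba1db60e438308565b05a1e1497462842aa912d81d06a9548e02e0285420528e98206b769422106ae635280c08d391285c6a9551283851f6b2a0321a6980461c684141cab588812b98b380d0685bd3a8406009156b6a0389d031a603808d38d10021e611b380d00998bba88,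
  0xc26172bb5e56ab7b0298eb5eba16eb595341ab476eb6a80d6518ce02ae244dec17162d26da7d86cdaba49303d64c98092d385322303da4c98000971cb1c4b22b66a84725af2c0d472fdb2c0617c874743c1a38f300415eb9872de048e14cabcb0275b28d2f318d29660850440e4eb645a958dc895b171cb24cb20d52aa60c6e0b50138b1289162814a3009c3d26d80a215409b82940423899270324f031169a824551b21270424f00d130b890044c5ddac1774f19c02c210285369700608086319d6c04452d9382a50bb378ce014a2560d14b64e0a9405004089a807013d0079bd600782e25c41ed5280e08352301414709636a768942014dbf8b8,
  0x617ab71daf2b55bd733e75abdd0a756c6988969c375b5326b27d9f2069249b0c344429a29d802ad96808c2f198c6a6a417a8c432832096ec1a248801f66f2d401c1521e6b2c9b2b51c938e496608d49abe4722468c7d2a540a2e9129613eb6b60b186dd20d41802052aad2144047986b04ca14f4554c3554e9501b1082c653c9c45a782aa912d81208351bae0c468a60d65401811aa175b60344c2e1630dba80541000c6de5a60840a426ce6700307532a9ce9834d40602428ebd423431a48a18d9200a0e064f78c01804f23936c0389e1b829b3a5401c182072b120087486788a3a95989008026ce8b0,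
  0x3d757ca4d776b316b3758db954a37439980df5db855cdd6d472accec2b10292a87ada0d86cd874050ec969d2d910e4eb021ecd66ce5887a8383e6421a72c43b822b5270c43788a382c4e92c09d4a8e0a674cb01863f758034945830b36b780269590a8918ae9426d5c700681b895100653ea965d4580281165189040998202331a20092713419d3c8903c83045d154a9016841a61a406ad5ed18382d7c72c00801b791006513a69044019bc890160c6ceb952801170e3600a944ae5a00423535168c11003ce9a3071ba0c8d005eea201f4a4a01a296f6894050b0a51045e061cae80f888033791003c6d4ed1281010d71118023a35f768941a01351888,
  0x149eacb76af95b27545b934937439964df563853cdd45252ac836e215a5016c30d075768a193a8f43c2a07078cc6353508ad4728e90915bb065eb98c2a97914554d546981ed264c0215749660a84ac6833c82dfbea820912714f0300b2e4b81b54c78422db2a0a53e8b0034e30b6c427728895ab5b0f0845b65b0a807922ddb62046c491214317896a06514214e55b435b01841aee02d1400690816d8343b56d12055188200196e7b6c06006a25b6e0343b6777ea40022e16052be956a074596bc8e6ea8020018dbcb50108e187a8d9a90111d2b9fac480746434d502c068a5bda24014746e5cd1102e8389f118548e255a8351b7b54481d1b42976a9001150cd9f75a901c00bd689c,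
  0x701c875aa5538ae54ac576c06131d46d0553396ed3642f5b4cd6e331a44e155b0d3a4b5c9c28b649c26d0d968e09428c425e270788dc6ab11a160c6c6c55083824aad1095cd603d757c7c9d1af7b4422600ada63a843a3996d964832f5cc746c3ed1080800e279ed91e4306d67584eb652bd5581841a296c8ed6c8694b3047034ee24db2134725eceb08244ad87024bbb7db2191ac5dd6b64368e00837f1b640b288fa3851de92c83809ee1c6d90f4801b471dad91023624a34ba9d60ca7942092a6ed6c82d1e010a6d16c8291a3ba3ac0c468a5bda590d814507b5b2034022e0fd55602a102947581081444060e6f8321a6b01683452ded1080a2136d3567637c0fd51c031ac03820decd08027c3665e884201e35a8b8,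
  0x7805b273dc06577bb5e56ab0b56c4eb5eba16eb5a4b41b55e66302b4db6eb7162d75389b71aee8d6c3eaa450017cab66d6ca53663b0d9b306031e00859965dc252a65d223d9b5cb61862a390f0c610492ca52b794230435cc6546b60a57a8d3cb1912ad4ea50f0f6cb8254ac06290883002e8ad5b8054423a251b84114ed201d0e04a1e936d831228241000cd1fd48108e20e819128b431982ce8122a918bc1a068c85cdcb51155f7eaa0287a1828861120047b667c4024bb689c306ec33e0f0051ae7b6c150c51059d060044b6220c894ca21f113a4740a7583480e0a85548b6c324f00507040a19a60c1bb0ce83c9af67c240102c89c,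
  0x5772a29dac556cc1274c51295d0b75caa918da8cb8996c06da0db8b3434053ec969d4924864ea3d874e81e002a2568e8226d90b98724543105b2f9091e812d1693551a5e4c8cac8c4876266e9e989d409702355acb9a983012d8f6ad3090176ff7daa1a4e2520aad46a90d33d4867ea629408f30d885c18ca0d796aa2206de5ceb544d0f1c964caa3a56b00d9e7ad84421340aed308450030ae7346a61e4cc51168b1026e67b6c0c14735795205536b76baa00119ddb291c60784c2e2e05c3236b35306852a9addb60d842a0234a15aa40682677fa54407430e5880c1debaa62059b64b60602d47d899dd39200a023de362150cd75448181eb264c0350cbe5caa10052ab448040418abfa90041e433e1d0b33ac480d003935fa88,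
  0xe8f5ba4329b5d96f75db9d6e974c3219514155e997cc4e16db75b8d1ab361b35e428132a96dbc5145040b0b6dbc5966270dc3b72f0655697787ad462a5409a6b8ede282d93ca6fbbc3e5c51d94af64a4024dbdcee2212fd88b3a1a7054bd32c0e970af8fa44012bdaae21e2cd2e1644996024850035141b886e9c36b61d7b60169500897c1b8856aa42802a8a75b0305228d5c01e4e960308c9129d22974f46d33048d211040079c94c351789a46391b8e1a4013671d30943c0ab6b298304001a394ea60a42a4e0a10a15948200e3ae1e4b5306011a3a5301a011a8d284170c1a39d2042050640e3500682c14aa40050c1dd20e150008c842c6a45600c029dc48ac0,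
  0x6f7a3d22825d3e990daecb0571b0eb74b4602716632b51c4e15b3757f4a57a3401a5b02e22a57988bc4662ca7d9ed15eb1660812b8dde2832508731bbc2762a612f43624f922a8534ce18116b2980284d2cb98042a05fadd0a0011a5b7103462d653006574805c296100069a5b7102166904921801a8331076128b4a9778f10a656a243053aca5314a10091368e824691e913d25d50aa8c5479d56d509a562901422182913d26d503a2422c9346d503c290a0431c94c271434c060514bd36a83906a9549001408d392981517041835d3043748010a6034010070e3ceaa002715302c183a44050ca9804e2400088813c8b1d5814007d933ac4,
  0xcaf470571daecb7b1a8aeb5b30694a59fb89c2db4fab63d1258352bcab5136130cc5cb457aa844546a0c954b3beef029714740401893e42af620b397afe0c82474dd0404ba3bd6e8f108074aa5c24ca367540e108145d700952a9f9041e3b0c45a1d250c91c9d3c995226d3304068d64a41a424452e978994548282244994c29134220800f290adb06853d265518008b59e3ed5008042862d6d80e1c939b889126540381267253280a914e5501a064c021ce9600d0f02655adb4c040021b796982102bdab5da00a8044be0dc4072900c5281432a8161af6944a07045674480e0c3e4c481c04b17e0ac0,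
  0x19c98d7693b56b3758db954a3602edcaae71385b6dd6f41eacb0014b16bb78148e4ac68349ad2f00d0ecd874057a9563c3da0c944cdc5a1accbb6bc4563b0a86a55f3097b1808d2063b7818ad49c54220433ade0b95353a5e0ca54263e72f0513aa9677dde102007a3798429f422101a3cd2f0a1391248ac15d0b4c25420fc72f0ad44a754a56fabc244da66080d44f8a0349c489e4802e974351a009a463682a350150b5f1cb41a709405dd2400f0881d76a9430660b403627ca4049983a501c8024d9d2f05d0d168024515b50194c900e8a5b7a12a64a0880264915832f01524be0b40044519a80420a3465c418a02e550df9780b0f0d53b44a1144cda00a154008ea042d40007d4680,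
  0x100550e8e5aa715ca958aed80a3553216ecd67355a6c261b698edc69325a0d86bae470c96e02b1f487ad1420346b2ada44c420346c5fda4518a0a6d974da41d00a553fb4819c440152c9d691153a013d2c1690cd4b604eea68f483402d23c624afa4365f27402954b2d20a844afeada41d009ef60b48672f5fc603ae897ad20e81ceca1c7a5e90fd502534896826096e6e36f8f1080d1ac7f690e904005a3d56f0e13e9b189fb04a5af884026cd2d0cd1c14ef5968248700aa457b7c6095047776fb78169305028e6b7c2a00c6fe36f0ad44a74aabdaef0480ab63cade1226d30848d26c1b4cd2d0452e9789a46290ee8ad011462501468ff58094786b895dad8060bd8c8ecad601485ecb284e286b0600a689dad8060b78fbb5b0034021472ca0545c1060d7581081480329da2903765940b06ec9081432ac14ec9480240750d2b75402c527e2d11c0ea0,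
  0xec9008bb2cce65743b5d96f69d5dd6c967569bd537138eb6af254ba4be5c6dd7d60b5af21401a5baadf112dd1400d52c76f8340e5549db3b5df14315809900696eab7c6cb165b31934a5e2f5522a8a28cc3bfb01d7bb5e11fb068543452191b0e870d3acaf5b00e1a754deb60008d472a22b150c7595eb60209b4aa5263024fa4c0266b26d911a3e431c8929d42a649805aba4db225431592ec00c5ac6a434944880450e75b00e1a7a4cb00c4ea6126cd290dc4881c774ed608942062255a50224a0715008a1ceb604e3a45395819192840c550b4a0340cb4e40952c03402a793ad80e9f64d08121081401834d48118d4a39a12c018aa4a254eada1060e4ac04cd2107af48420391c78ac,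
  0x1d9aec565bb56b3058db9449b5cad1caa67138eb6ab06bda55b78b88eafb6114864ad45068d69d4602c943a4e1ece9b21082e98c9a52f14aa10b316d6d1a982802a8b8edf1fa4a189d5f2e92f1956c116a84902a222b74e2548a2672c861280d5f295854a94fabe46949427224a750a18adf764503575f98016a201224cb20d0464e46b4834945d1191265806df5807282335c3c35309a467abb52095b752070daf8e58159b87da560b887502530baf9bc90ab50a4f4c182c71f9500706831556004003935f6902400b1cf6d30a938f3441cd50110046c486c8932f03859f4d12d406075b02520420a2146eb420faf65a506803d0e75bc150cd6f6aa904e17042219f540e459ed40024048ac79354085333694,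
  0x8954924d3b5148075c05d6964121099512a54956d3adc4cb7d6aa296245a2ad5235d52d664aed8aa159ad968cb662e290bc5eada88bf6130586be430110caed601800ba569ab022011cad9560c174af480395d2300280738b65600e1a62249b6038319368b06eb38dae4062d9180bd5ed523e7eb0130cb18b6b606769680fa9a469900696eab7c509916a489b5fcfd80c4492ec09d0c04995b56c0996a3737298016950ec5e77b8024049f39604016249960288d02389dab605c358bcef7005e2698488293b2580dc4413a9366d80281276a580ba94766e5300542b179dee0060836a635560645062b9755b0044093b4ec07873179dee001a061a8d390170c159754b00875ee48405b12110a2c8d101ce408036d0fb5440a019f44b016da908989bbcf170809348517803871684,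
  0x30bbde887026acccc6d76571a95d75abd674472b653ea59ea9db35061af971186ab59b0a05ba3c718370ee0060838fe6dc0005c331a310492fa04047c7916a8fe62ab4d2d98d2663ac92f3c46906a662b0a4f46401a6d7ee003245548e9823402a6baae016a65152397c702eb3d61eeaa14442101072906e001221ca4a1886011ee285aa0440744a2d0e86734404904261f07860a7da65c09a36191b47a550c14f499541e015ded56e01a071108d5c73b54028447234f49754068752a9a202847111af3d54140a6cea16a82e2c04e4da16a821824a2d6e910b5ba4a21294840bb85bf8755068e49830151dbcd6a828b4068814a9ab442a7691025bd3688,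
  0x132fecf41bda0d55bbb2b4e16eac5529ca7595b2e266cf5241c6f498080dba1aed20de4c953b7a6003a252b071bd1e003012b7a59133256acc622ba1c814c9593d2600faaa85154f29d2a18ce99648e920e34ecc0278ba5184871a69e00c254344e92c87e03120e368cc01155281609651a650e34ebc0004da317c74821448784c6208990069b5fb800e368bc0268d015afbb54a265e91812411c50a0a9d869434f92209015afbb54a134643012d77cad907a35124e0d493e488168a46075aca60099868d70112ab6881a69270320d4289230c959346600902514ec54a1b1c69dd9a94187593442a36eecc4a2602fbb44a0a0065e45c29228b4cb21a04a29d8a941a5385491b7766a50a1688d18027c510256dc688,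
  0x6805dcf349add0ef76b85cac2a1aee92ce98b22c6aa5757d7ab5a6b326edc69b65a1006bd59aabc6943514940c7598779d25c1431e34a3a030244af4e2a64406d6497004b653a551d028501651ed5b818582a548879044920a347a72511a8521d2c974ac42451f4722009c576adc0260ea62151406a28c4e1e28a69cb822689383134a1d34e0849401a5c69c240575a97028810819a602a01a3869c30fd2600287cd30480346b26dc01a35047a334c0581944981a917b4e01013f265b70128b47b649804d2334e093099a609023ce6272a04c39e5c0223c94569c02821905a7050228d227114b498120134a89c,
  0x6b1bb2586bd76bbd54a358aa5d0e672a55c4e1473751d5743aa83b3c52f801b4d24e221aacc6640aa0d08e016d22640eb2238da43c8174a836cfa15be256030a400135dcb6f8795abb5ecee60a64b2906439f6edf1bccd38310b2e16f89d1eb40f268cbe384b0434bb1dbe30669787d1abda3560406a14dfb7c6523924914f0139a5e4199562b54c290009835e0270f1ab0e69590381778a21d35f01ae8a80828970f1280a032a6355be094d46d18d12b088a5b82280d28c1a0b79adf091988d40944ba8d1404a269712892c50125aa2abb25f022288ca6a0202ccc58a0150b480b5916280e866ee7a5be0c4d02432e2b04a560d404419e611405cdbc6a01479cb5629228b4cb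e05824ad7ba6a03486a3500081823ce62f00604a0,
  0xa03887472556aae54ac546aa6131d90bd66b3986d35db6592c06e359a4540ddb0d52a0a15046b26531b65412d1836dbac5e2a09e86a369a922a48b4e758195abbac06a95da9252f936f35bac08005a1cac5b35860c4409b78f385a1aac00116dd61ca3265f7584e9b78b380015b758689bccab0c93ea48100379a56162582b5e92f8ad3f1c0b3fa4be130a7394be2455c200142bcedf052140298fa6df0daf5840400a15e76f850095e72f80d0a094c7d36f8414482006d7cc2142bcddf04a3d36842651e108c69284d7cc99c2c8136ab04a26898926de5279c08840c31d60916558150b40965583476dbce0c4615a0c1aab0040022d2b00041675800a20896b4ce0582410a766a4081433ac00a95b4a08455b388ac,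
  0x1d91b0aedf6dbb592c9b734d9ce873395cb627346d3f279c442a37399c44db8a94ad7a670daa9b4d79328d871e73ce1a28779cce4b572f4a48a7338358ad24a01a9ce67032551b4c419be4f38c1288e4acb8a31d3338e578b74e20568b0a02d977019cced1600a2eb56d0de9612cf39683a900085dd3b683c65426c68f5a0dc700dd964f86b41152a9aaa0ee6796830a851c652ca1514ec1bfe72d081621f96777175a052252a010a4a76d0d12b72477aeb43b12fed4b4034824634920cd6be3b68381abe3968125d2907a4d1312458042ee9db42e132a9cb412569483d62520a3e95a905a4d7a5221008ee64b68723af6a968088a6494844f252032e9da9002150d41c5e52d012b57fa3521a70948027c5493b6f26a4,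
  0x6d30b95d0eb76bbd5d2a5acc57737615017ac8a3b0d9d4c66b25b8d06934d00d56b35d04812cd5e8082d6ef4018b357a0148812d5e80d0046926808234b357a02487840612d668090046b2680c2690e8e8404428e680fa81448e4acad10851bd02754255571c992bd609c5948e612f82bc4ac468c2ac1a558a651279e15629482ec6f084cab0a156229047e14057639843255864ae0d95605289586a311800c754c2132b84255884ae029b4ac25108805914e610615c1b2b80a852b02a14b8186d2b054424537840a57050ae029b4b818852b06214b805109b39e102e0695c052897030da5c13429584d0a5c022c8,
  0xac1c87612ed6aae54b4146cc4e31d2abd603396ec9a42c59a5590eb8aa69156532ac78d52acac5595cab23364ab2d1565b2ac96dd2acbc5593d0a534bc20b66b5925c45582e65f78422cd6b0d27f2a5a43424cbef08c2c2d6205127f0a5a0ba1a5e11e532fac22754259ee37841b407434bc23257ac13a11ee39840ad0d2b08321b13287de1148057a6610623503434bc2138a401560a06d9843e0606d98426944cc6e049f81b5e10ca79368886011a5a61052d4151df308306ac20c226de1008528f083e20925180577e61018c1af0814a2c2092b49b5d2b0595a0a99e25ac16306bc2030a51e126da4ac2256936da560299b75ac0fd52b029328f094ad2564dbc958015a5a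52b6958091d06c8,
  0x15da6917428954b35957d728d60255329ea23954cc9452b91d1d412bd0d4b523691b8a4c64321102cd4721782d4f0964c0cc436c06087310db010418210613203d6e830e978a134985f4214ab15144e3e9c9c4b1551b4645247325d309425f43d88469442a3137294022029b7e6526c407022933eb88388d89a8548f1301b0589166202013f3b4f2d8806045267d710561d072b60198511ead80f8b1534176ec43f0ef32449bb106013285b6e20280648de5dd881f2eeb6010492080236d32e21b169c689bbd88440923573710041a621d3f35b0009196d880c39f6c00a0ca2f9900400dbd8b7102811165b6e200801f72310ecda8d8004edc6c43e5800d1871ebc819072c914c1b100c016c31883cfdd6c0122e0b60032f85b107c84bc,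
  0x6f03a392a9c51aa554ae58ad56ebb5eb0184c363b2192cc66b391059141a4d341164556b35d0c80e3e73da072125ed039292f680cb20164ecf681cc497b4125901cd497b41659193b2da02cfd5ed03a092f6844b209964079cb699faada02d5d1ed011f4c8325906cb207485b4d5d16d0f96402d9cded01274c8425905612da242c8d9cd6d13964025e9900982641c76b68b0b237725b45e590c0b201364c846d56d19964342c8e1c56d01af4c86c59009e264295cb68bb82da027c990e8b204444c806d9321e16435dcb680a22643e2c80515322096408949900de2643bd8b6910b2014a4c88a5900a5a64089e990228a6442d4b680e22644a2c8053d322596402a29900f026448ceb682e226403949913cb201544c8a259180b227645b427113205ca4c8073d322a1645c2c807453201604c8,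
  0x1b5eb74b9dcac16f6e5b9d6e974399cadf71385b6dd6e35dacd862525a4d14e8446dab580436632d0e011439d630f578c55f4dd6c9e537db71f2e254b057a7c540bdb6c21948d44a759c7022573dec215c6d34af8fab27295f508dc268d0471033b1824a792c92169328a1029411f8ec0d16306b742e00f2746800474622d0840a7a1208a15835d0662b108b24c5226b2106a2f1f5b01b408c72371c300162869a6b5d04a1f0993004f415aed1029138a154dc6a4aae78cc150880c36190b860d1cda029aa660295814cb17d8c0682c120706081cac660085831055bd842416de3f7ae8,
  0x6f76bd2e772b2582b8d875ba5d0e672af1c4e15b375573057ac8ebdaf2091292a76a26883ed92090d3ecf68af58b4a65add7f12006dac4b1888c54025e73040009125b087c885423e670d0e664d1ae00e19d2d02334610a81448896464794a92106536984d296491149a41249f8ec2516870250cc8429852622d2943301a303569a54be7e0e86c421e860a21bc841310514c0b08141d035cf5a81801a6d06ba0ac522e964080e611a2fd1df81d1c0ec9d02df3f132954dd00479c70013138a1822100ba1c6a0e4780308e4202022a75bd842652a9b30642e183538038a6ada8257316ccacb716891802858240e0c103958d4010f0c611c7409084d03eafc,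
  0xd0ed7a582b8e4b7ae296eb5e2cecce56fac1c2a253a76ae9a67b1292d263361868a4bd4500ba9cafa6ea8428034f6fd6e3262aa985205b2f93a848045c33f9f1e0bd570d5bcbe20ac8c854c3c6d4d080a9b4123a3ea483309ac224958b8169536d8404460b1a3a34088d79a6380541a31168ba4506874cc36471484205401dae78d81c918511a0db8552c840435dcdaf0250f8b8d550a3a0e867b4bb58c1f1cd5cc6813820618e10d5a4ce51b02839f6b1a80c12d5d6ab400c380225f06ba0511a0dc02e0f4c1536d466029bc8a6e102c60d6e80b060e9b0de4536cc120482db55a82438a60d6b504013c8a85780504de153ae8,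
  0x5276b2d953e4ec9d316e4d24dd0e64537d06e140b7564d76b2b1b89d69479b0c366216a2ad42a3d2b374331e24e8aaa422196aa391a45353057aae309e91251550e4346d42ae8fa9250878a133f76420927e38a785a443b3d3240a62c0e3347082ff6a294b43850c6b06bf060b3abb6d7e0d0424edfad41e00a25d55f8011b10830546975584084682477f157e178fa572de020009296ab503054af6420aa591a30732835f84a0e189988fc131e107e4ddb041a30228671b420f9345b6420a48a6e1058227aba6be0201195a3504439aea6fc0e8c85c306a780406669c6a0287818536480f8a817b6d84374d0a6c6a5d0da3646a0a0a4625fad4380d0347f5a8025b33b37e0e1a9dc48af8,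
  0x198d50e8e4aa715ca958aed80c263b21a0cd67355a6a36cb6954dc60548b31bb618f0d0b171c683d68b3298c365a4452aa7dab42f1663c64b15461d5ceef6301820d9f6eb40354aeda0d97c9d92a20e4548ed1a0503d5b7230c15eab96c3ece30680b4bd9ab411252fa88274ba1a2e20b5ef66d0369b06ff348c1a4fa923a010a6cd5a04d2652eb88124fc761200bcc9d6302d360dfd9cd6288c7947322c6052622d1b32a95e3b1816210e2918069d2addcf5b18008d8847594271010814bc7d2b96f423148e9c65a2440b2840c5a58ec60943e1316330745e8e691027143102c113c0b75c82a110193189d82440642e18353d052decda00a6e3a348914284cfe59100b0481c1820ded1a0028b4b1b8c0e1a9dc48ae4,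
  0x1d9d0ed72571cf6f63d2dd6bc61599cadf582d644cf4ed5d8cd8685255d5153b2272978d2a167456933a6cc344429393a92c01648d424026ea05f26d612a56cee5e9e8ea0e0f105241d0aa7812363ea683409a2a1d124b4854c8445862856341404af8e3602c6e289748a0d1c918f8e652a3408410a236e8108147c5c2a1550aba09c190e14bb3795d040029694eb403839f873d6c1a11630c6c24370e8c6801858c1add07c72d811a02e0d05019054ced9d00a701153bb1af3a0396c0e00897c1ae83e3994a8d80a183b741004a5cc6c24370e8c6c1c049ad46c0e056346cae8,
  0x4b693b5893e4ec9d316e4d24dd0e64537d06b240ab1b8d74f361a11d6bd450a0d146e7600151e95ab21a0f18a8d822d586a3a6245608e56a6e30a2554dd0cab8daba549c514bd1d2354a9a28a498a1a14012ae9f5b8853f1f46012ca5cd7428510091264510c10105434eb70925a3e7205e9084c9617022dde59d02d18107208e80b1081004726400c805d264201014ac5a574178f006d0e758c004a865f664506a716c070010928a865ec64604c4e290a1295dd3adc7a524539102a148df8ec1804ba2875c8221cd753721f1502f6db083c04fb9c95b82e0c50ab8c0abda9b40142845ed5238dd3429b1a84832a5f06c20717657c69a03008e2d3eb9004386beb3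230a94c31e2ec72ee0,
  0x182dddaa74fa22de8a41a0110e8733953ae24829512dc6ba1a1613749422d54604c1b451aef8c174632d5a9e5e315a49f9b30d38cc59ade5cbd4a2e144bd984997c9b5be84d854ad9b4bd42153378f5c08d51076fa1b61ac5c751cd1e8e8b40385ae85347ce01a30741b3630c6349d93508b409aa11a3073ab3630492d215142c1256f82b805a3008e753eb80b8e6b46390842c31d4746c60b8032c6c5701e027dce4ae02f0c0069aeaaf42e398bb8e42a19ad19181a93046d9dfb182218ae9918028f8f0ecdae3809c194444adf91826011439d62854321ad2482a2a19adde5630061b1e0f224c8c0d14af4c7a0d183acc8c0c022c74fae02e013488e41c01ad8e35e8c3626c26010e748c048a85975238028212a5cd720083012b5a4900804b9476ece0,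
  0x3a1e6a8e4aa715ca958aed80c263b21a0cd51b5554dc6caddb0ce5ccf5a2d36630d96ce2621d80c5a214978c5664c579488f8ce6f106c94068264881f14725488478f8a95791ecd1060a2080635be59b8509955976b724b2051472df4e8822580675a237214a0ad41a9afe6e3e4dac26f76d07b2612a31c883b97a34141c5a2b71080454a441d028537ad6e379ac9d60eb43684705372f5adc284d65d910631a4fab102ebdc6b721464d026a8474492d215326856b4087466e0b4c0264de756e0a484510804f3bb75b888fc09546b701a7471f81d2c4002321aab24fe74880840a3e13138329ce2be522084023a72682803fafb2c3054220314267f2c882200cde5db10170c1dd1c405065bda370149cabfc5b2c43b16826313b04880481c300dab71b8029732cb862704ce9e2adc,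
  0xd0ef76b82b8e7b25854eeb5e25ecce561ac1110067a766ea065aae92d54d3613d10692bd50b3853165d225f4c93eb1615196cc44baa9011e02a2ce6af8653e4eade7ab947c54036835ab802a2104a99502794ba570248350ca9e309588034ac75578045724d0c106b1915d066249686a52128b0e306c702182c8e19214396c03472363f0253701547a3400a2c72bc098845423c1105535b157c170aaa147413838034da0d740182010c3242068034f6457c06480f289755740d2ef5bc05b48f5bc71a82e6a3e35ee75f81d1a1cf29555a8dc4c8b5210b855ed51b0051c1913a8f8141593a875a81c09c4b3ebe11034abaad7c0704418cead8ca0b46c8fc,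
  0x135d09a5258564a042d49d6c36321504df5d26a54d55c2459b066e291415653a0a809e4acc518a165a2d68bc464296506c098030e2a8952b09553e42030e6ded78076f89b61126d012f41c753d428c9b0411c8758c210a08497cf5f0360809035d55e0242a05d92be03c4d06a78925a1c199b5795f096088406306c780a9297a3563e068b38ea6d781c4ba2c0266d8ebe0b944641f049fdf072585d0758f80600bc58f02a1d1b2d55e03422de51e0783a28342bc00a3e4400fc8df5f04e0e00d41db5e0352c2b3e89204012672928180513aad5f00c1254d3ebc00c5c21b52cabc169c95ca3c02030e61b578050834eedaf0141d2bcc95f0180123d86be020336cb557842d89b05c33f993ebc07083f3e3e02d2b2df014109735abe048024794d7c1e0722bc941802e6ee3af8,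
  0x756932ddabe5ac9d636e4d24dd0e65937d58e14f375b89cab361148565d4506c341c3a02865e34e0f0a87275270f66aa01b5e51d8bd0dc37486326a08ad605053d1156cdd6a858c2e15494582cd469c1e85946e21512714f284da81340dc4aef610a53e994a91452242068c46da3c150a7528352ede10662b12462642a67b1e0bcdca991e0b40346bcabc05a182051c62c218037dce3b0885550637060646975584220f0a4c841302899edaf04c2478ca88f420022e290500999bcb082a512b98dc109d26de8c7608888555063b071760c8484327aa5845803873c6e1514d7bc8402a68f9d3e3b0341cbc211ecdae370a933e8b6d841c1e85947600938746f0cd0d08b40ee648f0,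
  0x4eb7583b53e88b7a290680443a1cc904ea25c286e5d6e2115ad84dc5da4b5458954d31d80434a32d4aa65e2714337973257c8c5d29e5e9e594fd84c3984f5811a1a46b48c1a59ab64a46f00320d0f8c3649ae1512a52c880934766fe8c1b1464ee1b1846b2504894011754900588f0885c6cb1836a0448432ea9d801e107e4d1b082d195147a3211fcd834f46070652cefd841e08a63480125101477e400881939899eabe106a4a466e0cd6102d52cefb84156b45c302a94e3773200340485e452eaf0820118bf9081f66d69b82e29070c5e149b18426b37490022574b86014a896bca4300c19190908ea9c8c1c0b46f75b1022568b8209d1b1b71b859b96440341e5d46e03d224b8c0a57a5b70215a8e180202568b821004575eeb04,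
  0x190e8e96a3528a650aa168b95d2fd36ca5138560dd672d9acd360b15a4da6330d5f4b3b8a57a7b4a86562f79149287ae9d840132b36ec52a16e469f2f19a84048eb62b145e8eb29d87c3b9897ac42425c0a3ad5ec513a30251eb200f5811a00df448a1a42831936c5802d9ba4c3943f5ec409a742b6eb200e154ad1a336da60cbc4128b6f169d8c3351ac93426ee622ff461489656f858c2c133ecdbb1058a328d6374b184401e50a562081261ca25bb620b15bad5bc0e6f183e994f27802c1b77668c1d253a2560ef7c60789306e79ed9e3056248c43861fa8021d184228e32756303c02e75dac605a440d70cfc1b3f1814856316d77865dd1068005421dd746211ecdae4601a0117148b0c73236d8828009dde8b101081444060f181cb1fe1b104609cd6cd62014e7573014152f5900051c1ecb1c9606ee9b81cbd118b4f327d88038205eae000296169549003c65be891c,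
  0x37a9d60ed4fad66edc6c20110e873241788970ab9ba93a7abd28261cca3608292e879b20d86c4474d54cc96532d611e4eb0238a053cf50e07c99542f208ad53150b0c7b16de1085830f8448a4a8d43a5c606ae5ee306134944d445268d02b9f59b184122462ba4a6eed1b2cdaf841b57176040418cc6b08511694b2ea270231e85ec7e262ad458d7b03c207834f3b957804046634841247a782aa911e0391e18c21475f82d241142bd35e01cab5724100d73d8e40a115ad904463d0bd8f00e840236269b202e731b700b80a152895cb8203478dbb0395ace48544b5e51d83ce636ec0e10a987f610321e10698836103409cb323001ec16e013a36370351b72ec8e020275655b081401cbd9d5f0303187f06c200cfbedc0727a76008e4f4e03c65d49920,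
  0x39273216a954e2b952e35dba984b191b8ebe8e639725343a50239d3229699adc4bbcdcde948b92aa7da7496b972126c9724da1a2928127db914bc5c80162ab5e9d9d82450a04957e45202617c9a00c3448a0b0635fe6b14cc5c8415eb98e8d87da45014184de80954a75b2d62f374d29660b7cc9e8b537a54c0dc895b3cd69e8354a8b0636a57b140c6e0b98138b1289164c0e8d55da4504003ceb358a1442a8137054c0846c3c08326064bd23d24e4188b4d4125e6d5e79301b212f48f5d3901a26171b5f85cc0bba78de81610816063538031a0081d57b14360dfd9cd6285d9bc6f40a514f070940b34d8a02802044e6074abdd52294aca7204043e05fb1407041bd9c501414f47c3665e914201e35a938,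
  0x6169229dacc5acdd273e552b5d0a760269289690b75b5326b27daeba5e44906c34443a0287402ad9680a0a75810f66a417a8741b83209770451ac60ec191142020a8765802292abd09398e2096dd096608d49abe5ca2462ba50950099e48038218325ee5a101010542fec00ca542afb79ac113266181881c8fc1810b87630b420aa1010e338ec1084984df46f55c1f082415548a35f879388b43c2bedf868acda31d8eafa74158c87550a420e82348d33779df81e130b910079224202a6b37470410babe9d8426ce6ec1ca30682dddaec2e868b820404859bfb0818090a3af600bc99d7502468402838120cdada0070a957eab080c1d3f0b864346420785a552420e204ec0c083ce8fc3a162f59082400adf904,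
  0x2f395deb667d2930d5b13ad7aa84f24a92d05fa660ad46d36d22dc58a194f1f5624c3d11e39ee7e216251d1e859824d8f005d2965301422aa8a8e5fc1f04124b294a51451d46044b3f257e2f592dd2f2255ab926093438f5f0955a818a4884cbb7bebf0d2882d0ed1f021068f04ee1d3afc0604423715f855371b06c5e42afc188e812200a9895abf08471141c6ab8f88f5d3e04a2d1e0d1b88f80ecf3161cb7014fbf08c480b49b1f01a1e0ce2f8f8190b8b8a7f22d57e0a0e55ac7c020261a4dafc100479c5f5f86c49eb7bebe110d2ae76cb9ddf03c113873abe0782286a1d7e0a84035d5a3e0e18539338db7df81e4415d658f81e112b0e95f8fc63bc71f066927e07044595cafc1a1d5ad8f84a118748f8283a1498f80a05168e15f06c1359795545ef8,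
  0x125528934ed45201d70175a59048806544a95c2db56b7132d65aa8a58a168a7568cc54a527abb62a4582b6522f99347642bd92b69c425007e974165c719b0d79100287bca0384c218ee387d74bc59c65008f39400f117752400b893146f582374c219ce382d18397ba02b501753c2400ba9b2e38c14d2360d3500308d047a3d4b00426224e9004e913ca1c00ba7a369986824ce31d802432c60c80044ba0b2e00a04c8a32085e269186825d1af5801b86824d0b1d8018431dc0048140eab58204022e454b042008d3ac760858e5872c0a9386825ccef580194cc5c00b9154d1c5820340c351a6382e1a08bc1b360021d7b940016c5000d0588036d0fbd820c16921d1b002db5401c4251c4a05539ef68003871700,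
  0x2a390c9592a313c99502b164934d3954ee260b6d8cc86853d9ab36f2f1aab865b3186c45eb498aaf682d97c9e22eea71b103229558b36211d94a022aa7f4b1092a308c2e480425fa548ac5d6ec41904854ae5881c369dd480422f6f34803a50112ad1ed882c06c6ee0b103ea516e79c803c30baf4801e245544cb105a2d056e5620495a325729006ebd238b44800b4a137fb24015aa98c49de590060a451a98cd0a7200611922420358ff9d88114ba7a36998f118d32d5881a30863c80044f08534725801a8f8c9586400b04352b6d882b26ff24801c8dc101a57bcec41804ad72401d1bb16640111785ba40101168f6400521e27192a9aa67b1048653509003c4944c900068046bd0c40c9283429d882714762e9b1010815c9f99baba0b5e201a0dd540029551026215b6d96206424cca214cbf1001243c0b694613bc013a275795c8d00,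
  0x1bd30a85020120b16e2b9d68f48405cad44f3856ca653d295e974137988bc4412ca7d9ebb5ea8260a36832506a76432a2f43562692282114934dce089a26b46128544b373823f5ba6d4899460b70ea410554dae08e14b0b442509b38d2082624b28ec25182d5ad9043611fc190412eec3862b5124473cbb208a55dbd410d3e50436112b99044031acfcf6081234aa1ea68c860702928c90154945504284ceb29043011ac4d56085203046107a18e4803a8a5a82170e65ed7b0414a73d434482138c0a7b062582070255651b201c80148dc307a3d2e08c1355cb20815171a148d254b044751410835e4e080c002db2187cbdac3208161c1a76192044425ec9040643638210b9b1c100ebdce08a77f1704,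
  0x2198db2de5aa71d8a958aba39695d9864844d1dee21359cd569b0986da63a29a7496820d8f155ea051d4d83a3d33075b881584c398aba2eee8c881167adc403c957ca12eab5c8819250774881743adc4062b5272630aafc881e22ee8c8819572513ab322ab5c882075986214fa11532851a4922b05522d30bba2a20ad44a7556b5101ea6a388244da66080d44f93034946b71cd089e5102e974351c409a463682a39834b799cd0d385302ee9440c04aba6450c1982e20480a67bc2c501c68bbadd2205d0d171024515b98194ca204c1bcbb7ac5044014444f6e9100a925f05c402228ce6021051a32e20c982625077488058a8f7d8e4508a266e2053b29a008ea042e60007d4710,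
  0x2858b95d080483bd04b375b25215a4c34d3ca05625db893522c1615e45a896e938451caa91eb1a430102b6545098283652f17aba5f2fd8342a1a290c9150edc70cb168e38b9505ccbb91c2c72b39c0d472a175672422c5a38e264046ce2d7142aa35307a75a4908029556450fad0c50a236ae283e50ed470da494ea1514ecc512ac5a28e2618e2172b14349458a2a3de47119460d647062753011cd59144c11c48e56286e68fa4b8a11d7b9c70f038d1ebd9204500c73424501c4802899d6c7083bd8e28486a9cd228675ee71c2e0dfcdaf6488d6a9c2fd7b9c70d00514ba58e1200c62f5b1c3369470d06538a450420a6c061c4af6289a8ef72434018cbe9638580b687dac908da51c00e39b8a09b4a383c3159322801f6d714,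
  0x30bbd30a040241b8b1533ad5e90a2395b29f4fcf54e826830d9ca85055568ae4c4dd368f57ce1828140449033a4f2fb72922b4d2d92eb4a3ac92f3c44806aae02b2a3900a4f4ed0c915520525472060a356a6515095181c801a45e457202888453e80e480c12a6b24841f727241a058db92832da5b904ec2a401d128b1875c81453b8e484d3c02ee5928441ddc99241f0792190042695c811ac70e402d050f5f25c90aaae14d720586408d2387200741ab79c800d4520088e594790e400ce38724047323903aa18dc80f3f9ee402e48bf6b901b7d65c911b85202c08e6492450bb8b92178d29c80b0a9b9a4a082cd8e40029f372004bb8b902a76a48017d7720,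
  0x2b3ad34af76b85249aa1b452cb85a24a18aa57d7d7abe66a325adc44b6526804235a0cbc4242514940c740aed272a9c48516a261c713c8d412d94e955ca50cd050b8c2d572a443b1b4e508225c54a0823528468f4b3592e50ee8a940e4521d39152ea505d71b14a1147d1d094a0f41e3a98854bc3a8e9250416806aeb92819a54a070167564a042e5ea940f030f9c9435c8a50511ccd4a02a280b791250556af94a0ac3dee500d1b1d4a0f485280b2dc2a505409da525039568728137d4a05cc52843354a0901a5ca4a09dd5286a25f6692877b94a025b52834021f092803494a0e0071da4a060751a64a03595282c0f0f6928,
  0x12cd8e473ba96aae55196299899623a131d90cea6b3977535db65854040359a46592210d532ca1504153298db32c3a9c6f196174fb9e0e6095365dc709300e9f73b9cc0f2b51d300f6344980e582992c95888a5bba4c19a554e8f4e4e13c0e37093055554b0fa357b473c0f3294a9248a7b71963333c56a3452aaf2960270f1cf3819629e0a600d746604144b878a608f7298094d46d18d14f088a5b824c0d2ae77473024662398370f3784981289a5c4a24b2604970efab9804451194e60405998b2602a169016b22c9830c5b1cc0621c139cd278252b0730220cf309302e6de3980a3ce5cf0fddd4e6016092b5ee9cc0d21a8e600255b94b0060530,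
  0x1d0f59683556ae454ac5bae16131d90bd66aed86c0512716e9b54d591ca65ad312acb58d491ac5474b90cd086d6eee687246b04a23aa29a15952e578c28e4f53402b4584deee68f66cbb80cda0e573476fd4d1a3fcce68de7b054d0eac1d6873473a94d0dcec2e68f35a9a1152a9a9dd73485194d0c2a147194b2854327b39a26dca688163614d0522536b76b9a29c0a688b8a9a034824634949f6dcd1adc534521a9609341e9344c491b2afb9a45e6a68d4352b9268701b4c7268381badf2682d521abf09340d52bb9a50a2a68116a36b5c9346a1abf2934282a66c93400f633497d54d024c0048d1268c4357df268023602ef193446056ee934,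
  0x4e2732184bb5aab952a991a8e389c8ab00ce0ac398e6703a0ecc3389a6701eb8d0338a46714cce00354ce2b19c5733804d9338b46716cce05374ce2f19c106f99c1264b88ce3199c184d235ee973c86e63383ea051215ee973c7aab7499c27542f74a9e2b9bac95eb05be653c6531584be0af14f18e353c1867834cf152a24f3c33c557d4f1e6f53c2667850cf114823f3cdaa7864cf20565383667814a29e1a8c4f35a9e40b2a7084cf205b5380a6d4f0944279a14f205d53881794e02a153c817d4e061b53c150579a1cf23dd53881894e206353818854f23df538050d79a1cf26dd5388f894e20665388f8d4e09a153c997d4e03ce544,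
  0x222d22e8612e966b242ae51ac04aba5327ad3a01a88a80417a97452d99e9d412bdaacb52369140a4c66b220237d5280200934328135a2810ca803c5a8d52809d1e246299402cb529a3a4a0304c943cd650102491eb7448e540509a4c289f5a74010a14aa80c544934d69d00fa7154e2d3a02958a80a936b550062eb4e805146b2e0a80c99f174046d1500a355400bbd500626d5280553ae4e80e772a01c76a80353ed74026a1570c65c25011b17ee808a17374081b1500aa0d6e806caadd7280654c4d97094038a22ba01b6f1dd0347454033a753a01c1aef6ca010190394a0121aa65ca02094a805184c7407b99500b8350de50200dd9b6500a032cd65011057dbe5004a9e82a036c6a80602a39f280b8668e928050535d9280a82b8df2800d02855f7dd0148259c250170c7b9a501313d1d250118269ba500b4e540,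
  0x51039a20e3442a68870d1119a22934454688b8d1189a2353446e688ecd11e9a240344846890cd1239a2483449268930d1269a24e3440f2551281a252344a66881e72a255344ac6895cd103d3544b268968d12d9a207aea8974d12f1a207b4a897cd103db544c268988d1319a207bca881efaa264344ca68998d103e25440f8d51075f544ce689a0d103e5544d26881f32a20ec6a89a8d103e7544d66881f42a207d2a883b32a26c3440fa951369a207d6a883b42a20ed2a89b8d103ec5441da951379a207daa883b5aa215d2a89c0d1389a207dca883b62a207dea883b6aa215d6a89c8d103f05440fc551076e5442bb151076f5442bb551399a207e4a883b82a20ee2a885772a215dea88736aa2743440fcd5107725442bc1510af154439b9510e6f544ea6881fa2a20ee6a885792a21ce0a88738aa223dea89d8d103f55441dd1510af354439c95111f054447c551156f544]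

/-- The roots in type `E₈`. -/
def eEightVectors : List (List (List ℤ)) :=
  [signedRoots (table CartanMatrix.E₈ eEightHints)]

theorem eEight_tableCheck : tableCheck (simplePairs CartanMatrix.E₈) (table CartanMatrix.E₈ eEightHints) = true := by
  decide +kernel

theorem eEight_coverVerify : coverVerify CartanMatrix.E₈ eEightHints eEightClasses eEightCerts = true := by
  decide +kernel

theorem eEight_distinctVerify : distinctVerify CartanMatrix.E₈ eEightHints eEightClasses eEightVectors = true := by
  decide +kernel

theorem eEight_stableList : ∀ Y ∈ eEightVectors, StableList CartanMatrix.E₈ CartanMatrix.E₈_diag Y := by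
  intro Y hY
  rw [List.mem_singleton.1 hY]
  exact stableList_signedRoots (M := base ^ 8) (tableGood_of_tableCheck eEight_tableCheck)
    (by decide +kernel)

theorem pPowerClassCount_eEight :
    pPowerClassCount 2 (cartanWeylGroup CartanMatrix.E₈ CartanMatrix.E₈_diag) = 31 ∧
    pPowerClassCount 3 (cartanWeylGroup CartanMatrix.E₈ CartanMatrix.E₈_diag) = 6 ∧
    pPowerClassCount 5 (cartanWeylGroup CartanMatrix.E₈ CartanMatrix.E₈_diag) = 2 ∧
    pPowerClassCount 7 (cartanWeylGroup CartanMatrix.E₈ CartanMatrix.E₈_diag) = 1 ∧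
    ∀ p : ℕ, p.Prime → p ∉ ({2, 3, 5, 7} : Set ℕ) →
      pPowerClassCount p (cartanWeylGroup CartanMatrix.E₈ CartanMatrix.E₈_diag) = 0 := by
  -- The orders in `eEightClasses` have the same least common multiple, 2520, as in type `E₇`.
  obtain ⟨h, h0⟩ := pPowerClassCount_weyl (hA := CartanMatrix.E₈_diag) (N := 2520) (by norm_num)
    (by norm_num) eEight_tableCheck (by decide +kernel) eEight_coverVerify eEight_stableList
    eEight_distinctVerify (by decide +kernel)
  refine ⟨(h 2 (by simp)).trans ?_, (h 3 (by simp)).trans ?_, (h 5 (by simp)).trans ?_, (h 7 (by simp)).trans ?_,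
    fun p hp hpN => h0 p hp fun hd => hpN ?_⟩
  · exact congrArg Nat.cast (show (eEightClasses.filter fun c => isPowerOf 2 c.1).length = 31 by
      decide +kernel)
  · exact congrArg Nat.cast (show (eEightClasses.filter fun c => isPowerOf 3 c.1).length = 6 by
      decide +kernel)
  · exact congrArg Nat.cast (show (eEightClasses.filter fun c => isPowerOf 5 c.1).length = 2 by
      decide +kernel)
  · exact congrArg Nat.cast (show (eEightClasses.filter fun c => isPowerOf 7 c.1).length = 1 by
      decide +kernel)
  · exact prime_mem_of_dvd_2_3_5_7 hp (hd.trans (by norm_num))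

end WeylClasses

theorem mainTheorem10 :
    -- type `D₄`
    (pPowerClassCount 2 (cartanWeylGroup (CartanMatrix.D 4) (CartanMatrix.D_diag 4)) = 10 ∧
      pPowerClassCount 3 (cartanWeylGroup (CartanMatrix.D 4) (CartanMatrix.D_diag 4)) = 1 ∧
      ∀ p : ℕ, p.Prime → p ∉ ({2, 3} : Set ℕ) →
        pPowerClassCount p (cartanWeylGroup (CartanMatrix.D 4) (CartanMatrix.D_diag 4)) = 0) ∧
    -- type `F₄`
    (pPowerClassCount 2 (cartanWeylGroup CartanMatrix.F₄ CartanMatrix.F₄_diag) = 13 ∧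
      pPowerClassCount 3 (cartanWeylGroup CartanMatrix.F₄ CartanMatrix.F₄_diag) = 3 ∧
      ∀ p : ℕ, p.Prime → p ∉ ({2, 3} : Set ℕ) →
        pPowerClassCount p (cartanWeylGroup CartanMatrix.F₄ CartanMatrix.F₄_diag) = 0) ∧
    -- type `G₂`
    (pPowerClassCount 2 (cartanWeylGroup CartanMatrix.G₂ CartanMatrix.G₂_diag) = 3 ∧
      pPowerClassCount 3 (cartanWeylGroup CartanMatrix.G₂ CartanMatrix.G₂_diag) = 1 ∧
      ∀ p : ℕ, p.Prime → p ∉ ({2, 3} : Set ℕ) →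
        pPowerClassCount p (cartanWeylGroup CartanMatrix.G₂ CartanMatrix.G₂_diag) = 0) ∧
    -- type `E₆`
    (pPowerClassCount 2 (cartanWeylGroup CartanMatrix.E₆ CartanMatrix.E₆_diag) = 9 ∧
      pPowerClassCount 3 (cartanWeylGroup CartanMatrix.E₆ CartanMatrix.E₆_diag) = 4 ∧
      pPowerClassCount 5 (cartanWeylGroup CartanMatrix.E₆ CartanMatrix.E₆_diag) = 1 ∧
      ∀ p : ℕ, p.Prime → p ∉ ({2, 3, 5} : Set ℕ) →
        pPowerClassCount p (cartanWeylGroup CartanMatrix.E₆ CartanMatrix.E₆_diag) = 0) ∧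
    -- type `E₇`
    (pPowerClassCount 2 (cartanWeylGroup CartanMatrix.E₇ CartanMatrix.E₇_diag) = 23 ∧
      pPowerClassCount 3 (cartanWeylGroup CartanMatrix.E₇ CartanMatrix.E₇_diag) = 4 ∧
      pPowerClassCount 5 (cartanWeylGroup CartanMatrix.E₇ CartanMatrix.E₇_diag) = 1 ∧
      pPowerClassCount 7 (cartanWeylGroup CartanMatrix.E₇ CartanMatrix.E₇_diag) = 1 ∧
      ∀ p : ℕ, p.Prime → p ∉ ({2, 3, 5, 7} : Set ℕ) →
        pPowerClassCount p (cartanWeylGroup CartanMatrix.E₇ CartanMatrix.E₇_diag) = 0) ∧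
    -- type `E₈`
    (pPowerClassCount 2 (cartanWeylGroup CartanMatrix.E₈ CartanMatrix.E₈_diag) = 31 ∧
      pPowerClassCount 3 (cartanWeylGroup CartanMatrix.E₈ CartanMatrix.E₈_diag) = 6 ∧
      pPowerClassCount 5 (cartanWeylGroup CartanMatrix.E₈ CartanMatrix.E₈_diag) = 2 ∧
      pPowerClassCount 7 (cartanWeylGroup CartanMatrix.E₈ CartanMatrix.E₈_diag) = 1 ∧
      ∀ p : ℕ, p.Prime → p ∉ ({2, 3, 5, 7} : Set ℕ) →
        pPowerClassCount p (cartanWeylGroup CartanMatrix.E₈ CartanMatrix.E₈_diag) = 0) := by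
  exact ⟨WeylClasses.pPowerClassCount_dFour, WeylClasses.pPowerClassCount_fFour,
    WeylClasses.pPowerClassCount_gTwo, WeylClasses.pPowerClassCount_eSix,
    WeylClasses.pPowerClassCount_eSeven, WeylClasses.pPowerClassCount_eEight⟩
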